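/- Notation. For a Hilbert space $\mathcal H$ let $a(\phi)$, $\phi\in\mathcal H$, be the annihilation operators on the anti-symmetric Fock space of $\mathcal H$ (the adjoints of the creation operators $\phi_1\wedge\dots\wedge\phi_k\mapsto\phi\wedge\phi_1\wedge\dots\wedge\phi_k$), and let $\mathrm{CAR}(\mathcal H)$ be the C*-algebra they generate. An element of $\mathrm{CAR}(\mathcal H)$ is even if it is invariant under the parity automorphism $\Gamma(-I)(\cdot)\Gamma(-I)$, where $\Gamma(-I)$ acts as $(-1)^k$ on the $k$-particle space. For a bounded operator $0\le Q\le I$ on $\mathcal H$, $\omega_Q$ denotes the gauge-invariant quasi-free state with symbol $Q$, i.e. the state on $\mathrm{CAR}(\mathcal H)$ with $$\omega_Q\big(a(\phi_1)^*\cdots a(\phi_n)^*a(\psi_m)\cdots a(\psi_1)\big)=\delta_{mn}\det\big(\langle\psi_i,Q\phi_j\rangle\big)_{i,j=1}^n .$$ On $\ell^2(\mathbb Z)$, with canonical basis $(\mathbf 1_{\{k\}})_{k\in\mathbb Z}$, let $\mathcal F:\ell^2(\mathbb Z)\to L^2([0,2\pi))$ be the Fourier transformation, $\mathcal F\mathbf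 1_{\{k\}}(x)=e^{ikx}/\sqrt{2\pi}$; let $V_n:\mathbb C^{\{0,\dots,n-1\}}\to\ell^2(\mathbb Z)$ be the natural embedding, $\mathcal H_n=\mathrm{span}\{\mathbf 1_{\{0\}},\dots,\mathbf 1_{\{n-1\}}\}$, and let $\mathcal A_n\subseteq\mathrm{CAR}(\ell^2(\mathbb Z))$ be the C*-subalgebra generated by $\{a(\phi):\phi\in\mathcal H_n\}$. Theorem. Let $q,r:[0,2\pi)\to[0,1]$ be measurable functions such that $q$ is constant $0$ and $r$ is constant $1$ on some non-trivial interval $[\alpha,\omega]\subseteq[0,2\pi)$, and let $Q=\mathcal F^{-1}M_q\mathcal F$ and $R=\mathcal F^{-1}M_r\mathcal F$, where $M_q,M_r$ are the multiplication operators by $q,r$. Then there exist a constant $c>0$ and a sequence of even projections $T_n\in\mathcal A_n$ such that, for all $n\ge 1$, $$-\frac1n\log\omega_Q(I-T_n)\ \ge\ c\log n,\qquad -\frac1n\log\omega_R(T_n)\ \ge\ c\log n ,$$ with $-\log 0=+\infty$. In particular, $\omega_Q$ and $\omega_R$ can be super-exponentially distinguished by even projective tests, that is, there are even projections $T_n\in\mathcal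 A_n$ with $$\liminf_{n\to\infty}-\frac1n\log\omega_Q(I-T_n)=\liminf_{n\to\infty}-\frac1n\log\omega_R(T_n)=+\infty .$$ If, moreover, $q$ is not almost everywhere $0$ and $r$ is not almost everywhere $1$ on $[0,2\pi)$, then for every $n\in\mathbb N$ the density operators $\widehat\omega_{Q_n}$ and $\widehat\omega_{R_n}$ of the quasi-free states on $\mathrm{CAR}(\mathbb C^n)$ with symbols $Q_n=V_n^*QV_n$ and $R_n=V_n^*RV_n$ are invertible. -/

import Mathlib

open MeasureTheory Filter Topology
open scoped ENNReal ComplexOrder InnerProductSpace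

namespace Fermi
noncomputable section

/-- The Hilbert space `ℓ²(I)`; for finite `I` it is `ℂ^I` with its Euclidean inner product. -/
abbrev Ell2 (I : Type*) : Type _ := lp (fun _ : I => ℂ) 2

/-- The `i`-th coordinate of `f ∈ ℓ²(I)`. -/
def coord {I : Type*} (f : Ell2 I) (i : I) : ℂ := f i

theorem ext_coord {I : Type*} {f g : Ell2 I} (h : ∀ i, coord f i = coord g i) : f = g :=
  lp.ext (funext h)

@[simp] theorem coord_add {I : Type*} (f g : Ell2 I) (i : I) :
    coord (f + g) i = coord f i + coord g i := rfl

@[simp] theorem coord_smul {I : Type*} (c : ℂ) (f : Ell2 I) (i : I) :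
    coord (c • f) i = c * coord f i := rfl

@[simp] theorem coord_zero {I : Type*} (i : I) : coord (0 : Ell2 I) i = 0 := rfl

/-- The canonical basis vector of `ℓ²(I)` at the site `k`. -/
def basisVec {I : Type*} [DecidableEq I] (k : I) : Ell2 I := lp.single 2 k (1 : ℂ)

theorem coord_basisVec {I : Type*} [DecidableEq I] (k i : I) :
    coord (basisVec k) i = if i = k then 1 else 0 := by
  simp [coord, basisVec, Pi.single_apply]

theorem inner_basisVec {I : Type*} [DecidableEq I] (k : I) (f : Ell2 I) :
    ⟪basisVec k, f⟫_ℂ = coord f k := by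
  rw [basisVec, lp.inner_single_left]
  simp [coord]

theorem hasSum_norm_sq {I : Type*} (φ : Ell2 I) : HasSum (fun k => ‖coord φ k‖ ^ 2) (‖φ‖ ^ 2) := by
  have h := lp.hasSum_norm (p := 2) (by simp) φ
  simpa [coord] using h

/-- The operator `(T f) i = w i * f (g i)` on `ℓ²(ι)`, for weights `|w i| ≤ 1` and an index map `g`
that is injective where `w` does not vanish. -/
def weightedShift {ι : Type*} (w : ι → ℂ) (g : ι → ι) (hw : ∀ i, ‖w i‖ ≤ 1)
    (hg : ∀ i j, w i ≠ 0 → w j ≠ 0 → g i = g j → i = j) : Ell2 ι →L[ℂ] Ell2 ι := by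
  classical
  have key : ∀ (f : Ell2 ι) (s : Finset ι),
      ∑ i ∈ s, ‖w i * coord f (g i)‖ ^ (2 : ℝ≥0∞).toReal ≤ ‖f‖ ^ (2 : ℝ≥0∞).toReal := by
    intro f s
    calc ∑ i ∈ s, ‖w i * coord f (g i)‖ ^ (2 : ℝ≥0∞).toReal
        = ∑ i ∈ s with w i ≠ 0, ‖w i * coord f (g i)‖ ^ (2 : ℝ≥0∞).toReal := by
          rw [Finset.sum_filter_of_ne]
          intro i _ hi h0
          exact hi (by simp [h0])
      _ ≤ ∑ i ∈ s with w i ≠ 0, ‖coord f (g i)‖ ^ (2 : ℝ≥0∞).toReal := by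
          refine Finset.sum_le_sum fun i _ => ?_
          refine Real.rpow_le_rpow (norm_nonneg _) ?_ (by simp)
          rw [norm_mul]
          exact mul_le_of_le_one_left (norm_nonneg _) (hw i)
      _ = ∑ j ∈ (s.filter (fun i => w i ≠ 0)).image g, ‖coord f j‖ ^ (2 : ℝ≥0∞).toReal := by
          rw [Finset.sum_image]
          intro a ha b hb hab
          exact hg a b (by simpa using (Finset.mem_filter.1 ha).2)
            (by simpa using (Finset.mem_filter.1 hb).2) hab
      _ ≤ _ := lp.sum_rpow_le_norm_rpow (by simp) f _
  exact LinearMap.mkContinuous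
    { toFun := fun f => ⟨fun i => w i * coord f (g i), memℓp_gen' (key f)⟩
      map_add' := fun f h => ext_coord fun i => mul_add (w i) (coord f (g i)) (coord h (g i))
      map_smul' := fun c f => ext_coord fun i => mul_left_comm (w i) c (coord f (g i)) }
    1 (fun f => by
      rw [one_mul]
      exact lp.norm_le_of_forall_sum_le (by simp) (norm_nonneg _) (key f))

theorem weightedShift_apply {ι : Type*} (w : ι → ℂ) (g : ι → ι) (hw : ∀ i, ‖w i‖ ≤ 1)
    (hg : ∀ i j, w i ≠ 0 → w j ≠ 0 → g i = g j → i = j) (f : Ell2 ι) (i : ι) :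
    coord (weightedShift w g hw hg f) i = w i * coord f (g i) := rfl

/-- The antisymmetric Fock space over `ℓ²(I)`, `I` linearly ordered, in its occupation number basis:
for `S = {i₁ < ⋯ < i_n}`, the unit vector at `S` is `e_{i₁} ∧ ⋯ ∧ e_{i_n}`. -/
abbrev Fock (I : Type*) : Type _ := Ell2 (Finset I)

/-- Bounded operators on the Fock space. -/
abbrev FockOp (I : Type*) : Type _ := Fock I →L[ℂ] Fock I

theorem op_mul_apply {I : Type*} (A B : FockOp I) (f : Fock I) : (A * B) f = A (B f) := rfl

section CAR

variable {I : Type*} [LinearOrder I]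

/-- The sign `(-1) ^ #{j ∈ S : j < k}` of moving `e_k` to its place among the `e_j`, `j ∈ S`. -/
def jwSign (k : I) (S : Finset I) : ℂ := (-1) ^ (S.filter (· < k)).card

/-- The creation operator of the site `k`: it maps `e_{i₁} ∧ ⋯ ∧ e_{i_n}` to
`e_k ∧ e_{i₁} ∧ ⋯ ∧ e_{i_n}`. -/
def modeCreation (k : I) : FockOp I :=
  weightedShift (fun S => if k ∈ S then jwSign k S else 0) (fun S => S.erase k)
    (fun S => by by_cases h : k ∈ S <;> simp [h, jwSign])
    (fun S T hS hT h => by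
      have hS' : k ∈ S := by
        by_contra h0
        exact hS (if_neg h0)
      have hT' : k ∈ T := by
        by_contra h0
        exact hT (if_neg h0)
      rw [← Finset.insert_erase hS', h, Finset.insert_erase hT'])

theorem modeCreation_apply (k : I) (f : Fock I) (S : Finset I) :
    coord (modeCreation k f) S = if k ∈ S then jwSign k S * coord f (S.erase k) else 0 := by
  by_cases h : k ∈ S <;> simp [modeCreation, weightedShift_apply, h]

theorem jwSign_sq (k : I) (S : Finset I) : jwSign k S * jwSign k S = 1 := by
  simp [jwSign, ← mul_pow]

theorem jwSign_erase_self (k : I) (S : Finset I) : jwSign k (S.erase k) = jwSign k S := by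
  unfold jwSign
  congr 2
  ext j
  simp only [Finset.mem_filter, Finset.mem_erase]
  grind

theorem jwSign_erase_of_lt {k l : I} {S : Finset I} (h : k < l) :
    jwSign k (S.erase l) = jwSign k S := by
  unfold jwSign
  congr 2
  ext j
  simp only [Finset.mem_filter, Finset.mem_erase]
  grind

theorem jwSign_erase_of_gt {k l : I} {S : Finset I} (h : k < l) (hk : k ∈ S) :
    jwSign l (S.erase k) = -jwSign l S := by
  unfold jwSign
  have : S.filter (· < l) = insert k ((S.erase k).filter (· < l)) := by
    ext j
    simp only [Finset.mem_filter, Finset.mem_erase, Finset.mem_insert]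
    grind
  rw [this, Finset.card_insert_of_notMem (by simp), pow_succ]
  ring

theorem jwSign_insert_self (k : I) (S : Finset I) : jwSign k (insert k S) = jwSign k S := by
  rw [← jwSign_erase_self k (insert k S), Finset.erase_insert_eq_erase, jwSign_erase_self]

theorem modeCreation_basisVec (k : I) (S : Finset I) :
    modeCreation k (basisVec S) = if k ∈ S then 0 else jwSign k S • basisVec (insert k S) := by
  refine ext_coord fun T => ?_
  rw [modeCreation_apply]
  by_cases hT : k ∈ T
  · by_cases hS : k ∈ S
    · have : T.erase k ≠ S := by
        rintro rfl
        simp at hS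
      simp [hT, hS, coord_basisVec, this]
    · by_cases h : T = insert k S
      · subst h
        simp [hS, coord_basisVec, jwSign_insert_self]
      · have : T.erase k ≠ S := by
          rintro rfl
          exact h (Finset.insert_erase hT).symm
        simp [hT, hS, coord_basisVec, this, h]
  · by_cases hS : k ∈ S
    · simp [hT, hS]
    · have : T ≠ insert k S := by
        rintro rfl
        simp at hT
      simp [hT, hS, coord_basisVec, this]

theorem modeAnnihilation_apply (k : I) (f : Fock I) (S : Finset I) :
    coord (star (modeCreation k) f) S
      = if k ∈ S then 0 else jwSign k S * coord f (insert k S) := by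
  rw [← inner_basisVec, ContinuousLinearMap.star_eq_adjoint,
    ContinuousLinearMap.adjoint_inner_right, modeCreation_basisVec]
  split_ifs with h
  · simp
  · rw [inner_smul_left, inner_basisVec]
    simp [jwSign]

theorem mode_anticomm_create (k l : I) :
    modeCreation k * modeCreation l + modeCreation l * modeCreation k = 0 := by
  refine ContinuousLinearMap.ext fun f => ext_coord fun S => ?_
  rcases lt_trichotomy k l with h | rfl | h
  · simp only [_root_.add_apply, op_mul_apply, coord_add,
      modeCreation_apply, Finset.mem_erase]
    by_cases hk : k ∈ S <;> by_cases hl : l ∈ S <;>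
      simp [hk, hl, h.ne, h.ne', jwSign_erase_of_lt h, jwSign_erase_of_gt h]
    rw [Finset.erase_right_comm]
    ring
  · simp [modeCreation_apply]
  · simp only [_root_.add_apply, op_mul_apply, coord_add,
      modeCreation_apply, Finset.mem_erase]
    by_cases hk : k ∈ S <;> by_cases hl : l ∈ S <;>
      simp [hk, hl, h.ne, h.ne', jwSign_erase_of_lt h, jwSign_erase_of_gt h]
    rw [Finset.erase_right_comm]
    ring

theorem mode_anticomm_mixed (k l : I) :
    star (modeCreation k) * modeCreation l + modeCreation l * star (modeCreation k)
      = if k = l then 1 else 0 := by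
  refine ContinuousLinearMap.ext fun f => ext_coord fun S => ?_
  simp only [_root_.add_apply, op_mul_apply, coord_add,
      modeCreation_apply, modeAnnihilation_apply, Finset.mem_erase, Finset.mem_insert]
  by_cases hkl : k = l
  · subst hkl
    by_cases hk : k ∈ S
    · simp [hk, jwSign_erase_self, ← mul_assoc, jwSign_sq]
    · simp [hk, jwSign_insert_self, ← mul_assoc, jwSign_sq]
  · have hlk : l ≠ k := fun h => hkl h.symm
    by_cases hk : k ∈ S
    · by_cases hl : l ∈ S <;> simp [hk, hl, hkl]
    · by_cases hl : l ∈ S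
      · have e1 : (insert k S).erase l = insert k (S.erase l) :=
          Finset.erase_insert_of_ne hkl
        rcases lt_or_gt_of_ne hkl with h | h
        · have e2 := jwSign_erase_of_gt (S := insert k S) h (Finset.mem_insert_self k S)
          rw [Finset.erase_insert hk] at e2
          simp [hk, hl, hkl, hlk, e1, jwSign_erase_of_lt h, e2]
          ring
        · have e2 := jwSign_erase_of_lt (S := insert k S) h
          rw [Finset.erase_insert hk] at e2
          simp [hk, hl, hkl, e1, jwSign_erase_of_gt h hl, ← e2]
          ring
      · simp [hk, hl, hkl, hlk]

theorem sum_anticomm (s : Finset I) (φ : I → ℂ) :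
    star (∑ k ∈ s, φ k • modeCreation k) * (∑ k ∈ s, φ k • modeCreation k)
      + (∑ k ∈ s, φ k • modeCreation k) * star (∑ k ∈ s, φ k • modeCreation k)
      = ((∑ k ∈ s, ‖φ k‖ ^ 2 : ℝ) : ℂ) • (1 : FockOp I) := by
  have h1 : star (∑ k ∈ s, φ k • modeCreation k) * (∑ k ∈ s, φ k • modeCreation k)
      = ∑ k ∈ s, ∑ l ∈ s, (star (φ k) * φ l) • (star (modeCreation k) * modeCreation l) := by
    rw [star_sum, Finset.sum_mul_sum]
    simp only [star_smul, smul_mul_smul_comm]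
  have h2 : (∑ k ∈ s, φ k • modeCreation k) * star (∑ k ∈ s, φ k • modeCreation k)
      = ∑ k ∈ s, ∑ l ∈ s, (star (φ k) * φ l) • (modeCreation l * star (modeCreation k)) := by
    rw [star_sum, Finset.sum_mul_sum, Finset.sum_comm]
    simp only [star_smul, smul_mul_smul_comm, mul_comm]
  rw [h1, h2, ← Finset.sum_add_distrib]
  simp only [← Finset.sum_add_distrib, ← smul_add, mode_anticomm_mixed]
  rw [Complex.ofReal_sum, Finset.sum_smul]
  refine Finset.sum_congr rfl fun k hk => ?_
  rw [Finset.sum_eq_single k]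
  · rw [if_pos rfl]
    congr 1
    rw [Complex.star_def, Complex.conj_mul']
    push_cast
    rfl
  · intro l _ hl
    rw [if_neg (Ne.symm hl), smul_zero]
  · exact fun h => absurd hk h

theorem norm_sum_modeCreation_le (s : Finset I) (φ : I → ℂ) :
    ‖∑ k ∈ s, φ k • modeCreation k‖ ^ 2 ≤ ∑ k ∈ s, ‖φ k‖ ^ 2 := by
  set C : FockOp I := ∑ k ∈ s, φ k • modeCreation k with hC
  set r : ℝ := ∑ k ∈ s, ‖φ k‖ ^ 2 with hr
  have hr0 : 0 ≤ r := Finset.sum_nonneg fun k _ => sq_nonneg _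
  have key : star C * C + C * star C = (r : ℂ) • (1 : FockOp I) := sum_anticomm s φ
  have h : ‖C‖ ≤ √r := by
    refine ContinuousLinearMap.opNorm_le_bound _ (Real.sqrt_nonneg _) fun f => ?_
    have h1 : ‖C f‖ ^ 2 + ‖star C f‖ ^ 2 = r * ‖f‖ ^ 2 := by
      have e := congrArg (fun A : FockOp I => RCLike.re ⟪f, A f⟫_ℂ) key
      have e1 : (star C * C + C * star C) f = star C (C f) + C (star C f) := rfl
      have e2 : ((r : ℂ) • (1 : FockOp I)) f = (r : ℂ) • f := rfl
      simp only [e1, e2] at e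
      rw [inner_add_right, inner_smul_right, map_add, ContinuousLinearMap.star_eq_adjoint,
        ContinuousLinearMap.adjoint_inner_right,
        ← ContinuousLinearMap.adjoint_inner_left C (ContinuousLinearMap.adjoint C f) f,
        inner_self_eq_norm_sq, inner_self_eq_norm_sq] at e
      rw [ContinuousLinearMap.star_eq_adjoint, e]
      rw [inner_self_eq_norm_sq_to_K]
      simp [← Complex.ofReal_pow]
    have h2 : ‖C f‖ ^ 2 ≤ (√r * ‖f‖) ^ 2 := by
      rw [mul_pow, Real.sq_sqrt hr0]
      nlinarith [sq_nonneg ‖star C f‖]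
    exact le_of_sq_le_sq h2 (by positivity)
  calc ‖C‖ ^ 2 ≤ √r ^ 2 := by gcongr
    _ = r := Real.sq_sqrt hr0

theorem summable_modeCreation (φ : Ell2 I) :
    Summable fun k => coord φ k • (modeCreation k : FockOp I) := by
  rw [summable_iff_vanishing_norm]
  intro ε hε
  obtain ⟨s, hs⟩ := summable_iff_vanishing_norm.1 (hasSum_norm_sq φ).summable (ε ^ 2) (by positivity)
  refine ⟨s, fun t ht => ?_⟩
  have h1 := norm_sum_modeCreation_le t (coord φ)
  have h2 := hs t ht
  exact lt_of_pow_lt_pow_left₀ 2 hε.le (h1.trans_lt ((le_abs_self _).trans_lt h2))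

/-- The creation operator `c(φ)`, `φ ∈ ℓ²(I)`. The series converges in operator norm. -/
def creation (φ : Ell2 I) : FockOp I := ∑' k, coord φ k • modeCreation k

/-- The annihilation operator `a(φ) = c(φ)*`. -/
def annihilation (φ : Ell2 I) : FockOp I := star (creation φ)

theorem hasSum_creation (φ : Ell2 I) :
    HasSum (fun k => coord φ k • (modeCreation k : FockOp I)) (creation φ) :=
  (summable_modeCreation φ).hasSum

theorem hasSum_annihilation (φ : Ell2 I) :
    HasSum (fun k => star (coord φ k) • star (modeCreation k : FockOp I)) (annihilation φ) := by
  simpa only [star_smul, annihilation] using (hasSum_creation φ).star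

theorem norm_creation_le (φ : Ell2 I) : ‖creation φ‖ ≤ ‖φ‖ := by
  have h : ‖creation φ‖ ^ 2 ≤ ‖φ‖ ^ 2 :=
    le_of_tendsto_of_tendsto' ((hasSum_creation φ).norm.pow 2) (hasSum_norm_sq φ)
      (fun s => norm_sum_modeCreation_le s (coord φ))
  exact le_of_sq_le_sq h (norm_nonneg _)

theorem creation_add (φ ψ : Ell2 I) : creation (φ + ψ) = creation φ + creation ψ := by
  refine (hasSum_creation (φ + ψ)).unique ?_
  simpa only [coord_add, add_smul] using (hasSum_creation φ).add (hasSum_creation ψ)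

theorem creation_smul (z : ℂ) (φ : Ell2 I) : creation (z • φ) = z • creation φ := by
  refine (hasSum_creation (z • φ)).unique ?_
  simpa only [coord_smul, mul_smul] using (hasSum_creation φ).const_smul z

theorem anticomm_creation (φ ψ : Ell2 I) :
    creation φ * creation ψ + creation ψ * creation φ = 0 := by
  have h1 : ∀ l, creation φ * modeCreation l + modeCreation l * creation φ = 0 := by
    intro l
    have h := ((hasSum_creation φ).mul_right (modeCreation l)).add
      ((hasSum_creation φ).mul_left (modeCreation l))
    refine h.unique ?_
    simp only [smul_mul_assoc, mul_smul_comm, ← smul_add, mode_anticomm_create, smul_zero]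
    exact hasSum_zero
  have h := ((hasSum_creation ψ).mul_left (creation φ)).add
    ((hasSum_creation ψ).mul_right (creation φ))
  refine h.unique ?_
  simp only [smul_mul_assoc, mul_smul_comm, ← smul_add, h1, smul_zero]
  exact hasSum_zero

theorem anticomm_annihilation_creation (φ ψ : Ell2 I) :
    annihilation φ * creation ψ + creation ψ * annihilation φ = ⟪φ, ψ⟫_ℂ • (1 : FockOp I) := by
  have h1 : ∀ l, annihilation φ * modeCreation l + modeCreation l * annihilation φ
      = star (coord φ l) • (1 : FockOp I) := by
    intro l
    have h := ((hasSum_annihilation φ).mul_right (modeCreation l)).add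
      ((hasSum_annihilation φ).mul_left (modeCreation l))
    refine h.unique ?_
    simp only [smul_mul_assoc, mul_smul_comm, ← smul_add, mode_anticomm_mixed]
    have h2 := hasSum_single (f := fun k => star (coord φ k) • (if k = l then (1 : FockOp I) else 0))
      l (fun k hk => by simp only [if_neg hk, smul_zero])
    simpa only [if_pos] using h2
  have h := ((hasSum_creation ψ).mul_left (annihilation φ)).add
    ((hasSum_creation ψ).mul_right (annihilation φ))
  refine h.unique ?_
  simp only [smul_mul_assoc, mul_smul_comm, ← smul_add, h1, smul_smul]
  have h3 : HasSum (fun k => coord ψ k * star (coord φ k)) ⟪φ, ψ⟫_ℂ := by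
    have := lp.hasSum_inner (𝕜 := ℂ) φ ψ
    simpa [coord, mul_comm] using this
  exact h3.smul_const (1 : FockOp I)

theorem creation_zero : creation (0 : Ell2 I) = 0 := by
  simpa using creation_smul (0 : ℂ) (0 : Ell2 I)

theorem creation_sub (φ ψ : Ell2 I) : creation (φ - ψ) = creation φ - creation ψ := by
  have := creation_add (φ - ψ) ψ
  rw [sub_add_cancel] at this
  rw [this, add_sub_cancel_right]

/-- The phase rotation `Γ(z I)` on Fock space, `|z| = 1`: multiplication by `z ^ n` on the
`n`-particle space. -/
def phaseOp (I : Type*) (z : Circle) : FockOp I :=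
  weightedShift (fun S => (z : ℂ) ^ S.card) id (fun S => by rw [norm_pow, Circle.norm_coe, one_pow])
    (fun S T _ _ h => h)

theorem phaseOp_apply {I : Type*} (z : Circle) (f : Fock I) (S : Finset I) :
    coord (phaseOp I z f) S = (z : ℂ) ^ S.card * coord f S := rfl

theorem phaseOp_mul_inv {I : Type*} (z : Circle) : phaseOp I z * phaseOp I z⁻¹ = 1 := by
  refine ContinuousLinearMap.ext fun f => ext_coord fun S => ?_
  rw [op_mul_apply, phaseOp_apply, phaseOp_apply, ← mul_assoc, ← mul_pow, Circle.coe_inv,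
    mul_inv_cancel₀ (Circle.coe_ne_zero z), one_pow, one_mul]
  rfl

theorem phaseOp_mode (z : Circle) (k : I) :
    phaseOp I z * modeCreation k = (z : ℂ) • (modeCreation k * phaseOp I z) := by
  refine ContinuousLinearMap.ext fun f => ext_coord fun S => ?_
  change coord (phaseOp I z (modeCreation k f)) S
    = (z : ℂ) * coord (modeCreation k (phaseOp I z f)) S
  rw [phaseOp_apply, modeCreation_apply, modeCreation_apply, phaseOp_apply]
  by_cases hk : k ∈ S
  · rw [if_pos hk, if_pos hk, ← Finset.card_erase_add_one hk, pow_succ]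
    ring
  · simp [hk]

theorem phaseOp_mode_star (z : Circle) (k : I) :
    star (modeCreation k) * phaseOp I z = (z : ℂ) • (phaseOp I z * star (modeCreation k)) := by
  refine ContinuousLinearMap.ext fun f => ext_coord fun S => ?_
  change coord (star (modeCreation k) (phaseOp I z f)) S
    = (z : ℂ) * coord (phaseOp I z (star (modeCreation k) f)) S
  rw [phaseOp_apply, modeAnnihilation_apply, modeAnnihilation_apply, phaseOp_apply]
  by_cases hk : k ∈ S
  · simp [hk]
  · rw [if_neg hk, if_neg hk, Finset.card_insert_of_notMem hk, pow_succ]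
    ring

theorem phaseOp_creation (z : Circle) (φ : Ell2 I) :
    phaseOp I z * creation φ = (z : ℂ) • (creation φ * phaseOp I z) := by
  refine ((hasSum_creation φ).mul_left (phaseOp I z)).unique ?_
  simp only [mul_smul_comm, phaseOp_mode]
  have h := ((hasSum_creation φ).mul_right (phaseOp I z)).const_smul (z : ℂ)
  simpa only [smul_mul_assoc, smul_comm (z : ℂ)] using h

theorem phaseOp_annihilation (z : Circle) (φ : Ell2 I) :
    annihilation φ * phaseOp I z = (z : ℂ) • (phaseOp I z * annihilation φ) := by
  refine ((hasSum_annihilation φ).mul_right (phaseOp I z)).unique ?_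
  simp only [smul_mul_assoc, phaseOp_mode_star]
  have h := ((hasSum_annihilation φ).mul_left (phaseOp I z)).const_smul (z : ℂ)
  simpa only [mul_smul_comm, smul_comm (z : ℂ)] using h

/-- `c(φ₀) ⋯ c(φ_{n-1})`. -/
def creationProd {n : ℕ} (φ : Fin n → Ell2 I) : FockOp I :=
  (List.ofFn fun i => creation (φ i)).prod

/-- `a(ψ_{m-1}) ⋯ a(ψ₀)`. -/
def annihilationProd {m : ℕ} (ψ : Fin m → Ell2 I) : FockOp I :=
  (List.ofFn fun i => annihilation (ψ i.rev)).prod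

theorem creationProd_succ {n : ℕ} (φ : Fin (n + 1) → Ell2 I) :
    creationProd φ = creation (φ 0) * creationProd (fun i => φ i.succ) := by
  simp [creationProd, List.ofFn_succ]

theorem annihilationProd_succ {m : ℕ} (ψ : Fin (m + 1) → Ell2 I) :
    annihilationProd ψ = annihilationProd (fun i => ψ i.succ) * annihilation (ψ 0) := by
  rw [annihilationProd, List.ofFn_succ']
  simp [annihilationProd, Fin.rev_castSucc]

theorem creationProd_zero (φ : Fin 0 → Ell2 I) : creationProd φ = 1 := by simp [creationProd]

theorem annihilationProd_zero (φ : Fin 0 → Ell2 I) : annihilationProd φ = 1 := by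
  simp [annihilationProd]

theorem phaseOp_creationProd (z : Circle) {n : ℕ} (φ : Fin n → Ell2 I) :
    phaseOp I z * creationProd φ = ((z : ℂ) ^ n) • (creationProd φ * phaseOp I z) := by
  induction n with
  | zero => simp [creationProd_zero]
  | succ n ih =>
    rw [creationProd_succ, ← mul_assoc, phaseOp_creation, smul_mul_assoc, mul_assoc, ih,
      mul_smul_comm, smul_smul, pow_succ', mul_assoc]

theorem phaseOp_annihilationProd (z : Circle) {n : ℕ} (φ : Fin n → Ell2 I) :
    annihilationProd φ * phaseOp I z = ((z : ℂ) ^ n) • (phaseOp I z * annihilationProd φ) := by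
  induction n with
  | zero => simp [annihilationProd_zero]
  | succ n ih =>
    rw [annihilationProd_succ, mul_assoc, phaseOp_annihilation, mul_smul_comm, ← mul_assoc, ih,
      smul_mul_assoc, smul_smul, pow_succ', mul_assoc]

theorem creation_mul_creationProd (ξ : Ell2 I) {n : ℕ} (φ : Fin n → Ell2 I) :
    creation ξ * creationProd φ = ((-1 : ℂ) ^ n) • (creationProd φ * creation ξ) := by
  induction n with
  | zero => simp [creationProd_zero]
  | succ n ih =>
    rw [creationProd_succ, ← mul_assoc, eq_neg_of_add_eq_zero_left (anticomm_creation ξ (φ 0)),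
      neg_mul, mul_assoc, ih, mul_smul_comm, pow_succ', mul_assoc, mul_smul, neg_one_smul]

theorem creation_mul_annihilationProd (ξ : Ell2 I) {m : ℕ} (ψ : Fin (m + 1) → Ell2 I) :
    creation ξ * annihilationProd ψ
      = ((-1 : ℂ) ^ (m + 1)) • (annihilationProd ψ * creation ξ)
        + ∑ i : Fin (m + 1), ((-1 : ℂ) ^ (m + (i : ℕ)) * ⟪ψ i, ξ⟫_ℂ) •
            annihilationProd (fun j => ψ (i.succAbove j)) := by
  have hca : ∀ η : Ell2 I, creation ξ * annihilation η
      = ⟪η, ξ⟫_ℂ • (1 : FockOp I) - annihilation η * creation ξ := fun η =>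
    eq_sub_of_add_eq' (anticomm_annihilation_creation η ξ)
  induction m with
  | zero =>
    simp only [annihilationProd_succ, annihilationProd_zero, one_mul, hca]
    simp [sub_eq_neg_add]
  | succ m ih =>
    rw [annihilationProd_succ, ← mul_assoc, ih, add_mul, Finset.sum_mul,
      Fin.sum_univ_succ (n := m + 1), smul_mul_assoc,
      mul_assoc, hca, mul_sub, smul_sub, mul_smul_comm, mul_one]
    have e : ∀ i : Fin (m + 1),
        annihilationProd (fun j => ψ (i.succ.succAbove j))
          = annihilationProd (fun j => ψ (i.succAbove j).succ) * annihilation (ψ 0) := by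
      intro i
      rw [annihilationProd_succ]
      simp
    simp only [e, smul_mul_assoc]
    have s1 : ∀ i : Fin (m + 1), (-1 : ℂ) ^ (m + 1 + ((i.succ : Fin (m + 2)) : ℕ))
        = (-1) ^ (m + (i : ℕ)) := by
      intro i
      rw [Fin.val_succ, show m + 1 + ((i : ℕ) + 1) = m + i + 2 by ring, pow_add]
      simp
    simp only [s1]
    simp only [Fin.val_zero, add_zero, Fin.succAbove_zero, smul_smul, mul_assoc]
    rw [pow_succ (-1 : ℂ) (m + 1)]
    simp only [mul_neg, mul_one, neg_smul]
    abel

theorem exists_circle_pow_eq (d : ℕ) (hd : d ≠ 0) : ∃ z : Circle, (z : ℂ) ^ d = -1 := by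
  refine ⟨Circle.exp (Real.pi / d), ?_⟩
  have h0 : (d : ℂ) ≠ 0 := by exact_mod_cast hd
  rw [Circle.coe_exp, ← Complex.exp_nat_mul, ← Complex.exp_pi_mul_I]
  congr 1
  push_cast
  field_simp

/-- The properties from which the quasi-free state is constructed on all bounded operators. -/
structure IsPreQuasiFree (Q : Ell2 I →L[ℂ] Ell2 I) (ω : FockOp I →ₗ[ℂ] ℂ) : Prop where
  pos : ∀ X, 0 ≤ ω (star X * X)
  one : ω 1 = 1
  bound : ∀ X, ‖ω X‖ ≤ ‖X‖
  gauge : ∀ (z : Circle) (X : FockOp I), ω (phaseOp I z * X * phaseOp I z⁻¹) = ω X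
  kms : ∀ (φ : Ell2 I) (X : FockOp I), ω (creation (φ - Q φ) * X) = ω (X * creation (Q φ))

theorem IsPreQuasiFree.apply_ne {Q : Ell2 I →L[ℂ] Ell2 I} {ω : FockOp I →ₗ[ℂ] ℂ}
    (h : IsPreQuasiFree Q ω) {n m : ℕ} (hnm : n ≠ m) (φ : Fin n → Ell2 I) (ψ : Fin m → Ell2 I) :
    ω (creationProd φ * annihilationProd ψ) = 0 := by
  obtain ⟨z, hz⟩ : ∃ z : Circle, (z : ℂ) ^ n = -(z : ℂ) ^ m := by
    rcases lt_or_gt_of_ne hnm with hlt | hlt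
    · obtain ⟨d, rfl⟩ := Nat.exists_eq_add_of_lt hlt
      obtain ⟨z, hz⟩ := exists_circle_pow_eq (d + 1) (by omega)
      exact ⟨z, by rw [add_assoc, pow_add, hz]; ring⟩
    · obtain ⟨d, rfl⟩ := Nat.exists_eq_add_of_lt hlt
      obtain ⟨z, hz⟩ := exists_circle_pow_eq (d + 1) (by omega)
      exact ⟨z, by rw [add_assoc, pow_add, hz]; ring⟩
  have h1 := h.gauge z (creationProd φ * annihilationProd ψ)
  have hG := phaseOp_mul_inv (I := I) z
  have h2 : ((z : ℂ) ^ m) • (phaseOp I z * (creationProd φ * annihilationProd ψ) * phaseOp I z⁻¹)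
      = ((z : ℂ) ^ n) • (creationProd φ * annihilationProd ψ) := by
    rw [← mul_assoc, phaseOp_creationProd, smul_mul_assoc, smul_mul_assoc, smul_comm]
    congr 1
    rw [mul_assoc (creationProd φ), mul_assoc (creationProd φ), ← mul_smul_comm, ← smul_mul_assoc,
      ← phaseOp_annihilationProd, mul_assoc (annihilationProd ψ), hG, mul_one]
  have h3 := congrArg ω h2
  rw [map_smul, map_smul, h1, hz, smul_eq_mul, smul_eq_mul] at h3
  have hz0 : (z : ℂ) ^ m ≠ 0 := pow_ne_zero _ (Circle.coe_ne_zero z)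
  have h4 : (z : ℂ) ^ m * ω (creationProd φ * annihilationProd ψ) = 0 := by linear_combination h3 / 2
  exact (mul_eq_zero.1 h4).resolve_left hz0

theorem IsPreQuasiFree.apply_eq {Q : Ell2 I →L[ℂ] Ell2 I} {ω : FockOp I →ₗ[ℂ] ℂ}
    (h : IsPreQuasiFree Q ω) {n : ℕ} (φ ψ : Fin n → Ell2 I) :
    ω (creationProd φ * annihilationProd ψ) = (Matrix.of fun i j => ⟪ψ i, Q (φ j)⟫_ℂ).det := by
  induction n with
  | zero => simp [creationProd_zero, annihilationProd_zero, h.one]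
  | succ n ih =>
    set ξ := Q (φ 0) with hξ
    set C := creationProd (fun i => φ i.succ) with hC
    have e1 : ω (creationProd φ * annihilationProd ψ)
        = ω (C * annihilationProd ψ * creation ξ) + ω (creation ξ * (C * annihilationProd ψ)) := by
      have h1 := h.kms (φ 0) (C * annihilationProd ψ)
      rw [creation_sub, sub_mul, map_sub] at h1
      rw [creationProd_succ, mul_assoc, ← h1]
      ring
    have e2 : creation ξ * (C * annihilationProd ψ) = -(C * annihilationProd ψ * creation ξ)
        + ∑ i : Fin (n + 1), ((-1 : ℂ) ^ (i : ℕ) * ⟪ψ i, ξ⟫_ℂ) •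
            (C * annihilationProd (fun j => ψ (i.succAbove j))) := by
      rw [← mul_assoc, hC, creation_mul_creationProd, smul_mul_assoc, mul_assoc,
        creation_mul_annihilationProd, mul_add, smul_add, mul_smul_comm, smul_smul,
        Finset.mul_sum, Finset.smul_sum]
      congr 1
      · rw [← pow_add, show n + (n + 1) = 2 * n + 1 by ring, pow_succ, pow_mul]
        simp [mul_assoc]
      · refine Finset.sum_congr rfl fun i _ => ?_
        rw [mul_smul_comm, smul_smul, ← mul_assoc, ← pow_add,
          show n + (n + (i : ℕ)) = 2 * n + i by ring, pow_add, pow_mul]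
        simp
    rw [e1, e2, map_add, map_neg, add_neg_cancel_left, map_sum, Matrix.det_succ_column_zero]
    refine Finset.sum_congr rfl fun i _ => ?_
    rw [map_smul, ih, smul_eq_mul]
    rfl

theorem vacuum_isPreQuasiFree :
    IsPreQuasiFree (0 : Ell2 I →L[ℂ] Ell2 I)
      { toFun := fun X => ⟪(basisVec ∅ : Fock I), X (basisVec ∅)⟫_ℂ
        map_add' := fun _ _ => inner_add_right _ _ _
        map_smul' := fun _ _ => inner_smul_right _ _ _ } := by
  have hn : ‖(basisVec ∅ : Fock I)‖ = 1 := by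
    rw [basisVec, lp.norm_single (by simp)]
    simp
  have hann : ∀ φ : Ell2 I, annihilation φ (basisVec ∅) = 0 := by
    intro φ
    have h1 : ∀ k : I, star (modeCreation k) (basisVec ∅ : Fock I) = 0 := by
      intro k
      refine ext_coord fun S => ?_
      rw [modeAnnihilation_apply, coord_basisVec]
      simp
    have h2 := ((ContinuousLinearMap.apply ℂ (Fock I) (basisVec ∅ : Fock I)).hasSum
      (hasSum_annihilation φ))
    refine h2.unique ?_
    have h3 : ∀ k : I, (ContinuousLinearMap.apply ℂ (Fock I) (basisVec ∅ : Fock I))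
        (star (coord φ k) • star (modeCreation k)) = 0 := by
      intro k
      change star (coord φ k) • (star (modeCreation k) (basisVec ∅ : Fock I)) = 0
      rw [h1, smul_zero]
    simp only [h3]
    exact hasSum_zero
  refine ⟨fun X => ?_, ?_, fun X => ?_, fun z X => ?_, fun φ X => ?_⟩
  · change 0 ≤ ⟪(basisVec ∅ : Fock I), star X (X (basisVec ∅))⟫_ℂ
    rw [ContinuousLinearMap.star_eq_adjoint, ContinuousLinearMap.adjoint_inner_right]
    rw [inner_self_eq_norm_sq_to_K]
    simp
  · change ⟪(basisVec ∅ : Fock I), basisVec ∅⟫_ℂ = 1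
    rw [inner_basisVec, coord_basisVec, if_pos rfl]
  · change ‖⟪(basisVec ∅ : Fock I), X (basisVec ∅)⟫_ℂ‖ ≤ ‖X‖
    calc _ ≤ ‖(basisVec ∅ : Fock I)‖ * ‖X (basisVec ∅)‖ := norm_inner_le_norm _ _
      _ ≤ 1 * (‖X‖ * 1) := by
        rw [hn]
        gcongr
        simpa [hn] using X.le_opNorm (basisVec ∅ : Fock I)
      _ = ‖X‖ := by ring
  · change ⟪(basisVec ∅ : Fock I), phaseOp I z (X (phaseOp I z⁻¹ (basisVec ∅)))⟫_ℂ
      = ⟪(basisVec ∅ : Fock I), X (basisVec ∅)⟫_ℂ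
    have e : phaseOp I z⁻¹ (basisVec ∅ : Fock I) = basisVec ∅ := by
      refine ext_coord fun S => ?_
      rw [phaseOp_apply, coord_basisVec]
      by_cases hS : S = ∅
      · simp [hS]
      · simp [hS]
    rw [e, inner_basisVec, inner_basisVec, phaseOp_apply]
    simp
  · change ⟪(basisVec ∅ : Fock I), creation (φ - 0) (X (basisVec ∅))⟫_ℂ
      = ⟪(basisVec ∅ : Fock I), X (creation 0 (basisVec ∅))⟫_ℂ
    have e := hann φ
    rw [annihilation, ContinuousLinearMap.star_eq_adjoint] at e
    rw [sub_zero, ← ContinuousLinearMap.adjoint_inner_left, e, creation_zero]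
    simp

theorem IsPreQuasiFree.add_mode {Q : Ell2 I →L[ℂ] Ell2 I} {ω : FockOp I →ₗ[ℂ] ℂ}
    (h : IsPreQuasiFree Q ω) (hQ : ∀ x y, ⟪Q x, y⟫_ℂ = ⟪x, Q y⟫_ℂ) {f : Ell2 I} (hf : ‖f‖ = 1)
    (hQf : Q f = 0) {q : ℝ} (hq0 : 0 ≤ q) (hq1 : q ≤ 1) :
    ∃ ω' : FockOp I →ₗ[ℂ] ℂ,
      IsPreQuasiFree (Q + (q : ℂ) • (innerSL ℂ f).smulRight f) ω' := by
  have hff : ⟪f, f⟫_ℂ = 1 := by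
    rw [inner_self_eq_norm_sq_to_K, hf]
    simp
  have hac : annihilation f * creation f = 1 - creation f * annihilation f := by
    have := anticomm_annihilation_creation f f
    rw [hff, one_smul] at this
    exact eq_sub_of_add_eq this
  have hcX : ∀ X, ω (creation f * X) = 0 := by
    intro X
    have := h.kms f X
    rwa [hQf, sub_zero, creation_zero, mul_zero, map_zero] at this
  have hcc : creation f * creation f = 0 := by
    have := anticomm_creation f f
    have h2 : (2 : ℂ) • (creation f * creation f) = 0 := by rw [two_smul, this]
    exact (smul_eq_zero.1 h2).resolve_left two_ne_zero
  have hQ'f : (Q + (q : ℂ) • (innerSL ℂ f).smulRight f) f = (q : ℂ) • f := by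
    change Q f + (q : ℂ) • (⟪f, f⟫_ℂ • f) = (q : ℂ) • f
    rw [hQf, hff, one_smul, zero_add]
  have hQ'p : ∀ φ, ⟪f, φ⟫_ℂ = 0 → (Q + (q : ℂ) • (innerSL ℂ f).smulRight f) φ = Q φ := by
    intro φ hφ
    change Q φ + (q : ℂ) • (⟪f, φ⟫_ℂ • f) = Q φ
    rw [hφ, zero_smul, smul_zero, add_zero]
  set Q' := Q + (q : ℂ) • (innerSL ℂ f).smulRight f with hQ'
  let ω' : FockOp I →ₗ[ℂ] ℂ :=
    { toFun := fun X => ((1 - q : ℝ) : ℂ) * ω X + (q : ℂ) * ω (annihilation f * X * creation f)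
      map_add' := fun X Y => by
        rw [mul_add, add_mul, map_add, map_add]
        ring
      map_smul' := fun c X => by
        rw [mul_smul_comm, smul_mul_assoc, map_smul, map_smul]
        simp only [smul_eq_mul, RingHom.id_apply]
        ring }
  have hω' : ∀ X, ω' X = ((1 - q : ℝ) : ℂ) * ω X + (q : ℂ) * ω (annihilation f * X * creation f) :=
    fun X => rfl
  have hnc : ‖creation f‖ ≤ 1 := (norm_creation_le f).trans hf.le
  have hna : ‖annihilation f‖ ≤ 1 := by
    rw [annihilation, ContinuousLinearMap.star_eq_adjoint, LinearIsometryEquiv.norm_map]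
    exact hnc
  refine ⟨ω', ⟨fun X => ?_, ?_, fun X => ?_, fun z X => ?_, fun φ X => ?_⟩⟩
  · rw [hω']
    have e : annihilation f * (star X * X) * creation f = star (X * creation f) * (X * creation f) := by
      rw [star_mul, annihilation]
      simp only [mul_assoc]
    rw [e]
    have hq0' : (0 : ℂ) ≤ (q : ℂ) := by exact_mod_cast hq0
    have hq1' : (0 : ℂ) ≤ ((1 - q : ℝ) : ℂ) := by
      exact_mod_cast sub_nonneg.2 hq1
    exact add_nonneg (mul_nonneg hq1' (h.pos _)) (mul_nonneg hq0' (h.pos _))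
  · rw [hω', mul_one, hac, map_sub, hcX, h.one]
    push_cast
    ring
  · rw [hω']
    calc _ ≤ ‖((1 - q : ℝ) : ℂ) * ω X‖ + ‖(q : ℂ) * ω (annihilation f * X * creation f)‖ :=
          norm_add_le _ _
      _ ≤ (1 - q) * ‖X‖ + q * ‖X‖ := by
          rw [norm_mul, norm_mul, Complex.norm_real, Complex.norm_real, Real.norm_of_nonneg hq0,
            Real.norm_of_nonneg (sub_nonneg.2 hq1)]
          have h1 : ‖annihilation f * X * creation f‖ ≤ ‖X‖ := by
            calc _ ≤ ‖annihilation f * X‖ * ‖creation f‖ := norm_mul_le _ _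
              _ ≤ (‖annihilation f‖ * ‖X‖) * ‖creation f‖ := by
                gcongr
                exact norm_mul_le _ _
              _ ≤ (1 * ‖X‖) * 1 := by gcongr
              _ = ‖X‖ := by ring
          have h2 := sub_nonneg.2 hq1
          gcongr
          · exact h.bound X
          · exact (h.bound _).trans h1
      _ = ‖X‖ := by ring
  · rw [hω', hω', h.gauge]
    congr 2
    have e1 : annihilation f * (phaseOp I z * X * phaseOp I z⁻¹) * creation f
        = phaseOp I z * (annihilation f * X * creation f) * phaseOp I z⁻¹ := by
      have e2 : annihilation f * (phaseOp I z * X * phaseOp I z⁻¹) * creation f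
          = (annihilation f * phaseOp I z) * X * (phaseOp I z⁻¹ * creation f) := by
        simp only [mul_assoc]
      rw [e2, phaseOp_annihilation, phaseOp_creation, smul_mul_assoc, smul_mul_assoc,
        mul_smul_comm, smul_smul, Circle.coe_inv, mul_inv_cancel₀ (Circle.coe_ne_zero z), one_smul]
      simp only [mul_assoc]
    rw [e1, h.gauge]
  · -- split `φ` into its part along `f` and its part orthogonal to `f`
    have hpar : ω' (creation (f - Q' f) * X) = ω' (X * creation (Q' f)) := by
      have e0 : f - Q' f = ((1 - q : ℝ) : ℂ) • f := by
        rw [hQ'f]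
        push_cast
        rw [sub_smul, one_smul]
      rw [e0, hQ'f, creation_smul, creation_smul, smul_mul_assoc, mul_smul_comm, map_smul,
        map_smul, hω', hω', hcX]
      have e1 : annihilation f * (creation f * X) * creation f
          = X * creation f - creation f * (annihilation f * X * creation f) := by
        rw [← mul_assoc, hac, sub_mul, one_mul, sub_mul]
        simp only [mul_assoc]
      have e2 : annihilation f * (X * creation f) * creation f = 0 := by
        rw [mul_assoc, mul_assoc, hcc, mul_zero, mul_zero]
      rw [e1, e2, map_sub, hcX, map_zero]
      simp only [smul_eq_mul]
      ring
    have hperp : ∀ φ, ⟪f, φ⟫_ℂ = 0 →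
        ω' (creation (φ - Q' φ) * X) = ω' (X * creation (Q' φ)) := by
      intro φ hφ
      have hQφ : ⟪f, Q φ⟫_ℂ = 0 := by rw [← hQ, hQf, inner_zero_left]
      have hd : ⟪f, φ - Q φ⟫_ℂ = 0 := by rw [inner_sub_right, hφ, hQφ, sub_zero]
      rw [hQ'p φ hφ, hω', hω', h.kms]
      congr 2
      have e1 : annihilation f * (creation (φ - Q φ) * X) * creation f
          = -(creation (φ - Q φ) * (annihilation f * X * creation f)) := by
        have := anticomm_annihilation_creation f (φ - Q φ)
        rw [hd, zero_smul] at this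
        rw [← mul_assoc, eq_neg_of_add_eq_zero_left this]
        simp only [neg_mul, mul_assoc]
      have e2 : annihilation f * (X * creation (Q φ)) * creation f
          = -((annihilation f * X * creation f) * creation (Q φ)) := by
        have := anticomm_creation (Q φ) f
        rw [mul_assoc, mul_assoc, eq_neg_of_add_eq_zero_left this]
        simp only [mul_neg, mul_assoc]
      rw [e1, e2, map_neg, map_neg, h.kms]
    have hdec : φ = ⟪f, φ⟫_ℂ • f + (φ - ⟪f, φ⟫_ℂ • f) := by abel
    have ho : ⟪f, φ - ⟪f, φ⟫_ℂ • f⟫_ℂ = 0 := by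
      rw [inner_sub_right, inner_smul_right, hff, mul_one, sub_self]
    have h2 := hperp _ ho
    have e3 : φ - Q' φ = ⟪f, φ⟫_ℂ • (f - Q' f)
        + ((φ - ⟪f, φ⟫_ℂ • f) - Q' (φ - ⟪f, φ⟫_ℂ • f)) := by
      rw [map_sub, map_smul, smul_sub]
      abel
    have e4 : Q' φ = ⟪f, φ⟫_ℂ • Q' f + Q' (φ - ⟪f, φ⟫_ℂ • f) := by
      rw [map_sub, map_smul]
      abel
    rw [e3, creation_add, add_mul, map_add, creation_smul, smul_mul_assoc, map_smul, hpar, h2]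
    rw [e4, creation_add, mul_add, map_add, creation_smul, mul_smul_comm, map_smul]

/-- `Q` is a symbol: `0 ≤ Q ≤ 1`. -/
def IsSymbol {I : Type*} (Q : Ell2 I →L[ℂ] Ell2 I) : Prop := Q.IsPositive ∧ (1 - Q).IsPositive

theorem exists_isPreQuasiFree_compress {Q : Ell2 I →L[ℂ] Ell2 I} (hQ : IsSymbol Q)
    (U : Submodule ℂ (Ell2 I)) [FiniteDimensional ℂ U] :
    ∃ ω : FockOp I →ₗ[ℂ] ℂ,
      IsPreQuasiFree (U.starProjection ∘L Q ∘L U.starProjection) ω := by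
  classical
  have hsym : ∀ x y, ⟪Q x, y⟫_ℂ = ⟪x, Q y⟫_ℂ := hQ.1.isSymmetric
  let T : U →ₗ[ℂ] U := (U.orthogonalProjectionOnto : Ell2 I →ₗ[ℂ] U) ∘ₗ (Q : Ell2 I →ₗ[ℂ] Ell2 I) ∘ₗ U.subtype
  have hTi : ∀ x y : U, ⟪x, T y⟫_ℂ = ⟪(x : Ell2 I), Q y⟫_ℂ := by
    intro x y
    exact Submodule.inner_orthogonalProjectionOnto_eq_of_mem_left x (Q y)
  have hT : T.IsSymmetric := by
    intro x y
    rw [hTi, ← hsym, ← inner_conj_symm, hTi, inner_conj_symm]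
  let v := hT.eigenvectorBasis rfl
  let ev := hT.eigenvalues rfl
  have hTv : ∀ i, T (v i) = (ev i : ℂ) • v i := fun i => hT.apply_eigenvectorBasis rfl i
  have hev : ∀ i, 0 ≤ ev i ∧ ev i ≤ 1 := by
    intro i
    have h1 : ⟪(v i : Ell2 I), Q (v i)⟫_ℂ = (ev i : ℂ) := by
      have e2 : ‖(v i : Ell2 I)‖ = 1 := v.norm_eq_one i
      rw [← hTi, hTv]
      change ⟪(v i : Ell2 I), (ev i : ℂ) • (v i : Ell2 I)⟫_ℂ = _
      rw [inner_smul_right, inner_self_eq_norm_sq_to_K, e2]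
      simp
    have h2 : ⟪(v i : Ell2 I), (1 - Q) (v i)⟫_ℂ = ((1 - ev i : ℝ) : ℂ) := by
      have e : (1 - Q) (v i : Ell2 I) = (v i : Ell2 I) - Q (v i) := rfl
      have e2 : ‖(v i : Ell2 I)‖ = 1 := v.norm_eq_one i
      rw [e, inner_sub_right, h1, inner_self_eq_norm_sq_to_K, e2]
      simp
    have h3 := hQ.1.inner_nonneg_right (v i : Ell2 I)
    have h4 := hQ.2.inner_nonneg_right (v i : Ell2 I)
    rw [h1] at h3
    rw [h2] at h4
    constructor
    · exact_mod_cast h3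
    · exact sub_nonneg.1 (by exact_mod_cast h4)
  have hvo : ∀ i j, ⟪(v i : Ell2 I), (v j : Ell2 I)⟫_ℂ = if i = j then 1 else 0 :=
    fun i j => orthonormal_iff_ite.1 v.orthonormal i j
  let QS : Finset (Fin (Module.finrank ℂ U)) → (Ell2 I →L[ℂ] Ell2 I) := fun s =>
    ∑ i ∈ s, (ev i : ℂ) • (innerSL ℂ (v i : Ell2 I)).smulRight (v i : Ell2 I)
  have hQSa : ∀ s x, QS s x = ∑ i ∈ s, (ev i : ℂ) • (⟪(v i : Ell2 I), x⟫_ℂ • (v i : Ell2 I)) := by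
    intro s x
    simp only [QS, _root_.sum_apply]
    rfl
  have hQSs : ∀ s x y, ⟪QS s x, y⟫_ℂ = ⟪x, QS s y⟫_ℂ := by
    intro s x y
    rw [hQSa, hQSa, sum_inner, inner_sum]
    refine Finset.sum_congr rfl fun i _ => ?_
    rw [inner_smul_left, inner_smul_left, inner_smul_right, inner_smul_right, inner_conj_symm,
      Complex.conj_ofReal]
    ring
  have main : ∀ s, ∃ ω : FockOp I →ₗ[ℂ] ℂ, IsPreQuasiFree (QS s) ω := by
    intro s
    induction s using Finset.induction_on with
    | empty =>
      have h0 : QS ∅ = 0 := by simp [QS]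
      rw [h0]
      exact ⟨_, vacuum_isPreQuasiFree⟩
    | insert a s ha ih =>
      obtain ⟨ω, hω⟩ := ih
      have h0 : QS s (v a : Ell2 I) = 0 := by
        rw [hQSa]
        refine Finset.sum_eq_zero fun i hi => ?_
        have hia : i ≠ a := fun h => ha (h ▸ hi)
        rw [hvo, if_neg hia, zero_smul, smul_zero]
      have h1 := hω.add_mode (hQSs s) (v.norm_eq_one a) h0 (hev a).1 (hev a).2
      have h2 : QS (insert a s) = QS s + (ev a : ℂ) • (innerSL ℂ (v a : Ell2 I)).smulRight (v a : Ell2 I) := by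
        simp only [QS]
        rw [Finset.sum_insert ha, add_comm]
      rw [h2]
      exact h1
  obtain ⟨ω, hω⟩ := main Finset.univ
  refine ⟨ω, ?_⟩
  convert hω using 1
  refine ContinuousLinearMap.ext fun x => ?_
  rw [hQSa]
  set y : U := U.orthogonalProjectionOnto x with hy
  have e1 : (U.starProjection ∘L Q ∘L U.starProjection) x = (T y : Ell2 I) := rfl
  have e2 : y = ∑ i, ⟪v i, y⟫_ℂ • v i := (v.sum_repr' y).symm
  have e3 : T y = ∑ i, (ev i : ℂ) • (⟪v i, y⟫_ℂ • v i) := by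
    conv_lhs => rw [e2]
    rw [map_sum]
    refine Finset.sum_congr rfl fun i _ => ?_
    rw [map_smul, hTv, smul_comm]
  rw [e1, e3, Submodule.coe_sum]
  refine Finset.sum_congr rfl fun i _ => ?_
  have e4 : ⟪v i, y⟫_ℂ = ⟪(v i : Ell2 I), x⟫_ℂ :=
    Submodule.inner_orthogonalProjectionOnto_eq_of_mem_left (v i) x
  rw [e4]
  rfl

theorem exists_isPreQuasiFree {Q : Ell2 I →L[ℂ] Ell2 I} (hQ : IsSymbol Q) :
    ∃ ω : FockOp I →ₗ[ℂ] ℂ, IsPreQuasiFree Q ω := by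
  classical
  let U : Finset I → Submodule ℂ (Ell2 I) := fun K =>
    Submodule.span ℂ ((K.image (basisVec : I → Ell2 I) : Finset (Ell2 I)) : Set (Ell2 I))
  have hfd : ∀ K, FiniteDimensional ℂ (U K) := fun K => FiniteDimensional.span_finset ℂ _
  have hmono : Monotone U := by
    intro K L hKL
    exact Submodule.span_mono (by exact_mod_cast Finset.image_subset_image hKL)
  have hmem : ∀ k, basisVec k ∈ ⨆ K, U K := by
    intro k
    refine Submodule.mem_iSup_of_mem {k} (Submodule.subset_span ?_)
    simp
  have htop : ⊤ ≤ (⨆ K, U K).topologicalClosure := by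
    intro x _
    have hx : HasSum (fun k => lp.single 2 k (coord x k)) x := lp.hasSum_single (by simp) x
    refine IsClosed.mem_of_tendsto (Submodule.isClosed_topologicalClosure _) hx
      (Filter.Eventually.of_forall fun s => ?_)
    refine Submodule.le_topologicalClosure _ (Submodule.sum_mem _ fun k _ => ?_)
    have e : lp.single 2 k (coord x k) = coord x k • (basisVec k : Ell2 I) := by
      rw [basisVec, ← lp.single_smul]
      simp
    rw [e]
    exact Submodule.smul_mem _ _ (hmem k)
  have hproj : ∀ x : Ell2 I, Tendsto (fun K => (U K).starProjection x) atTop (𝓝 x) := fun x =>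
    Submodule.starProjection_tendsto_self U hmono x htop
  have hcomp : ∀ x : Ell2 I,
      Tendsto (fun K => ((U K).starProjection ∘L Q ∘L (U K).starProjection) x) atTop (𝓝 (Q x)) := by
    intro x
    have h1 : Tendsto (fun K => (U K).starProjection (Q ((U K).starProjection x) - Q x)) atTop
        (𝓝 0) := by
      refine squeeze_zero_norm (a := fun K => ‖Q ((U K).starProjection x) - Q x‖) (fun K => ?_) ?_
      · exact Submodule.norm_starProjection_apply_le _ _
      · have h2 : Tendsto (fun K => Q ((U K).starProjection x) - Q x) atTop (𝓝 (Q x - Q x)) :=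
          ((Q.continuous.tendsto x).comp (hproj x)).sub tendsto_const_nhds
        rw [sub_self] at h2
        simpa using h2.norm
    have h3 := h1.add (hproj (Q x))
    rw [zero_add] at h3
    refine h3.congr fun K => ?_
    rw [map_sub, sub_add_cancel]
    rfl
  choose ω hω using fun K => exists_isPreQuasiFree_compress hQ (U K)
  let 𝒰 : Ultrafilter (Finset I) := Ultrafilter.of atTop
  have h𝒰 : (𝒰 : Filter (Finset I)) ≤ atTop := Ultrafilter.of_le _
  have hlim : ∀ X : FockOp I, ∃ z ∈ Metric.closedBall (0 : ℂ) ‖X‖,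
      Tendsto (fun K => ω K X) 𝒰 (𝓝 z) := by
    intro X
    have hc : IsCompact (Metric.closedBall (0 : ℂ) ‖X‖) := isCompact_closedBall _ _
    obtain ⟨z, hz, hz'⟩ := hc.ultrafilter_le_nhds (𝒰.map fun K => ω K X) (by
      rw [Filter.le_principal_iff]
      refine Filter.mem_map.2 (Filter.univ_mem' fun K => ?_)
      exact mem_closedBall_zero_iff.2 ((hω K).bound X))
    exact ⟨z, hz, hz'⟩
  choose L hLb hL using hlim
  let Ω : FockOp I →ₗ[ℂ] ℂ :=
    { toFun := L
      map_add' := fun X Y => by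
        refine tendsto_nhds_unique (hL (X + Y)) ?_
        simpa only [map_add] using (hL X).add (hL Y)
      map_smul' := fun c X => by
        refine tendsto_nhds_unique (hL (c • X)) ?_
        simpa only [map_smul, RingHom.id_apply] using (hL X).const_smul c }
  refine ⟨Ω, ⟨fun X => ?_, ?_, fun X => ?_, fun z X => ?_, fun φ X => ?_⟩⟩
  · exact ge_of_tendsto' (hL _) fun K => (hω K).pos X
  · refine tendsto_nhds_unique (hL 1) ?_
    simp only [(hω _).one]
    exact tendsto_const_nhds
  · exact mem_closedBall_zero_iff.1 (hLb X)
  · refine tendsto_nhds_unique (hL _) ?_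
    simp only [(hω _).gauge]
    exact hL X
  · have aux : ∀ (f : Finset I → FockOp I) (A : FockOp I), Tendsto f atTop (𝓝 A) →
        Tendsto (fun K => ω K (f K)) 𝒰 (𝓝 (L A)) := by
      intro f A hf
      have h1 : Tendsto (fun K => ω K (f K - A)) 𝒰 (𝓝 0) := by
        refine squeeze_zero_norm (a := fun K => ‖f K - A‖) (fun K => (hω K).bound _) ?_
        have := (hf.mono_left h𝒰).sub (tendsto_const_nhds (x := A))
        rw [sub_self] at this
        simpa using this.norm
      have h2 := h1.add (hL A)
      rw [zero_add] at h2
      refine h2.congr fun K => ?_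
      rw [map_sub, sub_add_cancel]
    have hcr : ∀ (x : Finset I → Ell2 I) (y : Ell2 I), Tendsto x atTop (𝓝 y) →
        Tendsto (fun K => creation (x K)) atTop (𝓝 (creation y)) := by
      intro x y hxy
      rw [tendsto_iff_norm_sub_tendsto_zero] at hxy ⊢
      refine squeeze_zero (fun K => norm_nonneg _) (fun K => ?_) hxy
      rw [← creation_sub]
      exact norm_creation_le _
    have hA := aux _ _ ((hcr _ _ ((tendsto_const_nhds (x := φ)).sub (hcomp φ))).mul_const X)
    have hB := aux _ _ ((hcr _ _ (hcomp φ)).const_mul X)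
    refine tendsto_nhds_unique hA ?_
    refine hB.congr fun K => ?_
    exact ((hω K).kms φ X).symm

/-- The parity operator `Γ(-1)` on Fock space: `(-1) ^ n` on the `n`-particle space. -/
def parityOp (I : Type*) : FockOp I :=
  weightedShift (fun S => (-1 : ℂ) ^ S.card) id (fun S => by simp) (fun S T _ _ h => h)

/-- The CAR algebra over `ℓ²(I)`: the C*-algebra generated by all `a(φ)` on Fock space. -/
def carAlgebra (I : Type*) [LinearOrder I] : StarSubalgebra ℂ (FockOp I) :=
  (StarAlgebra.adjoin ℂ (Set.range (annihilation : Ell2 I → FockOp I))).topologicalClosure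

/-- `a(φ)` as an element of the CAR algebra. -/
def carAnn (φ : Ell2 I) : carAlgebra I :=
  ⟨annihilation φ, StarSubalgebra.le_topologicalClosure _
    (StarAlgebra.subset_adjoin ℂ _ (Set.mem_range_self φ))⟩

/-- A state on the CAR algebra: a positive linear functional with value `1` at the identity. -/
def IsState (ω : carAlgebra I →ₗ[ℂ] ℂ) : Prop :=
  (∀ X : carAlgebra I, 0 ≤ ω (star X * X)) ∧ ω 1 = 1

/-- `a(φ₁)* ⋯ a(φ_n)* a(ψ_m) ⋯ a(ψ₁)`. -/
def carMonomial {n m : ℕ} (φ : Fin n → Ell2 I) (ψ : Fin m → Ell2 I) : carAlgebra I :=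
  (List.ofFn fun i => star (carAnn (φ i))).prod * (List.ofFn fun i => carAnn (ψ i.rev)).prod

/-- `ω` is the gauge-invariant quasi-free state with symbol `Q`: a state with
`ω(a(φ₁)* ⋯ a(φ_n)* a(ψ_m) ⋯ a(ψ₁)) = δ_{mn} det (⟪ψ_i, Q φ_j⟫)_{ij}`. -/
structure IsQuasiFree (Q : Ell2 I →L[ℂ] Ell2 I) (ω : carAlgebra I →ₗ[ℂ] ℂ) : Prop where
  isState : IsState ω
  apply_eq : ∀ (n : ℕ) (φ ψ : Fin n → Ell2 I),
    ω (carMonomial φ ψ) = (Matrix.of fun i j => ⟪ψ i, Q (φ j)⟫_ℂ).det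
  apply_ne : ∀ (n m : ℕ), n ≠ m → ∀ (φ : Fin n → Ell2 I) (ψ : Fin m → Ell2 I),
    ω (carMonomial φ ψ) = 0

theorem coe_carMonomial {n m : ℕ} (φ : Fin n → Ell2 I) (ψ : Fin m → Ell2 I) :
    (carMonomial φ ψ : FockOp I) = creationProd φ * annihilationProd ψ := by
  have h : ∀ L : List (carAlgebra I), ((L.prod : carAlgebra I) : FockOp I)
      = (L.map (Subtype.val : carAlgebra I → FockOp I)).prod := by
    intro L
    induction L with
    | nil => rfl
    | cons a L ih =>
      rw [List.prod_cons, List.map_cons, List.prod_cons, ← ih]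
      rfl
  have e : (carMonomial φ ψ : FockOp I)
      = ((List.ofFn fun i => star (carAnn (φ i))).prod : carAlgebra I)
        * ((List.ofFn fun i => carAnn (ψ i.rev)).prod : carAlgebra I) := rfl
  rw [e, h, h, List.map_ofFn, List.map_ofFn, creationProd, annihilationProd]
  congr 3
  funext i
  exact star_star (creation (φ i))

theorem exists_isQuasiFree {Q : Ell2 I →L[ℂ] Ell2 I} (hQ : IsSymbol Q) :
    ∃ ω : carAlgebra I →ₗ[ℂ] ℂ, IsQuasiFree Q ω := by
  obtain ⟨ω, hω⟩ := exists_isPreQuasiFree hQ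
  refine ⟨ω ∘ₗ (carAlgebra I).subtype.toAlgHom.toLinearMap, ⟨fun X => hω.pos X, hω.one⟩,
    fun n φ ψ => ?_, fun n m hnm φ ψ => ?_⟩
  · change ω (carMonomial φ ψ : FockOp I) = _
    rw [coe_carMonomial, hω.apply_eq]
  · change ω (carMonomial φ ψ : FockOp I) = _
    rw [coe_carMonomial, hω.apply_ne hnm]

/-- The gauge-invariant quasi-free state `ω_Q` with symbol `Q` on the CAR algebra. -/
def quasiFreeState (Q : Ell2 I →L[ℂ] Ell2 I) (hQ : IsSymbol Q) : carAlgebra I →ₗ[ℂ] ℂ :=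
  (exists_isQuasiFree hQ).choose

theorem quasiFreeState_spec (Q : Ell2 I →L[ℂ] Ell2 I) (hQ : IsSymbol Q) :
    IsQuasiFree Q (quasiFreeState Q hQ) := (exists_isQuasiFree hQ).choose_spec

/-- The even part of the CAR algebra: the elements fixed by the parity automorphism
`X ↦ Γ(-1) X Γ(-1)`. -/
def IsEven (X : carAlgebra I) : Prop :=
  parityOp I * (X : FockOp I) * parityOp I = X

/-- `ρ` is the density operator of the state `ω` on the CAR algebra over a finite-dimensional
one-particle space. -/
structure IsDensityOperator [Fintype I] (ω : carAlgebra I →ₗ[ℂ] ℂ) (ρ : FockOp I) : Prop where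
  pos : ρ.IsPositive
  trace_one : LinearMap.trace ℂ (Fock I) (ρ : Fock I →ₗ[ℂ] Fock I) = 1
  apply_eq : ∀ X : carAlgebra I,
    ω X = LinearMap.trace ℂ (Fock I) ((ρ * (X : FockOp I) : FockOp I) : Fock I →ₗ[ℂ] Fock I)

end CAR

section Chain

/-- `H_n ⊆ ℓ²(ℤ)`, the span of the canonical basis vectors at the sites `0, …, n - 1`. -/
def siteSpace (n : ℕ) : Submodule ℂ (Ell2 ℤ) :=
  Submodule.span ℂ (Set.range fun k : Fin n => (basisVec ((k : ℕ) : ℤ) : Ell2 ℤ))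

/-- The C*-subalgebra of the CAR algebra over `ℓ²(ℤ)` generated by `a(φ)`, `φ ∈ H_n`. -/
def localAlgebra (n : ℕ) : StarSubalgebra ℂ (FockOp ℤ) :=
  (StarAlgebra.adjoin ℂ (annihilation '' (siteSpace n : Set (Ell2 ℤ)))).topologicalClosure

/-- The natural embedding `V_n` of `ℂ^n` into `ℓ²(ℤ)`. -/
def siteEmbedding (n : ℕ) : Ell2 (Fin n) →L[ℂ] Ell2 ℤ :=
  ∑ k : Fin n, (innerSL ℂ (basisVec k : Ell2 (Fin n))).smulRight (basisVec ((k : ℕ) : ℤ) : Ell2 ℤ)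

/-- `Q_n = V_n* Q V_n`. -/
def restrictSymbol (n : ℕ) (Q : Ell2 ℤ →L[ℂ] Ell2 ℤ) : Ell2 (Fin n) →L[ℂ] Ell2 (Fin n) :=
  ContinuousLinearMap.adjoint (siteEmbedding n) ∘L Q ∘L siteEmbedding n

theorem siteEmbedding_apply (n : ℕ) (x : Ell2 (Fin n)) :
    siteEmbedding n x = ∑ k : Fin n, coord x k • (basisVec ((k : ℕ) : ℤ) : Ell2 ℤ) := by
  rw [siteEmbedding, _root_.sum_apply]
  refine Finset.sum_congr rfl fun k _ => ?_
  change ⟪basisVec k, x⟫_ℂ • (basisVec ((k : ℕ) : ℤ) : Ell2 ℤ) = _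
  rw [inner_basisVec]

theorem inner_siteEmbedding (n : ℕ) (x y : Ell2 (Fin n)) :
    ⟪siteEmbedding n x, siteEmbedding n y⟫_ℂ = ⟪x, y⟫_ℂ := by
  rw [siteEmbedding_apply, siteEmbedding_apply, sum_inner, lp.inner_eq_tsum, tsum_fintype]
  refine Finset.sum_congr rfl fun k _ => ?_
  rw [inner_sum, Finset.sum_eq_single k]
  · rw [inner_smul_left, inner_smul_right, inner_basisVec, coord_basisVec, if_pos rfl]
    simp [coord, mul_comm]
  · intro l _ hl
    rw [inner_smul_left, inner_smul_right, inner_basisVec, coord_basisVec, if_neg]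
    · simp
    · intro h
      exact hl (Fin.ext (by exact_mod_cast h.symm))
  · simp

theorem inner_restrictSymbol (n : ℕ) (A : Ell2 ℤ →L[ℂ] Ell2 ℤ) (x y : Ell2 (Fin n)) :
    ⟪y, restrictSymbol n A x⟫_ℂ = ⟪siteEmbedding n y, A (siteEmbedding n x)⟫_ℂ := by
  have e : restrictSymbol n A x
      = ContinuousLinearMap.adjoint (siteEmbedding n) (A (siteEmbedding n x)) := rfl
  rw [e, ContinuousLinearMap.adjoint_inner_right]

theorem restrictSymbol_isPositive (n : ℕ) {A : Ell2 ℤ →L[ℂ] Ell2 ℤ} (hA : A.IsPositive) :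
    (restrictSymbol n A).IsPositive :=
  ContinuousLinearMap.IsPositive.adjoint_conj hA (siteEmbedding n)

theorem restrictSymbol_isSymbol (n : ℕ) {Q : Ell2 ℤ →L[ℂ] Ell2 ℤ} (hQ : IsSymbol Q) :
    IsSymbol (restrictSymbol n Q) := by
  refine ⟨restrictSymbol_isPositive n hQ.1, ?_⟩
  have e : 1 - restrictSymbol n Q = restrictSymbol n (1 - Q) := by
    refine ContinuousLinearMap.ext fun x => ext_inner_left ℂ fun y => ?_
    have e1 : (1 - restrictSymbol n Q) x = x - restrictSymbol n Q x := rfl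
    have e3 : (1 - Q) (siteEmbedding n x) = siteEmbedding n x - Q (siteEmbedding n x) := rfl
    rw [e1, inner_sub_right, inner_restrictSymbol, inner_restrictSymbol, e3, inner_sub_right,
      inner_siteEmbedding]
  rw [e]
  exact restrictSymbol_isPositive n hQ.2

instance two_pi_pos_fact : Fact (0 < 2 * Real.pi) := ⟨Real.two_pi_pos⟩

/-- A symbol function on `[0, 2π)`, carried over to `ℝ / 2πℤ`. -/
def symbolOnCircle (q : Set.Ico (0 : ℝ) (2 * Real.pi) → Set.Icc (0 : ℝ) 1)
    (x : AddCircle (2 * Real.pi)) : ℝ :=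
  q ⟨AddCircle.equivIco (2 * Real.pi) 0 x, by
    have h := (AddCircle.equivIco (2 * Real.pi) 0 x).2
    exact ⟨h.1, h.2.trans_eq (zero_add _)⟩⟩

theorem measurable_symbolOnCircle {q : Set.Ico (0 : ℝ) (2 * Real.pi) → Set.Icc (0 : ℝ) 1}
    (hq : Measurable q) : Measurable (symbolOnCircle q) := by
  have h1 : Measurable (fun x : AddCircle (2 * Real.pi) =>
      ((AddCircle.equivIco (2 * Real.pi) 0 x : ℝ))) := by
    refine measurable_of_continuousOn_compl_singleton ((0 : ℝ) : AddCircle (2 * Real.pi)) ?_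
    intro x hx
    exact (continuous_subtype_val.continuousAt.comp
      (AddCircle.continuousAt_equivIco (2 * Real.pi) 0 hx)).continuousWithinAt
  exact measurable_subtype_coe.comp (hq.comp (h1.subtype_mk))

theorem memLp_symbolOnCircle {q : Set.Ico (0 : ℝ) (2 * Real.pi) → Set.Icc (0 : ℝ) 1}
    (hq : Measurable q) :
    MemLp (fun x => (symbolOnCircle q x : ℂ)) ∞ (AddCircle.haarAddCircle (T := 2 * Real.pi)) := by
  refine memLp_top_of_bound
    (Complex.measurable_ofReal.comp (measurable_symbolOnCircle hq)).aestronglyMeasurable 1 ?_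
  refine Filter.Eventually.of_forall fun x => ?_
  have hb : 0 ≤ symbolOnCircle q x ∧ symbolOnCircle q x ≤ 1 := (q _).2
  rw [Complex.norm_real, Real.norm_of_nonneg hb.1]
  exact hb.2

/-- Multiplication by the symbol function, on `L²(ℝ / 2πℤ)`. -/
def multiplicationOp (q : Set.Ico (0 : ℝ) (2 * Real.pi) → Set.Icc (0 : ℝ) 1) (hq : Measurable q) :
    Lp ℂ 2 (AddCircle.haarAddCircle (T := 2 * Real.pi)) →L[ℂ]
      Lp ℂ 2 (AddCircle.haarAddCircle (T := 2 * Real.pi)) :=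
  (ContinuousLinearMap.mul ℂ ℂ).holderL AddCircle.haarAddCircle ∞ 2 2
    ((memLp_symbolOnCircle hq).toLp _)

/-- The Fourier transformation `ℓ²(ℤ) → L²(ℝ / 2πℤ)`, mapping the basis vector at `k` to
`x ↦ exp (i k x)`, for the normalized measure `dx / 2π`. -/
def fourierTransformation :
    Ell2 ℤ ≃ₗᵢ[ℂ] Lp ℂ 2 (AddCircle.haarAddCircle (T := 2 * Real.pi)) :=
  fourierBasis.repr.symm

/-- The translation-invariant operator `F⁻¹ M_q F` on `ℓ²(ℤ)`. -/
def translationInvariantSymbol (q : Set.Ico (0 : ℝ) (2 * Real.pi) → Set.Icc (0 : ℝ) 1)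
    (hq : Measurable q) : Ell2 ℤ →L[ℂ] Ell2 ℤ :=
  (fourierTransformation.symm.toContinuousLinearEquiv :
      Lp ℂ 2 (AddCircle.haarAddCircle (T := 2 * Real.pi)) →L[ℂ] Ell2 ℤ) ∘L
    multiplicationOp q hq ∘L (fourierTransformation.toContinuousLinearEquiv :
      Ell2 ℤ →L[ℂ] Lp ℂ 2 (AddCircle.haarAddCircle (T := 2 * Real.pi)))

theorem translationInvariantSymbol_isSymbol
    (q : Set.Ico (0 : ℝ) (2 * Real.pi) → Set.Icc (0 : ℝ) 1) (hq : Measurable q) :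
    IsSymbol (translationInvariantSymbol q hq) := by
  set Q := translationInvariantSymbol q hq with hQ
  have key : ∀ x : Ell2 ℤ, ∃ t : ℝ, 0 ≤ t ∧ t ≤ ‖x‖ ^ 2 ∧ ⟪Q x, x⟫_ℂ = t := by
    intro x
    set g := fourierTransformation x with hg
    have e1 : ⟪Q x, x⟫_ℂ = ⟪multiplicationOp q hq g, g⟫_ℂ := by
      have e0 : Q x = fourierTransformation.symm (multiplicationOp q hq g) := rfl
      rw [e0, ← LinearIsometryEquiv.inner_map_map fourierTransformation,
        LinearIsometryEquiv.apply_symm_apply]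
    have hM : multiplicationOp q hq g =ᵐ[AddCircle.haarAddCircle]
        fun t => (symbolOnCircle q t : ℂ) * g t := by
      have h1 := ContinuousLinearMap.coeFn_holder (r := 2) (ContinuousLinearMap.mul ℂ ℂ)
        ((memLp_symbolOnCircle hq).toLp _) g
      filter_upwards [h1, (memLp_symbolOnCircle hq).coeFn_toLp] with t ht ht2
      change ((ContinuousLinearMap.mul ℂ ℂ).holder 2 ((memLp_symbolOnCircle hq).toLp _) g) t = _
      rw [ht, ht2]
      rfl
    have hint : Integrable (fun t => ‖g t‖ ^ 2) (AddCircle.haarAddCircle (T := 2 * Real.pi)) := by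
      have := (Lp.memLp g).integrable_norm_pow (by norm_num)
      simpa using this
    have hnorm : ∫ t, ‖g t‖ ^ 2 ∂(AddCircle.haarAddCircle (T := 2 * Real.pi)) = ‖x‖ ^ 2 := by
      have h2 : ⟪g, g⟫_ℂ = (((∫ t, ‖g t‖ ^ 2 ∂(AddCircle.haarAddCircle (T := 2 * Real.pi))) : ℝ) : ℂ) := by
        rw [L2.inner_def, ← integral_complex_ofReal]
        refine integral_congr_ae (Filter.Eventually.of_forall fun t => ?_)
        change ⟪g t, g t⟫_ℂ = ((‖g t‖ ^ 2 : ℝ) : ℂ)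
        rw [inner_self_eq_norm_sq_to_K]
        norm_cast
      have h3 : ‖g‖ = ‖x‖ := LinearIsometryEquiv.norm_map _ _
      rw [inner_self_eq_norm_sq_to_K, h3] at h2
      apply Complex.ofReal_injective
      rw [← h2]
      push_cast
      rfl
    have hb : ∀ t, 0 ≤ symbolOnCircle q t ∧ symbolOnCircle q t ≤ 1 := fun t => (q _).2
    refine ⟨∫ t, symbolOnCircle q t * ‖g t‖ ^ 2 ∂AddCircle.haarAddCircle, ?_, ?_, ?_⟩
    · exact integral_nonneg fun t => mul_nonneg (hb t).1 (sq_nonneg _)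
    · rw [← hnorm]
      refine integral_mono_of_nonneg
        (Filter.Eventually.of_forall fun t => mul_nonneg (hb t).1 (sq_nonneg _)) hint
        (Filter.Eventually.of_forall fun t => mul_le_of_le_one_left (sq_nonneg _) (hb t).2)
    · rw [e1, L2.inner_def, ← integral_complex_ofReal]
      refine integral_congr_ae ?_
      filter_upwards [hM] with t ht
      rw [ht]
      change ⟪(symbolOnCircle q t : ℂ) * g t, g t⟫_ℂ = _
      rw [← smul_eq_mul, inner_smul_left, inner_self_eq_norm_sq_to_K, Complex.conj_ofReal]
      push_cast
      rfl
  constructor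
  · rw [ContinuousLinearMap.isPositive_iff_complex]
    intro x
    obtain ⟨t, h0, h1, ht⟩ := key x
    rw [ht]
    simpa using h0
  · rw [ContinuousLinearMap.isPositive_iff_complex]
    intro x
    obtain ⟨t, h0, h1, ht⟩ := key x
    have e : ⟪(1 - Q) x, x⟫_ℂ = ((‖x‖ ^ 2 - t : ℝ) : ℂ) := by
      have e0 : (1 - Q) x = x - Q x := rfl
      rw [e0, inner_sub_left, ht, inner_self_eq_norm_sq_to_K]
      push_cast
      rfl
    rw [e]
    have e2 : RCLike.re ((‖x‖ ^ 2 - t : ℝ) : ℂ) = ‖x‖ ^ 2 - t := Complex.ofReal_re _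
    rw [e2]
    exact ⟨rfl, by linarith⟩

/-- The gauge- and translation-invariant quasi-free state on the CAR algebra over `ℓ²(ℤ)` given by
the symbol function `q`. -/
def chainState (q : Set.Ico (0 : ℝ) (2 * Real.pi) → Set.Icc (0 : ℝ) 1) (hq : Measurable q) :
    carAlgebra ℤ →ₗ[ℂ] ℂ :=
  quasiFreeState (translationInvariantSymbol q hq) (translationInvariantSymbol_isSymbol q hq)

/-- The quasi-free state `ω_{Q_n}` on the CAR algebra over `ℂ^n`, `Q_n = V_n* Q V_n`, describing the
sites `0, …, n - 1`. -/
def localState (q : Set.Ico (0 : ℝ) (2 * Real.pi) → Set.Icc (0 : ℝ) 1) (hq : Measurable q)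
    (n : ℕ) : carAlgebra (Fin n) →ₗ[ℂ] ℂ :=
  quasiFreeState (restrictSymbol n (translationInvariantSymbol q hq))
    (restrictSymbol_isSymbol n (translationInvariantSymbol_isSymbol q hq))

/-- `-(1/n) log ω(X)` as an extended real number, `+∞` if `ω(X) = 0`. -/
def errorRate (ω : carAlgebra ℤ →ₗ[ℂ] ℂ) (n : ℕ) (X : carAlgebra ℤ) : EReal :=
  -((((1 : ℝ) / n : ℝ) : EReal) * ENNReal.log (ENNReal.ofReal (ω X).re))

/-- `T` is a test: `0 ≤ T ≤ 1`. -/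
def IsTest (T : carAlgebra ℤ) : Prop :=
  (T : FockOp ℤ).IsPositive ∧ (1 - (T : FockOp ℤ)).IsPositive

/-- `ω₀` and `ω₁` can be super-exponentially distinguished by local tests with the property `P`: for
some sequence of such tests on the sites `0, …, n - 1`, both error exponents are `+∞`. -/
def SuperExpDistinguishableBy (P : carAlgebra ℤ → Prop) (ω₀ ω₁ : carAlgebra ℤ →ₗ[ℂ] ℂ) : Prop :=
  ∃ T : ℕ → carAlgebra ℤ,
    (∀ n, (T n : FockOp ℤ) ∈ localAlgebra n ∧ IsTest (T n) ∧ P (T n)) ∧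
    Filter.liminf (fun n => errorRate ω₀ n (1 - T n)) Filter.atTop = ⊤ ∧
    Filter.liminf (fun n => errorRate ω₁ n (T n)) Filter.atTop = ⊤

end Chain

end
end Fermi

namespace Fermi
noncomputable section

/-! The two states are told apart by counting particles with momentum in the window `[α, ω]`, which
`ω_Q` leaves empty and `ω_R` fills. On `n` sites momentum is not sharp, but a normalized plane wave
whose frequency lies in the window at distance at least `δ` from its ends has only `O(1/n)` of its
mass outside: there its squared modulus is that of a geometric sum, divided by `n`. The frequencies
`2πj/n` give orthonormal waves, so `2k` such modes fit with `k ≥ κ n` (`exists_concentrated_modes`).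
Each is occupied under `ω_Q`, and empty under `ω_R`, with probability at most `C/n`.

The test accepts `ω_Q` if fewer than `k` of the `2k` modes are occupied. If it errs, some `k` modes
are all occupied (under `ω_Q`) or all empty (under `ω_R`). The probability of this for a given set
of `k` modes is a `k × k` determinant of a positive semidefinite matrix with diagonal at most `C/n`,
hence at most `(C/n)^k` by the inequality of arithmetic and geometric means on the eigenvalues
(`Matrix.PosSemidef.re_det_le_pow`). There are at most `4^k` sets to sum over, so both errors are at
most `(4C/n)^k` (`exists_counting_test`), which is `exp(-c n log n)` because `k` grows linearly in
`n`. The finitely many small `n` only need errors below `1`, for which looking at one site is enough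
(`exists_single_site_test`).

The determinants come from writing a product of number operators in normal order, and a product of
their complements in antinormal order. The antinormal formula, with symbol `1 - Q`, follows from the
KMS-type relation in `IsPreQuasiFree`. A quasi-free state is specified only by its values on
normally ordered monomials, but these span the polynomials in the field operators, and all tests are
polynomials; so the functional with the KMS relation may be used in place of the given state.

For the density operators the same relation reads `ρ c((1 - Q)φ) = c(Qφ) ρ`. If `Q` and `1 - Q` are
surjective, the kernel of `ρ` is therefore invariant under all creation and annihilation operators.
These generate all operators on the finite-dimensional Fock space (`mem_carPolynomials`), so the
kernel is trivial or everything, and trace one excludes the latter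
(`IsPreQuasiFree.isUnit_traceDual`). Surjectivity of `Q_n` and `1 - Q_n` holds because a nonzero
trigonometric polynomial has finitely many zeros, so both quadratic forms are strictly positive. -/

theorem parityOp_mul_self {I : Type*} : parityOp I * parityOp I = 1 := by
  refine ContinuousLinearMap.ext fun f => ext_coord fun S => ?_
  change (-1 : ℂ) ^ S.card * ((-1 : ℂ) ^ S.card * coord f S) = coord f S
  rw [← mul_assoc, ← mul_pow]
  simp

theorem parityOp_eq_phaseOp {I : Type*} : parityOp I = phaseOp I (-1) := by
  refine ContinuousLinearMap.ext fun f => ext_coord fun S => ?_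
  rw [phaseOp_apply, Circle.coe_neg, Circle.coe_one]
  rfl

/-! ### Normal ordering, and quasi-free states on polynomials in the field operators -/

section QuasiFree

variable {I : Type*} [LinearOrder I]

/-- The *-algebra generated by the annihilation operators, without closure. -/
abbrev carPolynomials (I : Type*) [LinearOrder I] : StarSubalgebra ℂ (FockOp I) :=
  StarAlgebra.adjoin ℂ (Set.range (annihilation : Ell2 I → FockOp I))

theorem carPolynomials_le : carPolynomials I ≤ carAlgebra I :=
  StarSubalgebra.le_topologicalClosure _

theorem annihilation_mem (φ : Ell2 I) : annihilation φ ∈ carPolynomials I :=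
  StarAlgebra.subset_adjoin ℂ _ (Set.mem_range_self φ)

theorem creation_mem (φ : Ell2 I) : creation φ ∈ carPolynomials I := by
  have h := star_mem (annihilation_mem φ)
  rwa [annihilation, star_star] at h

/-- The linear span of the normally ordered monomials. -/
def normalSpan (I : Type*) [LinearOrder I] : Submodule ℂ (FockOp I) :=
  Submodule.span ℂ {X | ∃ (n m : ℕ) (φ : Fin n → Ell2 I) (ψ : Fin m → Ell2 I),
    X = creationProd φ * annihilationProd ψ}

theorem creation_mul_mem_normalSpan (ξ : Ell2 I) {X : FockOp I} (hX : X ∈ normalSpan I) :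
    creation ξ * X ∈ normalSpan I := by
  induction hX using Submodule.span_induction with
  | mem X h =>
    obtain ⟨n, m, φ, ψ, rfl⟩ := h
    refine Submodule.subset_span ⟨n + 1, m, Fin.cons ξ φ, ψ, ?_⟩
    rw [creationProd_succ, ← mul_assoc]
    simp
  | zero => simp
  | add X Y _ _ hX hY => rw [mul_add]; exact add_mem hX hY
  | smul c X _ hX => rw [mul_smul_comm]; exact Submodule.smul_mem _ _ hX

theorem anticomm_annihilation (φ ψ : Ell2 I) :
    annihilation φ * annihilation ψ + annihilation ψ * annihilation φ = 0 := by
  have h := congrArg star (anticomm_creation ψ φ)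
  simpa only [star_add, star_mul, star_zero, annihilation] using h

theorem annihilation_mul_annihilationProd (ξ : Ell2 I) {n : ℕ} (φ : Fin n → Ell2 I) :
    annihilation ξ * annihilationProd φ = ((-1 : ℂ) ^ n) • (annihilationProd φ * annihilation ξ) := by
  induction n with
  | zero => simp [annihilationProd_zero]
  | succ n ih =>
    rw [annihilationProd_succ, ← mul_assoc, ih, smul_mul_assoc, mul_assoc,
      eq_neg_of_add_eq_zero_left (anticomm_annihilation ξ (φ 0)), mul_neg, smul_neg, pow_succ,
      mul_neg_one, neg_smul, mul_assoc]

/-- Induction on the number of creation operators: the anticommutation relation moves `annihilation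
ξ` past the first of them, leaving a scalar contraction. With none left it joins the annihilation
operators, at the right end and at the cost of a sign. -/
theorem annihilation_mul_mem_normalSpan (ξ : Ell2 I) {X : FockOp I} (hX : X ∈ normalSpan I) :
    annihilation ξ * X ∈ normalSpan I := by
  induction hX using Submodule.span_induction with
  | mem X h =>
    obtain ⟨n, m, φ, ψ, rfl⟩ := h
    induction n with
    | zero =>
      have e : annihilation ξ * (creationProd φ * annihilationProd ψ)
          = ((-1 : ℂ) ^ m) • (creationProd φ * annihilationProd (Fin.cons ξ ψ : Fin (m + 1) → Ell2 I)) := by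
        rw [creationProd_zero, one_mul, one_mul, annihilation_mul_annihilationProd,
          annihilationProd_succ]
        simp
      rw [e]
      exact Submodule.smul_mem _ _ (Submodule.subset_span ⟨0, m + 1, φ, _, rfl⟩)
    | succ n ih =>
      have e : annihilation ξ * (creationProd φ * annihilationProd ψ)
          = ⟪ξ, φ 0⟫_ℂ • (creationProd (fun i => φ i.succ) * annihilationProd ψ)
            - creation (φ 0)
              * (annihilation ξ * (creationProd (fun i => φ i.succ) * annihilationProd ψ)) := by
        rw [creationProd_succ]
        simp only [← mul_assoc]
        rw [eq_sub_of_add_eq (anticomm_annihilation_creation ξ (φ 0))]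
        simp only [sub_mul, smul_mul_assoc, one_mul]
      rw [e]
      exact sub_mem (Submodule.smul_mem _ _ (Submodule.subset_span ⟨n, m, _, ψ, rfl⟩))
        (creation_mul_mem_normalSpan _ (ih _))
  | zero => simp
  | add X Y _ _ hX hY => rw [mul_add]; exact add_mem hX hY
  | smul c X _ hX => rw [mul_smul_comm]; exact Submodule.smul_mem _ _ hX

/-- The span is stable under left multiplication by the generators and their adjoints, hence by the
whole algebra, and it contains `1`. -/
theorem mem_normalSpan {X : FockOp I} (hX : X ∈ carPolynomials I) : X ∈ normalSpan I := by
  have h1 : ∀ Y ∈ normalSpan I, X * Y ∈ normalSpan I := by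
    change X ∈ (carPolynomials I).toSubalgebra at hX
    rw [StarAlgebra.adjoin_toSubalgebra] at hX
    induction hX using Algebra.adjoin_induction with
    | mem X h =>
      intro Y hY
      rcases h with ⟨φ, rfl⟩ | ⟨φ, hφ⟩
      · exact annihilation_mul_mem_normalSpan φ hY
      · have : X = creation φ := by
          rw [← star_star X, ← hφ, annihilation, star_star]
        rw [this]
        exact creation_mul_mem_normalSpan φ hY
    | algebraMap r =>
      intro Y hY
      rw [← Algebra.smul_def]
      exact Submodule.smul_mem _ _ hY
    | add A B _ _ hA hB => intro Y hY; rw [add_mul]; exact add_mem (hA Y hY) (hB Y hY)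
    | mul A B _ _ hA hB => intro Y hY; rw [mul_assoc]; exact hA _ (hB Y hY)
  have h2 := h1 1 (Submodule.subset_span ⟨0, 0, 0, 0, by
    rw [creationProd_zero, annihilationProd_zero, one_mul]⟩)
  rwa [mul_one] at h2

/-- Both functionals have the same values on normally ordered monomials, which span the polynomials.
No continuity is involved, as nothing is claimed on the norm closure. -/
theorem IsQuasiFree.eq_of_isPreQuasiFree {Q : Ell2 I →L[ℂ] Ell2 I} {ω : carAlgebra I →ₗ[ℂ] ℂ}
    {ω' : FockOp I →ₗ[ℂ] ℂ} (hω : IsQuasiFree Q ω) (hω' : IsPreQuasiFree Q ω')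
    (X : carAlgebra I) (hX : (X : FockOp I) ∈ carPolynomials I) : ω X = ω' X := by
  -- Membership in the CAR algebra goes into the claim, since the span induction runs over bare
  -- operators on which `ω` is not defined.
  suffices h : ∃ h : (X : FockOp I) ∈ carAlgebra I, ω ⟨X, h⟩ = ω' X from h.choose_spec
  have h1 := mem_normalSpan hX
  generalize (X : FockOp I) = Y at h1
  induction h1 using Submodule.span_induction with
  | mem X h =>
    obtain ⟨n, m, φ, ψ, rfl⟩ := h
    rw [← coe_carMonomial]
    refine ⟨(carMonomial φ ψ).2, ?_⟩
    change ω (carMonomial φ ψ) = _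
    rw [coe_carMonomial]
    by_cases hnm : n = m
    · subst hnm
      rw [hω.apply_eq, hω'.apply_eq]
    · rw [hω.apply_ne n m hnm, hω'.apply_ne hnm]
  | zero => exact ⟨zero_mem _, by rw [map_zero]; exact map_zero ω⟩
  | add X Y _ _ hX hY =>
    obtain ⟨hX, eX⟩ := hX
    obtain ⟨hY, eY⟩ := hY
    refine ⟨add_mem hX hY, ?_⟩
    rw [map_add, ← eX, ← eY, ← map_add]
    rfl
  | smul c X _ hX =>
    obtain ⟨hX, eX⟩ := hX
    refine ⟨(carAlgebra I).smul_mem hX c, ?_⟩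
    rw [map_smul, ← eX, ← map_smul]
    rfl

/-- This makes the KMS relation and positivity on all bounded operators available for the abstractly
chosen `quasiFreeState`. -/
theorem exists_isPreQuasiFree_eq_quasiFreeState {Q : Ell2 I →L[ℂ] Ell2 I} (hQ : IsSymbol Q) :
    ∃ ω : FockOp I →ₗ[ℂ] ℂ, IsPreQuasiFree Q ω ∧
      ∀ X : carAlgebra I, (X : FockOp I) ∈ carPolynomials I → quasiFreeState Q hQ X = ω X := by
  obtain ⟨ω, hω⟩ := exists_isPreQuasiFree hQ
  exact ⟨ω, hω, fun X hX => (quasiFreeState_spec Q hQ).eq_of_isPreQuasiFree hω X hX⟩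

/-- The particle-hole dual of `IsPreQuasiFree.apply_eq`. Move `creation (φ 0)` to the right end and
split it along `(1 - Q) + Q`; the KMS relation carries the `Q` part round to the left end as
`creation ξ`. Commuting it back to the right cancels the other part and leaves contractions `⟪ψ i,
ξ⟫`, which form the Laplace expansion of the determinant along its first column. -/
theorem IsPreQuasiFree.apply_antinormal {Q : Ell2 I →L[ℂ] Ell2 I} {ω : FockOp I →ₗ[ℂ] ℂ}
    (h : IsPreQuasiFree Q ω) {n : ℕ} (φ ψ : Fin n → Ell2 I) :
    ω (annihilationProd ψ * creationProd φ)
      = (Matrix.of fun i j => ⟪ψ i, (1 - Q) (φ j)⟫_ℂ).det := by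
  induction n with
  | zero => simp [creationProd_zero, annihilationProd_zero, h.one]
  | succ n ih =>
    set ξ := (1 - Q) (φ 0) with hξ
    have hξ' : ξ = φ 0 - Q (φ 0) := rfl
    set C := creationProd (fun i => φ i.succ) with hC
    have e0 : annihilationProd ψ * creationProd φ
        = ((-1 : ℂ) ^ n) • (annihilationProd ψ * C * creation (φ 0)) := by
      rw [creationProd_succ, creation_mul_creationProd, mul_smul_comm, mul_assoc]
    have e1 : ω (annihilationProd ψ * C * creation (φ 0))
        = ω (annihilationProd ψ * C * creation ξ) + ω (creation ξ * (annihilationProd ψ * C)) := by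
      have h1 := h.kms (φ 0) (annihilationProd ψ * C)
      rw [← hξ'] at h1
      have h2 : creation (φ 0) = creation ξ + creation (Q (φ 0)) := by
        rw [← creation_add, hξ', sub_add_cancel]
      rw [h1, h2, mul_add, map_add]
    have e2 : creation ξ * (annihilationProd ψ * C) = -(annihilationProd ψ * C * creation ξ)
        + ∑ i : Fin (n + 1), ((-1 : ℂ) ^ (n + (i : ℕ)) * ⟪ψ i, ξ⟫_ℂ) •
            (annihilationProd (fun j => ψ (i.succAbove j)) * C) := by
      rw [← mul_assoc, creation_mul_annihilationProd, add_mul, smul_mul_assoc, mul_assoc,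
        hC, creation_mul_creationProd, mul_smul_comm, smul_smul, ← pow_add,
        show n + 1 + n = 2 * n + 1 by ring, pow_succ, pow_mul, Finset.sum_mul]
      simp [mul_assoc]
    rw [e0, map_smul, e1, e2, map_add, map_neg, add_neg_cancel_left, map_sum,
      Matrix.det_succ_column_zero, Finset.smul_sum]
    refine Finset.sum_congr rfl fun i _ => ?_
    rw [map_smul, ih, smul_eq_mul, smul_eq_mul, ← mul_assoc, ← mul_assoc, ← pow_add, ← add_assoc,
      ← two_mul, pow_add, pow_mul]
    simp only [neg_one_sq, one_pow, one_mul]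
    rfl

/-! ### Number operators of orthonormal modes -/

/-- The number operator of the mode `f`. -/
def modeNumber (f : Ell2 I) : FockOp I := creation f * annihilation f

theorem one_sub_modeNumber {f : Ell2 I} (hf : ⟪f, f⟫_ℂ = 1) :
    1 - modeNumber f = annihilation f * creation f := by
  have := anticomm_annihilation_creation f f
  rw [hf, one_smul] at this
  rw [modeNumber, ← this, add_sub_cancel_right]

theorem isStarProjection_modeNumber {f : Ell2 I} (hf : ⟪f, f⟫_ℂ = 1) :
    IsStarProjection (modeNumber f) := by
  refine ⟨?_, ?_⟩
  · have hcc : creation f * creation f = 0 := by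
      have := anticomm_creation f f
      have h2 : (2 : ℂ) • (creation f * creation f) = 0 := by rw [two_smul, this]
      exact (smul_eq_zero.1 h2).resolve_left two_ne_zero
    have h1 := one_sub_modeNumber hf
    have h2 : (1 - modeNumber f) * modeNumber f = 0 := by
      rw [h1, modeNumber, mul_assoc, ← mul_assoc (creation f), hcc, zero_mul, mul_zero]
    rw [sub_mul, one_mul, sub_eq_zero] at h2
    exact h2.symm
  · rw [IsSelfAdjoint, modeNumber, annihilation, star_mul, star_star]

/-- `creation g` anticommutes with both factors of the number operator, and the two signs cancel. -/
theorem commute_modeNumber_creation {f g : Ell2 I} (h : ⟪f, g⟫_ℂ = 0) :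
    Commute (modeNumber f) (creation g) := by
  have h1 := anticomm_annihilation_creation f g
  rw [h, zero_smul] at h1
  have h2 := anticomm_creation f g
  rw [Commute, SemiconjBy, modeNumber, mul_assoc, eq_neg_of_add_eq_zero_left h1, mul_neg,
    ← mul_assoc, eq_neg_of_add_eq_zero_left h2, neg_mul, neg_neg, mul_assoc]

theorem commute_modeNumber_annihilation {f g : Ell2 I} (h : ⟪f, g⟫_ℂ = 0) :
    Commute (modeNumber f) (annihilation g) := by
  have h1 := (commute_modeNumber_creation h).star_star
  rwa [modeNumber, star_mul, annihilation, star_star] at h1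

theorem commute_modeNumber {f g : Ell2 I} (h : ⟪f, g⟫_ℂ = 0) :
    Commute (modeNumber f) (modeNumber g) :=
  (commute_modeNumber_creation h).mul_right (commute_modeNumber_annihilation h)

theorem commute_modeNumber_annihilationProd {f : Ell2 I} {n : ℕ} {g : Fin n → Ell2 I}
    (h : ∀ i, ⟪f, g i⟫_ℂ = 0) : Commute (modeNumber f) (annihilationProd g) := by
  induction n with
  | zero => rw [annihilationProd_zero]; exact Commute.one_right _
  | succ n ih =>
    rw [annihilationProd_succ]
    exact (ih fun i => h i.succ).mul_right (commute_modeNumber_annihilation (h 0))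

/-- Normal order makes the probability that all these modes are occupied a determinant. In the
induction `annihilation (f 0)` commutes with the number operators of the later modes. -/
theorem prod_modeNumber {n : ℕ} {f : Fin n → Ell2 I} (hf : Orthonormal ℂ f) :
    (List.ofFn fun i => modeNumber (f i)).prod = creationProd f * annihilationProd f := by
  induction n with
  | zero => simp [creationProd_zero, annihilationProd_zero]
  | succ n ih =>
    have ih' := ih (hf.comp _ (Fin.succ_injective n))
    simp only [Function.comp_def] at ih'
    have ha : Commute (creationProd (fun i => f i.succ) * annihilationProd (fun i => f i.succ))
        (annihilation (f 0)) := by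
      rw [← ih']
      refine Commute.symm (Commute.list_prod_right _ _ fun x hx => ?_)
      obtain ⟨i, rfl⟩ := (List.mem_ofFn' _ _).1 hx
      exact (commute_modeNumber_annihilation (hf.2 (Fin.succ_ne_zero i))).symm
    rw [List.ofFn_succ, List.prod_cons, ih', creationProd_succ,
      annihilationProd_succ, modeNumber, mul_assoc, ← ha.eq]
    simp only [mul_assoc]

/-- The counterpart for empty modes: each factor is `annihilation (f i) * creation (f i)`, so the
product comes out antinormally ordered and `IsPreQuasiFree.apply_antinormal` applies. -/
theorem prod_one_sub_modeNumber {n : ℕ} {f : Fin n → Ell2 I} (hf : Orthonormal ℂ f) :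
    (List.ofFn fun i => 1 - modeNumber (f i)).prod = annihilationProd f * creationProd f := by
  induction n with
  | zero => simp [creationProd_zero, annihilationProd_zero]
  | succ n ih =>
    have h0 : ∀ i : Fin n, ⟪f 0, f i.succ⟫_ℂ = 0 := fun i => hf.2 (Fin.succ_ne_zero i).symm
    have h1 : ⟪f 0, f 0⟫_ℂ = 1 := by
      rw [inner_self_eq_norm_sq_to_K, hf.1]
      simp
    have ih' := ih (hf.comp _ (Fin.succ_injective n))
    simp only [Function.comp_def] at ih'
    have hc := (Commute.one_left _).sub_left (commute_modeNumber_annihilationProd h0)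
    rw [List.ofFn_succ, List.prod_cons, ih', creationProd_succ,
      annihilationProd_succ, ← mul_assoc, hc.eq, one_sub_modeNumber h1]
    simp only [mul_assoc]

theorem commute_parityOp_modeNumber (f : Ell2 I) : Commute (parityOp I) (modeNumber f) := by
  rw [Commute, SemiconjBy, parityOp_eq_phaseOp, modeNumber, ← mul_assoc, phaseOp_creation, mul_assoc,
    phaseOp_annihilation, mul_smul_comm, smul_mul_assoc, mul_assoc]

theorem isEven_of_commute {X : carAlgebra I} (h : Commute (parityOp I) (X : FockOp I)) :
    IsEven X := by
  rw [IsEven, h.eq, mul_assoc, parityOp_mul_self, mul_one]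

end QuasiFree

/-! ### Joint spectral projections and the majority test for commuting projections -/

section CommutingProjections

variable {B ι : Type*} [CommRing B] [StarRing B]

theorem isStarProjection_prod {p : ι → B} (hp : ∀ i, IsStarProjection (p i)) (s : Finset ι) :
    IsStarProjection (∏ i ∈ s, p i) := by
  classical
  induction s using Finset.induction_on with
  | empty => simp
  | insert a s ha ih =>
    rw [Finset.prod_insert ha]
    exact (hp a).mul ih (Commute.all _ _)

theorem isStarProjection_sum {E : ι → B} (hE : ∀ i, IsStarProjection (E i))
    (ho : ∀ i j, i ≠ j → E i * E j = 0) (s : Finset ι) : IsStarProjection (∑ i ∈ s, E i) := by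
  classical
  induction s using Finset.induction_on with
  | empty => simp
  | insert a s ha ih =>
    rw [Finset.sum_insert ha]
    refine (hE a).add ih ?_
    rw [Finset.mul_sum]
    exact Finset.sum_eq_zero fun i hi => ho _ _ fun h => ha (h ▸ hi)

variable [Fintype ι] [DecidableEq ι]

/-- The joint spectral projection on `p i = 1` for `i ∈ S` and `p i = 0` for `i ∉ S`. -/
def jointProjection (p : ι → B) (S : Finset ι) : B := (∏ i ∈ S, p i) * ∏ i ∈ Sᶜ, (1 - p i)

/-- Expand `∏ i, (p i + (1 - p i)) = 1`. -/
theorem sum_jointProjection {B ι : Type*} [CommRing B] [Fintype ι] [DecidableEq ι] (p : ι → B) :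
    ∑ S, jointProjection p S = 1 := by
  have h := Finset.prod_add p (fun i => 1 - p i) Finset.univ
  simp only [add_sub_cancel, Finset.prod_const_one, Finset.powerset_univ] at h
  rw [h]
  refine Finset.sum_congr rfl fun S _ => ?_
  rw [jointProjection, Finset.compl_eq_univ_sdiff]

theorem jointProjection_one_sub {B ι : Type*} [CommRing B] [Fintype ι] [DecidableEq ι]
    (p : ι → B) (S : Finset ι) :
    jointProjection (fun i => 1 - p i) Sᶜ = jointProjection p S := by
  simp only [jointProjection, compl_compl, sub_sub_cancel]
  rw [mul_comm]

theorem isStarProjection_jointProjection {p : ι → B} (hp : ∀ i, IsStarProjection (p i))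
    (S : Finset ι) : IsStarProjection (jointProjection p S) :=
  (isStarProjection_prod hp S).mul (isStarProjection_prod (fun i => (hp i).one_sub) Sᶜ)
    (Commute.all _ _)

theorem prod_mul_jointProjection {p : ι → B} (hp : ∀ i, IsStarProjection (p i))
    {U S : Finset ι} (h : U ⊆ S) : (∏ i ∈ U, p i) * jointProjection p S = jointProjection p S := by
  rw [jointProjection, ← Finset.prod_sdiff h, mul_comm (∏ i ∈ S \ U, p i), ← mul_assoc, ← mul_assoc,
    (isStarProjection_prod hp U).isIdempotentElem.eq]

/-- At an index in exactly one of the two sets, one projection absorbs `p i`, the other `1 - p i`,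
and `p i * (1 - p i) = 0`. -/
theorem jointProjection_mul_eq_zero {p : ι → B} (hp : ∀ i, IsStarProjection (p i))
    {S S' : Finset ι} (h : S ≠ S') : jointProjection p S * jointProjection p S' = 0 := by
  have key : ∀ {S S' : Finset ι} {i : ι}, i ∈ S → i ∉ S' →
      jointProjection p S * jointProjection p S' = 0 := by
    intro S S' i hi hi'
    have h1 : p i * jointProjection p S = jointProjection p S := by
      simpa using prod_mul_jointProjection hp (Finset.singleton_subset_iff.2 hi)
    have h2 : (1 - p i) * jointProjection p S' = jointProjection p S' := by
      have := prod_mul_jointProjection (fun i => (hp i).one_sub)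
        (Finset.singleton_subset_iff.2 (Finset.mem_compl.2 hi'))
      simpa [jointProjection_one_sub] using this
    have h3 : p i * (1 - p i) = 0 := (hp i).mul_one_sub_self
    rw [← h1, ← h2]
    linear_combination (jointProjection p S * jointProjection p S') * h3
  obtain ⟨i, hi⟩ : ∃ i, ¬ (i ∈ S ↔ i ∈ S') := by
    by_contra! h'
    exact h (Finset.ext h')
  by_cases hS : i ∈ S
  · exact key hS fun h' => hi ⟨fun _ => h', fun _ => hS⟩
  · rw [mul_comm]
    exact key (by tauto) hS

/-- For `U ⊆ S` with `k` elements, the joint projection at `S` lies below `∏ i ∈ U, p i`, so the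
difference is a projection and has nonnegative value. -/
theorem apply_jointProjection_le {p : ι → B} (hp : ∀ i, IsStarProjection (p i)) (ω : B →+ ℝ)
    (hω : ∀ P, IsStarProjection P → 0 ≤ ω P) {k : ℕ} {b : ℝ}
    (hb : ∀ U : Finset ι, U.card = k → ω (∏ i ∈ U, p i) ≤ b) {S : Finset ι} (hS : k ≤ S.card) :
    ω (jointProjection p S) ≤ b := by
  obtain ⟨U, hU, hUk⟩ := Finset.exists_subset_card_eq hS
  have h1 := hω _ ((isStarProjection_jointProjection hp S).sub_of_mul_eq_right
    (isStarProjection_prod hp U) (prod_mul_jointProjection hp hU))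
  rw [map_sub] at h1
  linarith [hb U hUk]

theorem apply_sum_jointProjection_le {p : ι → B} (hp : ∀ i, IsStarProjection (p i)) (ω : B →+ ℝ)
    (hω : ∀ P, IsStarProjection P → 0 ≤ ω P) {k : ℕ} {b : ℝ} (hb0 : 0 ≤ b)
    (hb : ∀ U : Finset ι, U.card = k → ω (∏ i ∈ U, p i) ≤ b) (F : Finset (Finset ι))
    (hF : ∀ S ∈ F, k ≤ S.card) :
    ω (∑ S ∈ F, jointProjection p S) ≤ 2 ^ Fintype.card ι * b := by
  rw [map_sum]
  calc ∑ S ∈ F, ω (jointProjection p S) ≤ ∑ S ∈ F, b :=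
        Finset.sum_le_sum fun S hS => apply_jointProjection_le hp ω hω hb (hF S hS)
    _ = F.card * b := by simp
    _ ≤ 2 ^ Fintype.card ι * b := by
        gcongr
        have := Finset.card_le_univ F
        rw [Fintype.card_finset] at this
        exact_mod_cast this

/-- `T` is the event that fewer than `k` of the `2k` projections are `1`. Its complement is the
event of at least `k` ones, and `T` itself is that of more than `k` zeros, so replacing `p` by `1 -
p` gives the second bound. `T` precedes the quantifier over `ω`, since one test has to serve two
states. -/
theorem exists_majority_projection {k : ℕ} (hι : Fintype.card ι = 2 * k) {p : ι → B}
    (hp : ∀ i, IsStarProjection (p i)) :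
    ∃ T : B, IsStarProjection T ∧ ∀ (ω : B →+ ℝ), (∀ P, IsStarProjection P → 0 ≤ ω P) →
      ∀ b : ℝ, 0 ≤ b →
        ((∀ U : Finset ι, U.card = k → ω (∏ i ∈ U, p i) ≤ b) → ω (1 - T) ≤ 2 ^ (2 * k) * b) ∧
        ((∀ U : Finset ι, U.card = k → ω (∏ i ∈ U, (1 - p i)) ≤ b) → ω T ≤ 2 ^ (2 * k) * b) := by
  refine ⟨∑ S with S.card < k, jointProjection p S,
    isStarProjection_sum (isStarProjection_jointProjection hp)
      (fun S S' h => jointProjection_mul_eq_zero hp h) _, fun ω hω b hb0 => ⟨fun hb => ?_, fun hb => ?_⟩⟩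
  · have e : 1 - ∑ S with S.card < k, jointProjection p S
        = ∑ S with ¬ S.card < k, jointProjection p S := by
      rw [← sum_jointProjection p, ← Finset.sum_filter_add_sum_filter_not _ (fun S => S.card < k),
        add_sub_cancel_left]
    rw [e, ← hι]
    refine apply_sum_jointProjection_le hp ω hω hb0 hb _ fun S hS => ?_
    simpa using hS
  · have e : ∑ S with S.card < k, jointProjection p S
        = ∑ S ∈ (Finset.univ.filter fun S : Finset ι => S.card < k).map
            ⟨compl, compl_injective⟩, jointProjection (fun i => 1 - p i) S := by
      rw [Finset.sum_map]
      exact Finset.sum_congr rfl fun S _ => (jointProjection_one_sub p S).symm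
    rw [e, ← hι]
    refine apply_sum_jointProjection_le (fun i => (hp i).one_sub) ω hω hb0 hb _ fun S hS => ?_
    obtain ⟨S, hS, rfl⟩ := Finset.mem_map.1 hS
    have h1 : S.card < k := by simpa using hS
    change k ≤ Sᶜ.card
    rw [Finset.card_compl]
    omega

end CommutingProjections

open scoped IsMulCommutative in
/-- Given `2 k` commuting projections, the test "fewer than `k` of them are `1`". -/
theorem exists_majority_test {A : Type*} [Ring A] [StarRing A] [Algebra ℂ A] [StarModule ℂ A]
    {k : ℕ} {p : Fin (2 * k) → A} (hp : ∀ i, IsStarProjection (p i))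
    (hcomm : ∀ i j, Commute (p i) (p j)) :
    ∃ T ∈ StarAlgebra.adjoin ℂ (Set.range p), IsStarProjection T ∧
      ∀ (ω : A →ₗ[ℂ] ℂ), (∀ X, 0 ≤ ω (star X * X)) → ∀ b : ℝ, 0 ≤ b →
        ((∀ e : Fin k ↪ Fin (2 * k), (ω (List.ofFn fun i => p (e i)).prod).re ≤ b) →
          (ω (1 - T)).re ≤ 2 ^ (2 * k) * b) ∧
        ((∀ e : Fin k ↪ Fin (2 * k), (ω (List.ofFn fun i => 1 - p (e i)).prod).re ≤ b) →
          (ω T).re ≤ 2 ^ (2 * k) * b) := by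
  -- The argument takes place in the commutative star-algebra generated by the projections, where
  -- products over finite sets make sense.
  have hc : IsMulCommutative (StarAlgebra.adjoin ℂ (Set.range p)) := by
    refine StarAlgebra.isMulCommutative_adjoin ℂ ?_ ?_
    · rintro _ ⟨i, rfl⟩ _ ⟨j, rfl⟩
      exact hcomm i j
    · rintro _ ⟨i, rfl⟩ _ ⟨j, rfl⟩
      rw [(hp j).isSelfAdjoint.star_eq]
      exact hcomm i j
  let p' : Fin (2 * k) → StarAlgebra.adjoin ℂ (Set.range p) := fun i =>
    ⟨p i, StarAlgebra.subset_adjoin ℂ _ (Set.mem_range_self i)⟩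
  have hp' : ∀ i, IsStarProjection (p' i) := fun i =>
    ⟨Subtype.ext (hp i).isIdempotentElem, Subtype.ext (hp i).isSelfAdjoint⟩
  obtain ⟨T, hT, h⟩ := exists_majority_projection (k := k) (by simp) hp'
  refine ⟨T, T.2, ⟨congrArg Subtype.val hT.isIdempotentElem,
    congrArg Subtype.val hT.isSelfAdjoint⟩, fun ω hω b hb => ?_⟩
  let ω' : StarAlgebra.adjoin ℂ (Set.range p) →+ ℝ :=
    { toFun := fun X => (ω X).re
      map_zero' := by simp
      map_add' := fun X Y => by simp }
  -- A projection equals `star P * P`, so positivity of `ω` applies.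
  have hω' : ∀ P, IsStarProjection P → 0 ≤ ω' P := by
    intro P hP
    have e : star (P : A) * P = P := by
      have h1 : star P = P := hP.isSelfAdjoint
      have h2 : P * P = P := hP.isIdempotentElem
      have h3 : star P * P = P := by rw [h1, h2]
      exact congrArg Subtype.val h3
    have h1 := hω (P : A)
    rw [e] at h1
    exact (Complex.le_def.1 h1).1
  -- Back in the noncommutative ring the product becomes a list, with `U` enumerated increasingly.
  -- This enumeration is the embedding to which the hypotheses are applied.
  have hprod : ∀ (q : Fin (2 * k) → StarAlgebra.adjoin ℂ (Set.range p)) (U : Finset (Fin (2 * k)))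
      (hU : U.card = k), ((∏ i ∈ U, q i : StarAlgebra.adjoin ℂ (Set.range p)) : A)
        = (List.ofFn fun i => (q (U.orderEmbOfFin hU i) : A)).prod := by
    intro q U hU
    have e1 : ∏ i ∈ U, q i = (List.ofFn fun i => q (U.orderEmbOfFin hU i)).prod := by
      rw [List.prod_ofFn]
      conv_lhs => rw [← Finset.map_orderEmbOfFin_univ U hU]
      rw [Finset.prod_map]
      rfl
    rw [e1]
    refine (map_list_prod (StarAlgebra.adjoin ℂ (Set.range p)).subtype _).trans ?_
    rw [List.map_ofFn]
    rfl
  refine ⟨fun hb' => (h ω' hω' b hb).1 fun U hU => ?_, fun hb' => (h ω' hω' b hb).2 fun U hU => ?_⟩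
  · change (ω _).re ≤ b
    rw [hprod p' U hU]
    exact hb' (U.orderEmbOfFin hU).toEmbedding
  · change (ω _).re ≤ b
    rw [hprod (fun i => 1 - p' i) U hU]
    exact hb' (U.orderEmbOfFin hU).toEmbedding

/-! ### Determinants of positive semidefinite matrices -/

section Determinant

/-- The determinant is the product of the nonnegative eigenvalues and the trace is their sum, so the
geometric mean of the eigenvalues is at most their arithmetic mean, which is at most `η`. -/
theorem _root_.Matrix.PosSemidef.re_det_le_pow {k : ℕ} {M : Matrix (Fin k) (Fin k) ℂ}
    (hM : M.PosSemidef) {η : ℝ} (hη : ∀ i, (M i i).re ≤ η) : M.det.re ≤ η ^ k := by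
  rcases Nat.eq_zero_or_pos k with rfl | hk
  · simp
  have hk' : (0 : ℝ) < k := by exact_mod_cast hk
  set l := hM.isHermitian.eigenvalues with hl
  have hl0 : ∀ i, 0 ≤ l i := hM.eigenvalues_nonneg
  have h1 : M.det.re = ∏ i, l i := by
    rw [hM.isHermitian.det_eq_prod_eigenvalues]
    change (∏ i, ((l i : ℝ) : ℂ)).re = _
    rw [← Complex.ofReal_prod, Complex.ofReal_re]
  have h2 : ∑ i, l i ≤ k * η := by
    have e : M.trace.re = ∑ i, l i := by
      rw [hM.isHermitian.trace_eq_sum_eigenvalues]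
      change (∑ i, ((l i : ℝ) : ℂ)).re = _
      rw [← Complex.ofReal_sum, Complex.ofReal_re]
    rw [← e, Matrix.trace, Complex.re_sum]
    refine (Finset.sum_le_sum fun i _ => hη i).trans ?_
    simp
  have h3 := Real.geom_mean_le_arith_mean Finset.univ (fun _ => 1) l (fun _ _ => zero_le_one)
    (by simpa using hk) (fun i _ => hl0 i)
  simp only [Real.rpow_one, Finset.sum_const, Finset.card_univ, Fintype.card_fin, nsmul_eq_mul,
    mul_one, one_mul] at h3
  have hP : 0 ≤ ∏ i, l i := Finset.prod_nonneg fun i _ => hl0 i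
  have h4 : (∏ i, l i) ^ ((k : ℝ)⁻¹) ≤ η :=
    h3.trans ((div_le_iff₀ hk').2 (by linarith))
  rw [h1]
  calc ∏ i, l i = ((∏ i, l i) ^ ((k : ℝ)⁻¹)) ^ k := (Real.rpow_inv_natCast_pow hP hk.ne').symm
    _ ≤ η ^ k := by
      have := Real.rpow_nonneg hP ((k : ℝ)⁻¹)
      gcongr

/-- The quadratic form of this matrix at `x` is `⟪v, A v⟫` with `v = ∑ i, x i • f i`. -/
theorem _root_.ContinuousLinearMap.IsPositive.posSemidef_inner {H ι : Type*} [NormedAddCommGroup H]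
    [InnerProductSpace ℂ H] [CompleteSpace H] [Fintype ι] {A : H →L[ℂ] H} (hA : A.IsPositive)
    (f : ι → H) : (Matrix.of fun i j => ⟪f i, A (f j)⟫_ℂ).PosSemidef := by
  have hs : ∀ x y, ⟪A x, y⟫_ℂ = ⟪x, A y⟫_ℂ := hA.isSymmetric
  refine Matrix.PosSemidef.of_dotProduct_mulVec_nonneg ?_ fun x => ?_
  · ext i j
    rw [Matrix.conjTranspose_apply, Matrix.of_apply, Matrix.of_apply, ← hs]
    exact inner_conj_symm _ _
  · have e : star x ⬝ᵥ ((Matrix.of fun i j => ⟪f i, A (f j)⟫_ℂ).mulVec x)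
        = ⟪∑ i, x i • f i, A (∑ i, x i • f i)⟫_ℂ := by
      rw [map_sum, sum_inner, dotProduct]
      refine Finset.sum_congr rfl fun i _ => ?_
      rw [inner_smul_left, inner_sum, Matrix.mulVec, dotProduct]
      congr 1
      refine Finset.sum_congr rfl fun j _ => ?_
      rw [map_smul, inner_smul_right, Matrix.of_apply, mul_comm]
    rw [e]
    exact hA.inner_nonneg_right _

end Determinant

/-- The test counting the particles in `2 k` orthonormal modes. -/
theorem exists_counting_test {I : Type*} [LinearOrder I] {k : ℕ} {f : Fin (2 * k) → Ell2 I}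
    (hf : Orthonormal ℂ f) :
    ∃ T ∈ StarAlgebra.adjoin ℂ (Set.range fun i => modeNumber (f i)), IsStarProjection T ∧
      ∀ {Q : Ell2 I →L[ℂ] Ell2 I} {ω : FockOp I →ₗ[ℂ] ℂ}, IsSymbol Q → IsPreQuasiFree Q ω →
        ∀ η : ℝ, 0 ≤ η →
        ((∀ i, (⟪f i, Q (f i)⟫_ℂ).re ≤ η) → (ω (1 - T)).re ≤ (4 * η) ^ k) ∧
        ((∀ i, (⟪f i, (1 - Q) (f i)⟫_ℂ).re ≤ η) → (ω T).re ≤ (4 * η) ^ k) := by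
  have hn : ∀ i, ⟪f i, f i⟫_ℂ = 1 := fun i => by
    rw [inner_self_eq_norm_sq_to_K, hf.1]
    simp
  obtain ⟨T, hTm, hT, h⟩ := exists_majority_test (p := fun i => modeNumber (f i))
    (fun i => isStarProjection_modeNumber (hn i)) (fun i j => by
      by_cases hij : i = j
      · rw [hij]
        exact Commute.refl _
      · exact commute_modeNumber (hf.2 hij))
  refine ⟨T, hTm, hT, fun {Q ω} hQ hω η hη => ?_⟩
  have h2 := h ω hω.pos (η ^ k) (by positivity)
  -- The factor `4 ^ k` is the number of occupation patterns of `2k` modes; `η ^ k` bounds each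
  -- determinant.
  have e : (4 * η) ^ k = 2 ^ (2 * k) * η ^ k := by rw [mul_pow, pow_mul]; norm_num
  rw [e]
  refine ⟨fun hd => h2.1 fun g => ?_, fun hd => h2.2 fun g => ?_⟩
  · rw [prod_modeNumber (f := fun i => f (g i)) (hf.comp g g.injective), hω.apply_eq]
    exact (hQ.1.posSemidef_inner fun i => f (g i)).re_det_le_pow fun i => hd (g i)
  · rw [prod_one_sub_modeNumber (f := fun i => f (g i)) (hf.comp g g.injective),
      hω.apply_antinormal]
    exact (hQ.2.posSemidef_inner fun i => f (g i)).re_det_le_pow fun i => hd (g i)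

/-! ### Expected occupation numbers as integrals over the circle -/

section Fourier

/-- The circle `ℝ / 2πℤ`. -/
local notation "𝕋" => AddCircle (2 * Real.pi)

/-- The normalized Haar measure of the circle. -/
local notation "haar" => AddCircle.haarAddCircle (T := 2 * Real.pi)

/-- The representative in `[0, 2π)` of a point of the circle. -/
def circleRep (t : 𝕋) : ℝ := AddCircle.equivIco (2 * Real.pi) 0 t

theorem circleRep_mem (t : 𝕋) : circleRep t ∈ Set.Ico (0 : ℝ) (2 * Real.pi) := by
  have h := (AddCircle.equivIco (2 * Real.pi) 0 t).2
  exact ⟨h.1, h.2.trans_eq (zero_add _)⟩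

theorem symbolOnCircle_eq (q : Set.Ico (0 : ℝ) (2 * Real.pi) → Set.Icc (0 : ℝ) 1) (t : 𝕋) :
    symbolOnCircle q t = q ⟨circleRep t, circleRep_mem t⟩ := rfl

theorem symbolOnCircle_mem (q : Set.Ico (0 : ℝ) (2 * Real.pi) → Set.Icc (0 : ℝ) 1) (t : 𝕋) :
    symbolOnCircle q t ∈ Set.Icc (0 : ℝ) 1 := (q _).2

theorem coe_circleRep (t : 𝕋) : ((circleRep t : ℝ) : 𝕋) = t :=
  AddCircle.coe_equivIco

theorem circleRep_coe {x : ℝ} (hx : x ∈ Set.Ico (0 : ℝ) (2 * Real.pi)) :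
    circleRep (x : 𝕋) = x := by
  have h := AddCircle.equivIco_coe_eq (p := 2 * Real.pi) (a := 0) (x := x) (by simpa using hx)
  rw [circleRep, h]

theorem ae_of_ae_symbolOnCircle {q : Set.Ico (0 : ℝ) (2 * Real.pi) → Set.Icc (0 : ℝ) 1} {c : ℝ}
    (h : ∀ᵐ t ∂haar, symbolOnCircle q t = c) :
    ∀ᵐ x : ℝ, ∀ hx : x ∈ Set.Ico (0 : ℝ) (2 * Real.pi), (q ⟨x, hx⟩ : ℝ) = c := by
  have h1 : ∀ᵐ t : 𝕋, symbolOnCircle q t = c := by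
    rw [AddCircle.volume_eq_smul_haarAddCircle]
    exact Measure.ae_smul_measure h _
  have h2 := (AddCircle.measurePreserving_mk (2 * Real.pi) 0).quasiMeasurePreserving.ae h1
  rw [ae_restrict_iff' measurableSet_Ioc] at h2
  -- The quotient map is measure preserving from `(0, 2π]`, whereas the symbol lives on `[0, 2π)`;
  -- leaving out `0` reconciles the two.
  have h3 : ∀ᵐ x : ℝ, x ≠ 0 := Measure.ae_ne volume 0
  filter_upwards [h2, h3] with x hx hx0 hxm
  have h4 := hx ⟨lt_of_le_of_ne hxm.1 (Ne.symm hx0), by simpa using hxm.2.le⟩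
  rw [symbolOnCircle_eq] at h4
  simpa only [circleRep_coe hxm] using h4

/-- The interval has positive length. This makes `q` not almost everywhere `1` and `r` not almost
everywhere `0`, without further assumptions. -/
theorem not_ae_of_eq_on_interval {q : Set.Ico (0 : ℝ) (2 * Real.pi) → Set.Icc (0 : ℝ) 1}
    {α ω c c' : ℝ} (hα : 0 ≤ α) (hαω : α < ω) (hω : ω < 2 * Real.pi) (hc : c ≠ c')
    (hq : ∀ x : Set.Ico (0 : ℝ) (2 * Real.pi), (x : ℝ) ∈ Set.Icc α ω → (q x : ℝ) = c) :
    ¬ ∀ᵐ x : ℝ, ∀ hx : x ∈ Set.Ico (0 : ℝ) (2 * Real.pi), (q ⟨x, hx⟩ : ℝ) = c' := by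
  intro h
  have h1 : volume (Set.Icc α ω) = 0 := by
    refine measure_mono_null (fun x hx => ?_) (ae_iff.1 h)
    have hm : x ∈ Set.Ico (0 : ℝ) (2 * Real.pi) := ⟨hα.trans hx.1, hx.2.trans_lt hω⟩
    intro h'
    exact hc ((hq ⟨x, hm⟩ hx).symm.trans (h' hm))
  rw [Real.volume_Icc, ENNReal.ofReal_eq_zero] at h1
  linarith

theorem inner_translationInvariantSymbol {q : Set.Ico (0 : ℝ) (2 * Real.pi) → Set.Icc (0 : ℝ) 1}
    (hq : Measurable q) (x : Ell2 ℤ) :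
    ⟪x, translationInvariantSymbol q hq x⟫_ℂ
      = ((∫ t, symbolOnCircle q t * ‖fourierTransformation x t‖ ^ 2 ∂haar : ℝ) : ℂ) := by
  set g := fourierTransformation x with hg
  have e1 : ⟪x, translationInvariantSymbol q hq x⟫_ℂ = ⟪g, multiplicationOp q hq g⟫_ℂ := by
    have e0 : translationInvariantSymbol q hq x
        = fourierTransformation.symm (multiplicationOp q hq g) := rfl
    rw [e0, ← LinearIsometryEquiv.inner_map_map fourierTransformation,
      LinearIsometryEquiv.apply_symm_apply]
  have hM : multiplicationOp q hq g =ᵐ[haar] fun t => (symbolOnCircle q t : ℂ) * g t := by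
    have h1 := ContinuousLinearMap.coeFn_holder (r := 2) (ContinuousLinearMap.mul ℂ ℂ)
      ((memLp_symbolOnCircle hq).toLp _) g
    filter_upwards [h1, (memLp_symbolOnCircle hq).coeFn_toLp] with t ht ht2
    change ((ContinuousLinearMap.mul ℂ ℂ).holder 2 ((memLp_symbolOnCircle hq).toLp _) g) t = _
    rw [ht, ht2]
    rfl
  rw [e1, L2.inner_def, ← integral_complex_ofReal]
  refine integral_congr_ae ?_
  filter_upwards [hM] with t ht
  change ⟪g t, multiplicationOp q hq g t⟫_ℂ = _
  rw [ht]
  change ⟪g t, (symbolOnCircle q t : ℂ) • g t⟫_ℂ = ((symbolOnCircle q t * ‖g t‖ ^ 2 : ℝ) : ℂ)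
  rw [inner_smul_right, inner_self_eq_norm_sq_to_K]
  push_cast
  rfl

theorem norm_sq_eq_integral (x : Ell2 ℤ) :
    ∫ t, ‖fourierTransformation x t‖ ^ 2 ∂haar = ‖x‖ ^ 2 := by
  set g := fourierTransformation x with hg
  have h2 : ⟪g, g⟫_ℂ = (((∫ t, ‖g t‖ ^ 2 ∂haar) : ℝ) : ℂ) := by
    rw [L2.inner_def, ← integral_complex_ofReal]
    refine integral_congr_ae (Filter.Eventually.of_forall fun t => ?_)
    change ⟪g t, g t⟫_ℂ = ((‖g t‖ ^ 2 : ℝ) : ℂ)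
    rw [inner_self_eq_norm_sq_to_K]
    norm_cast
  have h3 : ‖g‖ = ‖x‖ := LinearIsometryEquiv.norm_map _ _
  rw [inner_self_eq_norm_sq_to_K, h3] at h2
  apply Complex.ofReal_injective
  rw [← h2]
  push_cast
  rfl

/-- The element of `H_n` with coefficients `a`. -/
def siteVec (n : ℕ) (a : ℕ → ℂ) : Ell2 ℤ := ∑ k ∈ Finset.range n, a k • basisVec (k : ℤ)

theorem siteVec_mem (n : ℕ) (a : ℕ → ℂ) : siteVec n a ∈ siteSpace n := by
  refine Submodule.sum_mem _ fun k hk => Submodule.smul_mem _ _ (Submodule.subset_span ?_)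
  exact ⟨⟨k, Finset.mem_range.1 hk⟩, rfl⟩

/-- The trigonometric polynomial with coefficients `a`. -/
def trigPoly (n : ℕ) (a : ℕ → ℂ) (t : 𝕋) : ℂ :=
  ∑ k ∈ Finset.range n, a k * (fourier 1 t : ℂ) ^ k

theorem continuous_trigPoly (n : ℕ) (a : ℕ → ℂ) : Continuous (trigPoly n a) := by
  unfold trigPoly
  fun_prop

theorem fourier_natCast (k : ℕ) (t : 𝕋) : (fourier (k : ℤ) t : ℂ) = fourier 1 t ^ k := by
  induction k with
  | zero => simp
  | succ k ih => rw [Nat.cast_succ, fourier_add, ih, pow_succ]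

theorem fourierTransformation_basisVec (k : ℤ) :
    fourierTransformation (basisVec k) = fourierLp 2 k := by
  rw [fourierTransformation, basisVec, HilbertBasis.repr_symm_single, coe_fourierBasis]

theorem fourierTransformation_siteVec (n : ℕ) (a : ℕ → ℂ) :
    fourierTransformation (siteVec n a) =ᵐ[haar] trigPoly n a := by
  unfold siteVec trigPoly
  induction n with
  | zero =>
    simp only [Finset.range_zero, Finset.sum_empty, map_zero]
    exact Lp.coeFn_zero _ _ _
  | succ n ih =>
    rw [Finset.sum_range_succ, map_add, map_smul, fourierTransformation_basisVec]
    filter_upwards [ih, Lp.coeFn_add (fourierTransformation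
      (∑ k ∈ Finset.range n, a k • basisVec (k : ℤ))) (a n • fourierLp 2 (n : ℤ)),
      Lp.coeFn_smul (a n) (fourierLp (T := 2 * Real.pi) 2 (n : ℤ)),
      coeFn_fourierLp (T := 2 * Real.pi) 2 (n : ℤ)] with t h1 h2 h3 h4
    rw [h2, Pi.add_apply, h1, h3, Pi.smul_apply, h4, Finset.sum_range_succ, fourier_natCast,
      smul_eq_mul]

theorem integrable_norm_trigPoly_sq (n : ℕ) (a : ℕ → ℂ) :
    Integrable (fun t => ‖trigPoly n a t‖ ^ 2) haar :=
  ((continuous_trigPoly n a).norm.pow 2).integrable_of_hasCompactSupport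
    (HasCompactSupport.of_compactSpace _)

theorem inner_siteVec {q : Set.Ico (0 : ℝ) (2 * Real.pi) → Set.Icc (0 : ℝ) 1}
    (hq : Measurable q) (n : ℕ) (a : ℕ → ℂ) :
    ⟪siteVec n a, translationInvariantSymbol q hq (siteVec n a)⟫_ℂ
      = ((∫ t, symbolOnCircle q t * ‖trigPoly n a t‖ ^ 2 ∂haar : ℝ) : ℂ) := by
  rw [inner_translationInvariantSymbol]
  congr 1
  refine integral_congr_ae ?_
  filter_upwards [fourierTransformation_siteVec n a] with t ht
  rw [ht]

theorem integrable_symbol_mul {q : Set.Ico (0 : ℝ) (2 * Real.pi) → Set.Icc (0 : ℝ) 1}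
    (hq : Measurable q) (n : ℕ) (a : ℕ → ℂ) :
    Integrable (fun t => symbolOnCircle q t * ‖trigPoly n a t‖ ^ 2) haar := by
  refine (integrable_norm_trigPoly_sq n a).bdd_mul (c := 1)
    (measurable_symbolOnCircle hq).aestronglyMeasurable (Filter.Eventually.of_forall fun t => ?_)
  rw [Real.norm_of_nonneg (symbolOnCircle_mem q t).1]
  exact (symbolOnCircle_mem q t).2

theorem inner_one_sub_siteVec {q : Set.Ico (0 : ℝ) (2 * Real.pi) → Set.Icc (0 : ℝ) 1}
    (hq : Measurable q) (n : ℕ) (a : ℕ → ℂ) :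
    ⟪siteVec n a, (1 - translationInvariantSymbol q hq) (siteVec n a)⟫_ℂ
      = ((∫ t, (1 - symbolOnCircle q t) * ‖trigPoly n a t‖ ^ 2 ∂haar : ℝ) : ℂ) := by
  have e : (1 - translationInvariantSymbol q hq) (siteVec n a)
      = siteVec n a - translationInvariantSymbol q hq (siteVec n a) := rfl
  have e2 : ∫ t, ‖trigPoly n a t‖ ^ 2 ∂haar = ‖siteVec n a‖ ^ 2 := by
    rw [← norm_sq_eq_integral]
    refine integral_congr_ae ?_
    filter_upwards [fourierTransformation_siteVec n a] with t ht
    rw [ht]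
  simp only [sub_mul, one_mul]
  rw [e, inner_sub_right, inner_siteVec, integral_sub (integrable_norm_trigPoly_sq n a)
    (integrable_symbol_mul hq n a), e2, inner_self_eq_norm_sq_to_K]
  push_cast
  rfl

/-- It is a nonzero polynomial evaluated at `exp(it)`, an injective function of the point of the
circle, so its zero set is finite; Haar measure has no atoms. -/
theorem trigPoly_ae_ne_zero {n : ℕ} {a : ℕ → ℂ} (ha : ∃ k < n, a k ≠ 0) :
    ∀ᵐ t ∂haar, trigPoly n a t ≠ 0 := by
  classical
  let P : Polynomial ℂ := ∑ k ∈ Finset.range n, Polynomial.C (a k) * Polynomial.X ^ k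
  have hP : P ≠ 0 := by
    obtain ⟨k, hk, hak⟩ := ha
    intro h
    have h1 : P.coeff k = a k := by
      simp only [P, Polynomial.finsetSum_coeff, Polynomial.coeff_C_mul_X_pow]
      simp [hk]
    exact hak (by rw [← h1, h, Polynomial.coeff_zero])
  have hev : ∀ t, trigPoly n a t = P.eval (fourier 1 t) := by
    intro t
    simp [P, trigPoly, Polynomial.eval_finsetSum]
  have hinj : Function.Injective (fun t : 𝕋 => (fourier 1 t : ℂ)) := by
    intro s t h
    simp only [fourier_one] at h
    exact AddCircle.injective_toCircle (by positivity) (Subtype.ext h)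
  have hfin : {t : 𝕋 | trigPoly n a t = 0}.Finite := by
    refine Set.Finite.subset ((P.roots.toFinset.finite_toSet).preimage hinj.injOn) fun t ht => ?_
    have : P.eval (fourier 1 t) = 0 := by rw [← hev]; exact ht
    exact Multiset.mem_toFinset.2 ((Polynomial.mem_roots hP).2 this)
  have hna : NullSingletonClass haar := by
    refine ⟨fun t => ?_⟩
    -- A point is the closed ball of radius `0`.
    have h1 : (volume : Measure 𝕋) {t} = 0 := by
      have := AddCircle.volume_closedBall (T := 2 * Real.pi) (x := t) 0
      simpa using this
    rw [AddCircle.volume_eq_smul_haarAddCircle, Measure.smul_apply, smul_eq_mul] at h1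
    exact (mul_eq_zero.1 h1).resolve_left (by simp [Real.pi_pos])
  rw [ae_iff]
  simpa using hfin.measure_zero haar

/-- Stated for a general weight so that it covers both `q` and `1 - q`. A vanishing integral would
force the weight to vanish almost everywhere, as the polynomial does not. -/
theorem integral_mul_trigPoly_pos {s : 𝕋 → ℝ} (hs0 : ∀ t, 0 ≤ s t) {n : ℕ} {a : ℕ → ℂ}
    (hint : Integrable (fun t => s t * ‖trigPoly n a t‖ ^ 2) haar)
    (hs : ¬ ∀ᵐ t ∂haar, s t = 0) (ha : ∃ k < n, a k ≠ 0) :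
    0 < ∫ t, s t * ‖trigPoly n a t‖ ^ 2 ∂haar := by
  have h0 : ∀ t, 0 ≤ s t * ‖trigPoly n a t‖ ^ 2 := fun t => mul_nonneg (hs0 t) (sq_nonneg _)
  refine lt_of_le_of_ne (integral_nonneg h0) fun h => hs ?_
  have h1 := (integral_eq_zero_iff_of_nonneg h0 hint).1 h.symm
  filter_upwards [h1, trigPoly_ae_ne_zero ha] with t h2 h3
  have h4 : s t * ‖trigPoly n a t‖ ^ 2 = 0 := h2
  exact (mul_eq_zero.1 h4).resolve_right (by positivity)

theorem inner_siteVec_pos {q : Set.Ico (0 : ℝ) (2 * Real.pi) → Set.Icc (0 : ℝ) 1}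
    (hq : Measurable q)
    (hq0 : ¬ ∀ᵐ x : ℝ, ∀ hx : x ∈ Set.Ico (0 : ℝ) (2 * Real.pi), (q ⟨x, hx⟩ : ℝ) = 0)
    {n : ℕ} {a : ℕ → ℂ} (ha : ∃ k < n, a k ≠ 0) :
    0 < (⟪siteVec n a, translationInvariantSymbol q hq (siteVec n a)⟫_ℂ).re := by
  rw [inner_siteVec, Complex.ofReal_re]
  exact integral_mul_trigPoly_pos (fun t => (symbolOnCircle_mem q t).1)
    (integrable_symbol_mul hq n a) (fun h => hq0 (ae_of_ae_symbolOnCircle h)) ha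

theorem inner_one_sub_siteVec_pos {q : Set.Ico (0 : ℝ) (2 * Real.pi) → Set.Icc (0 : ℝ) 1}
    (hq : Measurable q)
    (hq1 : ¬ ∀ᵐ x : ℝ, ∀ hx : x ∈ Set.Ico (0 : ℝ) (2 * Real.pi), (q ⟨x, hx⟩ : ℝ) = 1)
    {n : ℕ} {a : ℕ → ℂ} (ha : ∃ k < n, a k ≠ 0) :
    0 < (⟪siteVec n a, (1 - translationInvariantSymbol q hq) (siteVec n a)⟫_ℂ).re := by
  rw [inner_one_sub_siteVec, Complex.ofReal_re]
  refine integral_mul_trigPoly_pos (fun t => sub_nonneg.2 (symbolOnCircle_mem q t).2) ?_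
    (fun h => hq1 (ae_of_ae_symbolOnCircle ?_)) ha
  · simp only [sub_mul, one_mul]
    exact (integrable_norm_trigPoly_sq n a).sub (integrable_symbol_mul hq n a)
  · filter_upwards [h] with t ht
    linarith

/-! ### Plane waves concentrated in the frequency window -/

/-- Coefficients of the plane wave of frequency `θ`, normalized on `n` sites. -/
def waveCoeff (n : ℕ) (θ : ℝ) (k : ℕ) : ℂ :=
  ((√n)⁻¹ : ℝ) * Complex.exp (-(θ * Complex.I)) ^ k

theorem fourier_one_eq_exp (t : 𝕋) : (fourier 1 t : ℂ) = Complex.exp (circleRep t * Complex.I) := by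
  conv_lhs => rw [← coe_circleRep t]
  rw [fourier_coe_apply]
  congr 1
  have : (Real.pi : ℂ) ≠ 0 := by exact_mod_cast Real.pi_ne_zero
  push_cast
  field_simp

theorem trigPoly_waveCoeff (n : ℕ) (θ : ℝ) (t : 𝕋) :
    trigPoly n (waveCoeff n θ) t = ((√n)⁻¹ : ℝ) *
      ∑ k ∈ Finset.range n, Complex.exp (((circleRep t - θ : ℝ) : ℂ) * Complex.I) ^ k := by
  rw [trigPoly, Finset.mul_sum]
  refine Finset.sum_congr rfl fun k _ => ?_
  rw [waveCoeff, mul_assoc, ← mul_pow, fourier_one_eq_exp, ← Complex.exp_add]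
  congr 3
  push_cast
  ring

theorem norm_exp_sub_one_sq (x : ℝ) :
    ‖Complex.exp ((x : ℂ) * Complex.I) - 1‖ ^ 2 = 2 - 2 * Real.cos x := by
  rw [← Complex.normSq_eq_norm_sq, Complex.normSq_apply]
  simp only [Complex.sub_re, Complex.sub_im, Complex.exp_ofReal_mul_I_re,
    Complex.exp_ofReal_mul_I_im, Complex.one_re, Complex.one_im]
  nlinarith [Real.sin_sq_add_cos_sq x]

/-- The sum is `(z ^ n - 1) / (z - 1)` with `‖z ^ n - 1‖ ≤ 2` and `‖z - 1‖ ^ 2 = 2 - 2 cos x`. The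
bound does not depend on `n`. -/
theorem norm_geom_sum_exp_sq_le (n : ℕ) {x d : ℝ} (hd : 0 < d) (hx : d ≤ 2 - 2 * Real.cos x) :
    ‖∑ k ∈ Finset.range n, Complex.exp ((x : ℂ) * Complex.I) ^ k‖ ^ 2 ≤ 4 / d := by
  set z := Complex.exp ((x : ℂ) * Complex.I) with hz
  have h1 : ‖z - 1‖ ^ 2 = 2 - 2 * Real.cos x := norm_exp_sub_one_sq x
  have h2 : (∑ k ∈ Finset.range n, z ^ k) * (z - 1) = z ^ n - 1 := geom_sum_mul z n
  have h3 : ‖z ^ n - 1‖ ≤ 2 := by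
    refine (norm_sub_le _ _).trans ?_
    rw [norm_pow, hz, Complex.norm_exp_ofReal_mul_I]
    norm_num
  have h4 : ‖∑ k ∈ Finset.range n, z ^ k‖ ^ 2 * ‖z - 1‖ ^ 2 ≤ 4 := by
    rw [← mul_pow, ← norm_mul, h2]
    nlinarith [norm_nonneg (z ^ n - 1)]
  rw [le_div_iff₀ hd]
  refine le_trans ?_ h4
  rw [h1]
  gcongr

/-- A point outside the window is at distance at least `δ` from `θ` around the circle in both
directions: `|x - θ|` lies between `δ` and `2π - δ`, the upper bound because the window sits inside
`[0, 2π]`. -/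
theorem cos_sub_le {α ω δ θ x : ℝ} (hα : 0 ≤ α) (hω : ω ≤ 2 * Real.pi) (hδ : 0 < δ)
    (hθ : θ ∈ Set.Icc (α + δ) (ω - δ)) (hx : x ∈ Set.Ico (0 : ℝ) (2 * Real.pi))
    (hx' : x ∉ Set.Icc α ω) : Real.cos (x - θ) ≤ Real.cos δ := by
  obtain ⟨h1, h2⟩ := hθ
  obtain ⟨h3, h4⟩ := hx
  have key : ∀ y : ℝ, δ ≤ y → y ≤ 2 * Real.pi - δ → Real.cos y ≤ Real.cos δ := by
    intro y hy hy'
    rcases le_total y Real.pi with h | h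
    · exact Real.cos_le_cos_of_nonneg_of_le_pi hδ.le h hy
    · rw [← Real.cos_two_pi_sub y]
      exact Real.cos_le_cos_of_nonneg_of_le_pi hδ.le (by linarith) (by linarith)
  rcases lt_or_ge x α with h | h
  · rw [← Real.cos_neg]
    exact key _ (by linarith) (by linarith)
  · have : ω < x := by
      by_contra h'
      exact hx' ⟨h, not_lt.1 h'⟩
    exact key _ (by linarith) (by linarith)

/-- The integrand vanishes on the window; outside it the geometric sum is bounded uniformly in `n`,
and the normalization of the wave contributes `1/n`. The weight `s` stands for `q` or for `1 - r`.
-/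
theorem integral_wave_le {s : 𝕋 → ℝ} (hs : ∀ t, s t ∈ Set.Icc (0 : ℝ) 1) {α ω δ θ : ℝ}
    (hs0 : ∀ t, circleRep t ∈ Set.Icc α ω → s t = 0) (hα : 0 ≤ α) (hω : ω ≤ 2 * Real.pi)
    (hδ : 0 < δ) (hδπ : δ ≤ Real.pi) (hθ : θ ∈ Set.Icc (α + δ) (ω - δ)) {n : ℕ} (hn : 0 < n) :
    ∫ t, s t * ‖trigPoly n (waveCoeff n θ) t‖ ^ 2 ∂haar ≤ 2 / (1 - Real.cos δ) / n := by
  have hn' : (0 : ℝ) < n := by exact_mod_cast hn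
  have hd : 0 < 2 - 2 * Real.cos δ := by
    have := Real.cos_lt_cos_of_nonneg_of_le_pi le_rfl hδπ hδ
    rw [Real.cos_zero] at this
    linarith
  have hd2 : 2 / (1 - Real.cos δ) = 4 / (2 - 2 * Real.cos δ) := by
    rw [show 2 - 2 * Real.cos δ = 2 * (1 - Real.cos δ) by ring]
    have : 1 - Real.cos δ ≠ 0 := by linarith
    field_simp
    norm_num
  rw [hd2]
  have hpt : ∀ t, s t * ‖trigPoly n (waveCoeff n θ) t‖ ^ 2 ≤ 4 / (2 - 2 * Real.cos δ) / n := by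
    intro t
    by_cases ht : circleRep t ∈ Set.Icc α ω
    · rw [hs0 t ht, zero_mul]
      positivity
    · have h1 := norm_geom_sum_exp_sq_le n (x := circleRep t - θ) hd (by
        linarith [cos_sub_le hα hω hδ hθ (circleRep_mem t) ht])
      refine (mul_le_of_le_one_left (sq_nonneg _) (hs t).2).trans ?_
      rw [trigPoly_waveCoeff, norm_mul, mul_pow, Complex.norm_real, Real.norm_of_nonneg (by positivity),
        inv_pow, Real.sq_sqrt hn'.le, div_eq_inv_mul _ (n : ℝ)]
      gcongr
  calc ∫ t, s t * ‖trigPoly n (waveCoeff n θ) t‖ ^ 2 ∂haar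
      ≤ ∫ _, 4 / (2 - 2 * Real.cos δ) / n ∂haar :=
        integral_mono_of_nonneg
          (Filter.Eventually.of_forall fun t => mul_nonneg (hs t).1 (sq_nonneg _))
          (integrable_const _) (Filter.Eventually.of_forall hpt)
    _ = _ := by simp

theorem inner_siteVec_siteVec (n : ℕ) (a b : ℕ → ℂ) :
    ⟪siteVec n a, siteVec n b⟫_ℂ = ∑ k ∈ Finset.range n, star (a k) * b k := by
  rw [siteVec, siteVec, sum_inner]
  refine Finset.sum_congr rfl fun k hk => ?_
  rw [inner_sum, Finset.sum_eq_single k]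
  · rw [inner_smul_left, inner_smul_right, inner_basisVec, coord_basisVec, if_pos rfl, mul_one]
    rfl
  · intro l _ hl
    rw [inner_smul_left, inner_smul_right, inner_basisVec, coord_basisVec, if_neg, mul_zero, mul_zero]
    exact fun h => hl (by exact_mod_cast h.symm)
  · exact fun h => absurd hk h

/-- These are at most `n` consecutive vectors of the discrete Fourier basis. Two distinct ones have
as inner product the geometric sum of a nontrivial `n`-th root of unity, which is zero. -/
theorem orthonormal_wave {n : ℕ} (hn : 0 < n) {m : ℕ} (hm : m ≤ n) (j₀ : ℕ) :
    Orthonormal ℂ fun j : Fin m =>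
      siteVec n (waveCoeff n (2 * Real.pi * ((j₀ + j : ℕ) : ℝ) / n)) := by
  have hn' : (0 : ℝ) < n := by exact_mod_cast hn
  have hnc : (n : ℂ) ≠ 0 := by exact_mod_cast hn.ne'
  have key : ∀ i j : Fin m,
      ⟪siteVec n (waveCoeff n (2 * Real.pi * ((j₀ + i : ℕ) : ℝ) / n)),
        siteVec n (waveCoeff n (2 * Real.pi * ((j₀ + j : ℕ) : ℝ) / n))⟫_ℂ
        = (n : ℂ)⁻¹ * ∑ k ∈ Finset.range n,
            Complex.exp (2 * Real.pi * Complex.I * (((i : ℤ) - (j : ℤ) : ℤ) / n)) ^ k := by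
    intro i j
    rw [inner_siteVec_siteVec, Finset.mul_sum]
    refine Finset.sum_congr rfl fun k _ => ?_
    rw [waveCoeff, waveCoeff, star_mul', star_pow, mul_mul_mul_comm, ← mul_pow]
    congr 1
    · rw [Complex.star_def, Complex.conj_ofReal, ← Complex.ofReal_mul, ← mul_inv,
        Real.mul_self_sqrt hn'.le]
      push_cast
      rfl
    · rw [Complex.star_def, ← Complex.exp_conj, ← Complex.exp_add]
      congr 2
      simp only [map_neg, map_mul, Complex.conj_ofReal, Complex.conj_I]
      push_cast
      field_simp
      ring
  rw [orthonormal_iff_ite]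
  intro i j
  rw [key]
  split_ifs with h
  · subst h
    simp [hnc]
  · set w := Complex.exp (2 * Real.pi * Complex.I * (((i : ℤ) - (j : ℤ) : ℤ) / n)) with hw
    have hwn : w ^ n = 1 := by
      rw [hw, ← Complex.exp_nat_mul, Complex.exp_eq_one_iff]
      refine ⟨(i : ℤ) - (j : ℤ), ?_⟩
      field_simp
    have hw1 : w ≠ 1 := by
      intro h1
      obtain ⟨l, hl⟩ := Complex.exp_eq_one_iff.1 h1
      have hpi : (2 * Real.pi * Complex.I : ℂ) ≠ 0 := Complex.two_pi_I_ne_zero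
      rw [mul_comm (l : ℂ)] at hl
      have h2 := mul_left_cancel₀ hpi hl
      rw [div_eq_iff hnc] at h2
      have h3 : (i : ℤ) - (j : ℤ) = l * n := by exact_mod_cast h2
      have hi : ((i : ℕ) : ℤ) < n := by exact_mod_cast i.2.trans_le hm
      have hj : ((j : ℕ) : ℤ) < n := by exact_mod_cast j.2.trans_le hm
      have h4 : ((i : ℕ) : ℤ) = j := by
        -- A nonzero `l` would put the two indices at least `n` apart.
        rcases lt_trichotomy l 0 with hl0 | hl0 | hl0
        · nlinarith
        · subst hl0; linarith
        · nlinarith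
      exact h (Fin.ext (by exact_mod_cast h4))
    have h5 := geom_sum_mul w n
    rw [hwn, sub_self] at h5
    rw [(mul_eq_zero.1 h5).resolve_right (sub_ne_zero.2 hw1), mul_zero]

/-- Consecutive frequencies `2πj/n` well inside the window, a positive fraction of all `n`. The
modes depend only on the window and on `n`, so the same ones serve both symbols. -/
theorem exists_concentrated_modes {α ω : ℝ} (hα : 0 ≤ α) (hαω : α < ω) (hω : ω < 2 * Real.pi) :
    ∃ κ : ℝ, 0 < κ ∧ ∃ C : ℝ, 0 < C ∧ ∃ N : ℕ, 0 < N ∧ ∀ n ≥ N, ∃ k : ℕ, κ * n ≤ k ∧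
      ∃ f : Fin (2 * k) → Ell2 ℤ, Orthonormal ℂ f ∧ (∀ i, f i ∈ siteSpace n) ∧
        ∀ (q : Set.Ico (0 : ℝ) (2 * Real.pi) → Set.Icc (0 : ℝ) 1) (hq : Measurable q),
          ((∀ x : Set.Ico (0 : ℝ) (2 * Real.pi), (x : ℝ) ∈ Set.Icc α ω → (q x : ℝ) = 0) →
            ∀ i, (⟪f i, translationInvariantSymbol q hq (f i)⟫_ℂ).re ≤ C / n) ∧
          ((∀ x : Set.Ico (0 : ℝ) (2 * Real.pi), (x : ℝ) ∈ Set.Icc α ω → (q x : ℝ) = 1) →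
            ∀ i, (⟪f i, (1 - translationInvariantSymbol q hq) (f i)⟫_ℂ).re ≤ C / n) := by
  have hpi := Real.pi_pos
  -- A quarter of the window is given up at either end; the remaining half has length `2 δ`.
  set δ := (ω - α) / 4 with hδ
  have hδ0 : 0 < δ := by rw [hδ]; linarith
  have hδπ : δ ≤ Real.pi := by rw [hδ]; linarith
  have hcos : 0 < 1 - Real.cos δ := by
    have := Real.cos_lt_cos_of_nonneg_of_le_pi le_rfl hδπ hδ0
    rw [Real.cos_zero] at this
    linarith
  refine ⟨δ / (8 * Real.pi), by positivity, 2 / (1 - Real.cos δ), by positivity,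
    ⌈8 * Real.pi / δ⌉₊ + 1, Nat.succ_pos _, fun n hn => ?_⟩
  have hn1 : 0 < n := by omega
  have hn' : (0 : ℝ) < n := by exact_mod_cast hn1
  -- For such `n` both rounding errors are harmless: the floor in `k` still leaves `k ≥ κ n`, and
  -- the ceiling in `j₀` shifts the frequencies by at most `δ`.
  have hnδ : 8 * Real.pi ≤ n * δ := by
    have h1 : 8 * Real.pi / δ ≤ n := (Nat.le_ceil _).trans (by exact_mod_cast (by omega))
    rwa [div_le_iff₀ hδ0] at h1
  -- The `2k` frequencies, spaced by `2π/n`, cover a length of at most `δ`, half of the inner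
  -- window; the other half absorbs the rounding of the starting index.
  set k := ⌊n * δ / (4 * Real.pi)⌋₊ with hk
  have hk1 : (k : ℝ) ≤ n * δ / (4 * Real.pi) := Nat.floor_le (by positivity)
  have hk2 : n * δ / (4 * Real.pi) < k + 1 := Nat.lt_floor_add_one _
  have hk1' : 4 * Real.pi * k ≤ n * δ := by
    rw [le_div_iff₀ (by positivity)] at hk1
    linarith
  have hk2' : n * δ < 4 * Real.pi * (k + 1) := by
    rw [div_lt_iff₀ (by positivity)] at hk2
    linarith
  set j₀ := ⌈n * (α + δ) / (2 * Real.pi)⌉₊ with hj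
  have hj1 : n * (α + δ) ≤ 2 * Real.pi * j₀ := by
    have := Nat.le_ceil (n * (α + δ) / (2 * Real.pi))
    rw [div_le_iff₀ (by positivity)] at this
    linarith
  have hj2 : 2 * Real.pi * j₀ < n * (α + δ) + 2 * Real.pi := by
    have := Nat.ceil_lt_add_one (a := n * (α + δ) / (2 * Real.pi)) (by positivity)
    rw [← hj, ← sub_lt_iff_lt_add, lt_div_iff₀ (by positivity)] at this
    linarith
  have h2k : 2 * k ≤ n := by
    have : (2 * k : ℝ) ≤ n := by
      have h1 : n * δ ≤ n * Real.pi := by gcongr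
      nlinarith
    exact_mod_cast this
  refine ⟨k, ?_, fun i => siteVec n (waveCoeff n (2 * Real.pi * ((j₀ + i : ℕ) : ℝ) / n)),
    orthonormal_wave hn1 h2k j₀, fun i => siteVec_mem _ _, fun q hq => ?_⟩
  · rw [div_mul_eq_mul_div, div_le_iff₀ (by positivity)]
    linarith
  have hθ : ∀ i : Fin (2 * k),
      2 * Real.pi * ((j₀ + i : ℕ) : ℝ) / n ∈ Set.Icc (α + δ) (ω - δ) := by
    intro i
    have hi : ((i : ℕ) : ℝ) ≤ 2 * k := by exact_mod_cast i.2.le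
    have hi0 : (0 : ℝ) ≤ ((i : ℕ) : ℝ) := Nat.cast_nonneg _
    have hωδ : ω - δ = α + δ + 2 * δ := by rw [hδ]; ring
    push_cast
    constructor
    · rw [le_div_iff₀ hn']
      nlinarith
    · rw [div_le_iff₀ hn', hωδ]
      have : 2 * Real.pi * (i : ℕ) ≤ n * δ := by nlinarith
      nlinarith
  constructor
  · intro hq0 i
    rw [inner_siteVec, Complex.ofReal_re]
    exact integral_wave_le (fun t => symbolOnCircle_mem q t) (fun t ht => hq0 _ ht) hα hω.le hδ0 hδπ
      (hθ i) hn1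
  · intro hq1 i
    rw [inner_one_sub_siteVec, Complex.ofReal_re]
    refine integral_wave_le (fun t => ⟨sub_nonneg.2 (symbolOnCircle_mem q t).2,
      sub_le_self _ (symbolOnCircle_mem q t).1⟩) (fun t ht => ?_) hα hω.le hδ0 hδπ (hθ i) hn1
    rw [symbolOnCircle_eq, hq1 _ ht, sub_self]

end Fourier

/-! ### Even local tests and their error rates -/

section Tests

/-- Monotonicity of the extended logarithm also covers an error probability `0`, where the rate is
`⊤`. -/
theorem le_errorRate {ω : carAlgebra ℤ →ₗ[ℂ] ℂ} {n : ℕ} (hn : 1 ≤ n) {X : carAlgebra ℤ} {x : ℝ}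
    (h : (ω X).re ≤ Real.exp (-(n * x))) : (x : EReal) ≤ errorRate ω n X := by
  have hn' : (0 : ℝ) < n := by exact_mod_cast hn
  have h1 : ENNReal.log (ENNReal.ofReal (ω X).re) ≤ ((-(n * x) : ℝ) : EReal) := by
    refine (ENNReal.log_le_log (ENNReal.ofReal_le_ofReal h)).trans ?_
    rw [ENNReal.log_ofReal_of_pos (Real.exp_pos _), Real.log_exp]
  have h2 : (((1 : ℝ) / n : ℝ) : EReal) * ENNReal.log (ENNReal.ofReal (ω X).re)
      ≤ (((1 : ℝ) / n : ℝ) : EReal) * ((-(n * x) : ℝ) : EReal) :=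
    mul_le_mul_of_nonneg_left h1 (by exact_mod_cast (by positivity))
  rw [errorRate, EReal.le_neg]
  refine h2.trans (le_of_eq ?_)
  rw [← EReal.coe_mul, ← EReal.coe_neg]
  congr 1
  field_simp

/-- `T` is an even projection on the sites `0, …, n - 1`, and a polynomial in the field operators. -/
structure IsLocalEvenProjection (n : ℕ) (T : carAlgebra ℤ) : Prop where
  mem_local : (T : FockOp ℤ) ∈ localAlgebra n
  mem_polynomials : (T : FockOp ℤ) ∈ carPolynomials ℤ
  isStarProjection : IsStarProjection T
  isEven : IsEven T

/-- Number operators of modes in `H_n` are local polynomials and commute with parity, and both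
properties pass to the star-algebra they generate. -/
theorem exists_isLocalEvenProjection {ι : Type*} {n : ℕ} {f : ι → Ell2 ℤ}
    (hf : ∀ i, f i ∈ siteSpace n) {T : FockOp ℤ}
    (hT : T ∈ StarAlgebra.adjoin ℂ (Set.range fun i => modeNumber (f i)))
    (hTp : IsStarProjection T) :
    ∃ T' : carAlgebra ℤ, (T' : FockOp ℤ) = T ∧ IsLocalEvenProjection n T' := by
  have h1 : StarAlgebra.adjoin ℂ (Set.range fun i => modeNumber (f i))
      ≤ StarAlgebra.adjoin ℂ (annihilation '' (siteSpace n : Set (Ell2 ℤ))) := by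
    refine StarAlgebra.adjoin_le ?_
    rintro _ ⟨i, rfl⟩
    have ha : annihilation (f i) ∈
        StarAlgebra.adjoin ℂ (annihilation '' (siteSpace n : Set (Ell2 ℤ))) :=
      StarAlgebra.subset_adjoin ℂ _ ⟨f i, hf i, rfl⟩
    have hc := star_mem ha
    rw [annihilation, star_star] at hc
    exact mul_mem hc ha
  have h2 : StarAlgebra.adjoin ℂ (annihilation '' (siteSpace n : Set (Ell2 ℤ))) ≤ carPolynomials ℤ :=
    StarAlgebra.adjoin_mono (Set.image_subset_range _ _)
  have hP : Commute (parityOp ℤ) T := by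
    change T ∈ (StarAlgebra.adjoin ℂ (Set.range fun i => modeNumber (f i))).toSubalgebra at hT
    rw [StarAlgebra.adjoin_toSubalgebra] at hT
    clear hTp
    induction hT using Algebra.adjoin_induction with
    | mem X h =>
      rcases h with ⟨i, rfl⟩ | ⟨i, hi⟩
      · exact commute_parityOp_modeNumber (f i)
      · have e : X = modeNumber (f i) := by
          rw [← star_star X, ← hi]
          simp only [modeNumber, annihilation, star_mul, star_star]
        rw [e]
        exact commute_parityOp_modeNumber (f i)
    | algebraMap r => exact (Algebra.commutes r (parityOp ℤ)).symm
    | add A B _ _ hA hB => exact hA.add_right hB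
    | mul A B _ _ hA hB => exact hA.mul_right hB
  exact ⟨⟨T, carPolynomials_le (h2 (h1 hT))⟩, rfl, StarSubalgebra.le_topologicalClosure _ (h1 hT),
    h2 (h1 hT), ⟨Subtype.ext hTp.isIdempotentElem, Subtype.ext hTp.isSelfAdjoint⟩,
    isEven_of_commute hP⟩

/-- Both error probabilities of the test `T` are at most `b`. -/
def ErrorsLE (ω₀ ω₁ : carAlgebra ℤ →ₗ[ℂ] ℂ) (T : carAlgebra ℤ) (b : ℝ) : Prop :=
  (ω₀ (1 - T)).re ≤ b ∧ (ω₁ T).re ≤ b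

theorem IsPreQuasiFree.apply_modeNumber {I : Type*} [LinearOrder I] {Q : Ell2 I →L[ℂ] Ell2 I}
    {ω : FockOp I →ₗ[ℂ] ℂ} (h : IsPreQuasiFree Q ω) (f : Ell2 I) :
    ω (modeNumber f) = ⟪f, Q f⟫_ℂ := by
  have h1 := h.apply_eq (n := 1) (fun _ => f) (fun _ => f)
  simpa [creationProd, annihilationProd, modeNumber] using h1

variable {q r : Set.Ico (0 : ℝ) (2 * Real.pi) → Set.Icc (0 : ℝ) 1}

theorem exists_counting_test_errors_le (hq : Measurable q) (hr : Measurable r) {α ω : ℝ}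
    (hα : 0 ≤ α) (hαω : α < ω) (hω : ω < 2 * Real.pi)
    (hq0 : ∀ x : Set.Ico (0 : ℝ) (2 * Real.pi), (x : ℝ) ∈ Set.Icc α ω → (q x : ℝ) = 0)
    (hr1 : ∀ x : Set.Ico (0 : ℝ) (2 * Real.pi), (x : ℝ) ∈ Set.Icc α ω → (r x : ℝ) = 1) :
    ∃ c : ℝ, 0 < c ∧ ∃ N : ℕ, 0 < N ∧ ∀ n ≥ N, ∃ T : carAlgebra ℤ, IsLocalEvenProjection n T ∧
      ErrorsLE (chainState q hq) (chainState r hr) T (Real.exp (-(n * (c * Real.log n)))) := by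
  obtain ⟨κ, hκ, C, hC, N, hN, h⟩ := exists_concentrated_modes hα hαω hω
  -- Once `n ≥ (4C)²`, `4C/n ≤ n^(-1/2)`, so the error `(4C/n)^k` is at most `n^(-k/2)`. With `k ≥ κ
  -- n` this gives the rate constant `κ / 2`.
  refine ⟨κ / 2, by positivity, N + ⌈(4 * C) ^ 2⌉₊, by omega, fun n hn => ?_⟩
  obtain ⟨k, hk, f, hf, hfm, hf'⟩ := h n (by omega)
  have hn1 : 1 ≤ n := by omega
  have hn' : (0 : ℝ) < n := by exact_mod_cast hn1
  have hCn : 4 * C ≤ √n := by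
    refine Real.le_sqrt_of_sq_le ((Nat.le_ceil _).trans ?_)
    exact_mod_cast (by omega)
  obtain ⟨T, hT, hTp, hb⟩ := exists_counting_test hf
  obtain ⟨T, rfl, hT'⟩ := exists_isLocalEvenProjection hfm hT hTp
  have hbound : (4 * (C / n)) ^ k ≤ Real.exp (-(n * (κ / 2 * Real.log n))) := by
    have h1 : 4 * (C / n) ≤ Real.exp (-(Real.log n / 2)) := by
      rw [Real.exp_neg, Real.exp_half, Real.exp_log hn', ← mul_div_assoc, div_le_iff₀ hn']
      calc 4 * C ≤ √n := hCn
        _ = (√n)⁻¹ * n := by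
          rw [inv_mul_eq_div, Real.div_sqrt]
    calc (4 * (C / n)) ^ k ≤ Real.exp (-(Real.log n / 2)) ^ k := by gcongr
      _ = Real.exp (-(k * (Real.log n / 2))) := by rw [← Real.exp_nat_mul, mul_neg]
      _ ≤ _ := by
        rw [Real.exp_le_exp, neg_le_neg_iff]
        have h2 : 0 ≤ Real.log n := Real.log_natCast_nonneg n
        nlinarith
  refine ⟨T, hT', ?_, ?_⟩
  · obtain ⟨ω', hω', he⟩ := exists_isPreQuasiFree_eq_quasiFreeState
      (translationInvariantSymbol_isSymbol q hq)
    have h1 := (hb (translationInvariantSymbol_isSymbol q hq) hω' (C / n) (by positivity)).1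
      ((hf' q hq).1 hq0)
    rw [chainState, he (1 - T) (sub_mem (one_mem _) hT'.mem_polynomials)]
    exact h1.trans hbound
  · obtain ⟨ω', hω', he⟩ := exists_isPreQuasiFree_eq_quasiFreeState
      (translationInvariantSymbol_isSymbol r hr)
    have h1 := (hb (translationInvariantSymbol_isSymbol r hr) hω' (C / n) (by positivity)).2
      ((hf' r hr).2 hr1)
    rw [chainState, he T hT'.mem_polynomials]
    exact h1.trans hbound

/-- For small `n`: the test accepts `ω_Q` if site `0` is empty. Its errors are `⟪f, Q f⟫` and `1 -
⟪f, R f⟫`, both below `1` because `q` is not almost everywhere `1` and `r` not almost everywhere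
`0`. -/
theorem exists_single_site_test (hq : Measurable q) (hr : Measurable r)
    (hq1 : ¬ ∀ᵐ x : ℝ, ∀ hx : x ∈ Set.Ico (0 : ℝ) (2 * Real.pi), (q ⟨x, hx⟩ : ℝ) = 1)
    (hr0 : ¬ ∀ᵐ x : ℝ, ∀ hx : x ∈ Set.Ico (0 : ℝ) (2 * Real.pi), (r ⟨x, hx⟩ : ℝ) = 0) :
    ∃ b : ℝ, 0 < b ∧ b < 1 ∧ ∀ n ≥ 1, ∃ T : carAlgebra ℤ, IsLocalEvenProjection n T ∧
      ErrorsLE (chainState q hq) (chainState r hr) T b := by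
  set f : Ell2 ℤ := siteVec 1 (fun _ => 1) with hf
  have hff : ⟪f, f⟫_ℂ = 1 := by
    rw [hf, inner_siteVec_siteVec]
    simp
  have hfm : ∀ n ≥ 1, f ∈ siteSpace n := by
    intro n hn
    refine Submodule.span_mono ?_ (siteVec_mem 1 (fun _ => 1))
    rintro _ ⟨k, rfl⟩
    exact ⟨⟨k, k.2.trans_le hn⟩, rfl⟩
  have hQ := inner_one_sub_siteVec_pos hq hq1 (n := 1) (a := fun _ => 1) ⟨0, one_pos, one_ne_zero⟩
  have hR := inner_siteVec_pos hr hr0 (n := 1) (a := fun _ => 1) ⟨0, one_pos, one_ne_zero⟩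
  rw [← hf] at hQ hR
  have e : (1 - translationInvariantSymbol q hq) f = f - translationInvariantSymbol q hq f := rfl
  rw [e, inner_sub_right, hff, Complex.sub_re, Complex.one_re] at hQ
  -- The `1 / 2` keeps the bound positive, so that its logarithm can be taken.
  refine ⟨max (1 / 2) (max (⟪f, translationInvariantSymbol q hq f⟫_ℂ).re
    (1 - (⟪f, translationInvariantSymbol r hr f⟫_ℂ).re)), by positivity,
    max_lt (by norm_num) (max_lt (by linarith) (by linarith)), fun n hn => ?_⟩
  have hT : 1 - modeNumber f ∈ StarAlgebra.adjoin ℂ (Set.range fun _ : Unit => modeNumber f) :=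
    sub_mem (one_mem _) (StarAlgebra.subset_adjoin ℂ _ ⟨(), rfl⟩)
  obtain ⟨T, hTe, hT'⟩ := exists_isLocalEvenProjection (fun _ => hfm n hn) hT
    (isStarProjection_modeNumber hff).one_sub
  refine ⟨T, hT', ?_, ?_⟩
  · obtain ⟨ω', hω', he⟩ := exists_isPreQuasiFree_eq_quasiFreeState
      (translationInvariantSymbol_isSymbol q hq)
    have e1 : ((1 - T : carAlgebra ℤ) : FockOp ℤ) = modeNumber f := by
      change 1 - (T : FockOp ℤ) = _
      rw [hTe, sub_sub_cancel]
    rw [chainState, he (1 - T) (sub_mem (one_mem _) hT'.mem_polynomials), e1,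
      hω'.apply_modeNumber]
    exact (le_max_left _ _).trans (le_max_right _ _)
  · obtain ⟨ω', hω', he⟩ := exists_isPreQuasiFree_eq_quasiFreeState
      (translationInvariantSymbol_isSymbol r hr)
    rw [chainState, he T hT'.mem_polynomials, hTe, map_sub, hω'.one, hω'.apply_modeNumber,
      Complex.sub_re, Complex.one_re]
    exact (le_max_right _ _).trans (le_max_right _ _)

theorem exists_tests_errors_le (hq : Measurable q) (hr : Measurable r) {α ω : ℝ}
    (hα : 0 ≤ α) (hαω : α < ω) (hω : ω < 2 * Real.pi)
    (hq0 : ∀ x : Set.Ico (0 : ℝ) (2 * Real.pi), (x : ℝ) ∈ Set.Icc α ω → (q x : ℝ) = 0)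
    (hr1 : ∀ x : Set.Ico (0 : ℝ) (2 * Real.pi), (x : ℝ) ∈ Set.Icc α ω → (r x : ℝ) = 1) :
    ∃ c : ℝ, 0 < c ∧ ∀ n ≥ 1, ∃ T : carAlgebra ℤ, IsLocalEvenProjection n T ∧
      ErrorsLE (chainState q hq) (chainState r hr) T (Real.exp (-(n * (c * Real.log n)))) := by
  obtain ⟨c, hc, N, hN, hlarge⟩ := exists_counting_test_errors_le hq hr hα hαω hω hq0 hr1
  obtain ⟨b, hb0, hb1, hsmall⟩ := exists_single_site_test hq hr
    (not_ae_of_eq_on_interval hα hαω hω zero_ne_one hq0)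
    (not_ae_of_eq_on_interval hα hαω hω one_ne_zero hr1)
  have hN' : (0 : ℝ) < N := by exact_mod_cast hN
  have hL : 0 < -Real.log b := neg_pos.2 (Real.log_neg hb0 hb1)
  have hmono : ∀ (T : carAlgebra ℤ) {x y : ℝ}, x ≤ y →
      ErrorsLE (chainState q hq) (chainState r hr) T x →
      ErrorsLE (chainState q hq) (chainState r hr) T y :=
    fun T x y hxy h => ⟨h.1.trans hxy, h.2.trans hxy⟩
  -- For `n < N` one has `n log n ≤ N²`, so the second entry makes `exp(-c n log n)` at least `b`.
  refine ⟨min c (-Real.log b / N ^ 2), by positivity, fun n hn => ?_⟩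
  have hlog : 0 ≤ Real.log n := Real.log_natCast_nonneg n
  rcases le_or_gt N n with h | h
  · obtain ⟨T, hT, hE⟩ := hlarge n h
    refine ⟨T, hT, hmono T ?_ hE⟩
    rw [Real.exp_le_exp, neg_le_neg_iff]
    gcongr
    exact min_le_left _ _
  · obtain ⟨T, hT, hE⟩ := hsmall n hn
    refine ⟨T, hT, hmono T ?_ hE⟩
    rw [← Real.log_le_iff_le_exp hb0, le_neg]
    have hnN : (n : ℝ) ≤ N := by exact_mod_cast h.le
    have hn0 : (0 : ℝ) < n := by exact_mod_cast hn
    have h1 : Real.log n ≤ N := (Real.log_le_self hn0.le).trans hnN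
    calc n * (min c (-Real.log b / N ^ 2) * Real.log n)
        ≤ N * (-Real.log b / N ^ 2 * N) := by
          gcongr
          exact min_le_right _ _
      _ = -Real.log b := by field_simp

theorem exists_tests (hq : Measurable q) (hr : Measurable r) {α ω : ℝ}
    (hα : 0 ≤ α) (hαω : α < ω) (hω : ω < 2 * Real.pi)
    (hq0 : ∀ x : Set.Ico (0 : ℝ) (2 * Real.pi), (x : ℝ) ∈ Set.Icc α ω → (q x : ℝ) = 0)
    (hr1 : ∀ x : Set.Ico (0 : ℝ) (2 * Real.pi), (x : ℝ) ∈ Set.Icc α ω → (r x : ℝ) = 1) :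
    ∃ c : ℝ, 0 < c ∧ ∃ T : ℕ → carAlgebra ℤ,
      (∀ n, (T n : FockOp ℤ) ∈ localAlgebra n ∧ IsStarProjection (T n) ∧ IsEven (T n)) ∧
      ∀ n : ℕ, 1 ≤ n →
        ((c * Real.log n : ℝ) : EReal) ≤ errorRate (chainState q hq) n (1 - T n) ∧
        ((c * Real.log n : ℝ) : EReal) ≤ errorRate (chainState r hr) n (T n) := by
  obtain ⟨c, hc, h⟩ := exists_tests_errors_le hq hr hα hαω hω hq0 hr1
  choose! T hT using h
  -- At `n = 0` no rate is required, but the test must still be an even local projection; `1` will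
  -- do.
  refine ⟨c, hc, fun n => if 1 ≤ n then T n else 1, fun n => ?_, fun n hn => ?_⟩
  · by_cases hn : 1 ≤ n
    · simp only [hn, if_true]
      exact ⟨(hT n hn).1.mem_local, (hT n hn).1.isStarProjection, (hT n hn).1.isEven⟩
    · simp only [hn, if_false]
      exact ⟨one_mem _, IsStarProjection.one _, isEven_of_commute (Commute.one_right _)⟩
  · simp only [hn, if_true]
    exact ⟨le_errorRate hn (hT n hn).2.1, le_errorRate hn (hT n hn).2.2⟩

theorem isTest_of_isStarProjection {T : carAlgebra ℤ} (h : IsStarProjection T) : IsTest T := by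
  have h1 : IsStarProjection (T : FockOp ℤ) :=
    ⟨congrArg Subtype.val h.isIdempotentElem, congrArg Subtype.val h.isSelfAdjoint⟩
  exact ⟨ContinuousLinearMap.IsPositive.of_isStarProjection h1,
    ContinuousLinearMap.IsPositive.of_isStarProjection h1.one_sub⟩

theorem liminf_errorRate_eq_top {ω : carAlgebra ℤ →ₗ[ℂ] ℂ} {X : ℕ → carAlgebra ℤ} {c : ℝ}
    (hc : 0 < c) (h : ∀ n : ℕ, 1 ≤ n → ((c * Real.log n : ℝ) : EReal) ≤ errorRate ω n (X n)) :
    Filter.liminf (fun n => errorRate ω n (X n)) Filter.atTop = ⊤ := by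
  refine Tendsto.liminf_eq ?_
  have h1 : Tendsto (fun n : ℕ => c * Real.log n) atTop atTop :=
    (Real.tendsto_log_atTop.comp tendsto_natCast_atTop_atTop).const_mul_atTop hc
  refine tendsto_nhds_top_mono (EReal.tendsto_coe_atTop.comp h1) ?_
  filter_upwards [eventually_ge_atTop 1] with n hn
  exact h n hn

end Tests

/-! ### Density operators on a finite-dimensional Fock space -/

section DensityOperator

variable {I : Type*} [LinearOrder I] [Fintype I]

open InnerProductSpace (rankOne)

theorem orthonormal_basisVec {I : Type*} [LinearOrder I] :
    Orthonormal ℂ (fun S : Finset I => (basisVec S : Fock I)) := by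
  rw [orthonormal_iff_ite]
  intro S T
  rw [inner_basisVec, coord_basisVec]

theorem sum_coord_smul_basisVec (f : Fock I) : ∑ S, coord f S • (basisVec S : Fock I) = f := by
  refine ext_coord fun T => ?_
  rw [← inner_basisVec, inner_sum, Finset.sum_eq_single T]
  · rw [inner_smul_right, inner_basisVec, coord_basisVec, if_pos rfl, mul_one]
  · intro S _ hS
    rw [inner_smul_right, inner_basisVec, coord_basisVec, if_neg (Ne.symm hS), mul_zero]
  · exact fun h => absurd (Finset.mem_univ _) h

/-- The occupation number basis. -/
def occupationBasis (I : Type*) [LinearOrder I] [Fintype I] :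
    OrthonormalBasis (Finset I) ℂ (Fock I) :=
  OrthonormalBasis.mk orthonormal_basisVec (by
    intro f _
    rw [← sum_coord_smul_basisVec f]
    exact Submodule.sum_mem _ fun S _ =>
      Submodule.smul_mem _ _ (Submodule.subset_span (Set.mem_range_self S)))

theorem occupationBasis_apply (S : Finset I) : occupationBasis I S = basisVec S := by
  simp [occupationBasis]

instance : FiniteDimensional ℂ (Fock I) := (occupationBasis I).toBasis.finiteDimensional_of_finite

theorem trace_eq_sum (X : FockOp I) :
    LinearMap.trace ℂ (Fock I) (X : Fock I →ₗ[ℂ] Fock I) = ∑ S, ⟪(basisVec S : Fock I), X (basisVec S)⟫_ℂ := by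
  rw [LinearMap.trace_eq_sum_inner _ (occupationBasis I)]
  simp only [occupationBasis_apply]
  rfl

theorem trace_mul_rankOne (ρ : FockOp I) (u v : Fock I) :
    LinearMap.trace ℂ (Fock I) ((ρ * rankOne ℂ u v : FockOp I) : Fock I →ₗ[ℂ] Fock I) = ⟪v, ρ u⟫_ℂ := by
  have e : ρ * rankOne ℂ u v = rankOne ℂ (ρ u) v := InnerProductSpace.comp_rankOne u v ρ
  rw [e]
  exact InnerProductSpace.trace_rankOne _ _

theorem eq_sum_rankOne (X : FockOp I) :
    X = ∑ S, ∑ T, ⟪(basisVec S : Fock I), X (basisVec T)⟫_ℂ •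
      rankOne ℂ (basisVec S : Fock I) (basisVec T) := by
  refine ContinuousLinearMap.ext fun f => ?_
  have e1 : X f = ∑ S, ⟪(basisVec S : Fock I), X f⟫_ℂ • (basisVec S : Fock I) := by
    conv_lhs => rw [← sum_coord_smul_basisVec (X f)]
    simp only [inner_basisVec]
  rw [e1, _root_.sum_apply]
  refine Finset.sum_congr rfl fun S _ => ?_
  rw [_root_.sum_apply]
  conv_lhs => rw [← sum_coord_smul_basisVec f]
  rw [map_sum, inner_sum, Finset.sum_smul]
  refine Finset.sum_congr rfl fun T _ => ?_
  rw [map_smul, inner_smul_right]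
  change _ = ⟪(basisVec S : Fock I), X (basisVec T)⟫_ℂ • (⟪(basisVec T : Fock I), f⟫_ℂ • basisVec S)
  rw [inner_basisVec T f, smul_smul, mul_comm]

theorem modeCreation_mem {I : Type*} [LinearOrder I] (k : I) : modeCreation k ∈ carPolynomials I := by
  have h : creation (basisVec k) = modeCreation k := by
    have h1 := hasSum_single (f := fun l => coord (basisVec k) l • (modeCreation l : FockOp I)) k
      (fun l hl => by rw [coord_basisVec, if_neg hl, zero_smul])
    rw [coord_basisVec, if_pos rfl, one_smul] at h1
    exact (hasSum_creation _).unique h1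
  rw [← h]
  exact creation_mem _

/-- Create the particles one by one; the factor `jwSign` undoes the sign of each creation. -/
theorem exists_mem_apply_vacuum {I : Type*} [LinearOrder I] (S : Finset I) :
    ∃ A ∈ carPolynomials I, A (basisVec ∅) = basisVec S := by
  induction S using Finset.induction_on with
  | empty => exact ⟨1, one_mem _, rfl⟩
  | insert k S hk ih =>
    obtain ⟨A, hA, hAS⟩ := ih
    refine ⟨jwSign k S • (modeCreation k * A),
      (carPolynomials I).smul_mem (mul_mem (modeCreation_mem k) hA) _, ?_⟩
    change jwSign k S • modeCreation k (A (basisVec ∅)) = _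
    rw [hAS, modeCreation_basisVec, if_neg hk, smul_smul, jwSign_sq, one_smul]

/-- It is the product over all sites of the projections onto "site `k` is empty". The partial
product over `s` keeps the configurations disjoint from `s`. -/
theorem vacuumProjection_mem :
    rankOne ℂ (basisVec ∅ : Fock I) (basisVec ∅) ∈ carPolynomials I := by
  have key : ∀ s : Finset I, ∃ P ∈ carPolynomials I, ∀ (f : Fock I) (S : Finset I),
      coord (P f) S = if Disjoint S s then coord f S else 0 := by
    intro s
    induction s using Finset.induction_on with
    | empty => exact ⟨1, one_mem _, fun f S => by simp⟩
    | insert k s hk ih =>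
      obtain ⟨P, hP, hPf⟩ := ih
      refine ⟨star (modeCreation k) * modeCreation k * P,
        mul_mem (mul_mem (star_mem (modeCreation_mem k)) (modeCreation_mem k)) hP, fun f S => ?_⟩
      change coord (star (modeCreation k) (modeCreation k (P f))) S = _
      rw [modeAnnihilation_apply, modeCreation_apply]
      by_cases h : k ∈ S
      · simp [h]
      · rw [if_neg h, if_pos (Finset.mem_insert_self k S), Finset.erase_insert h, jwSign_insert_self,
          ← mul_assoc, jwSign_sq, one_mul, hPf]
        simp [h]
  obtain ⟨P, hP, hPf⟩ := key Finset.univ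
  convert hP using 1
  refine ContinuousLinearMap.ext fun f => ext_coord fun S => ?_
  rw [hPf, InnerProductSpace.rankOne_apply, coord_smul, inner_basisVec, coord_basisVec]
  by_cases h : S = ∅
  · simp [h]
  · have : ¬ Disjoint S Finset.univ := by
      rw [← Finset.top_eq_univ, disjoint_top]
      exact h
    simp [h, this]

/-- Every matrix unit is `A * P * star B`, where `P` is the vacuum projection and the polynomials
`A`, `B` create the two basis vectors from the vacuum. -/
theorem mem_carPolynomials (X : FockOp I) : X ∈ carPolynomials I := by
  rw [eq_sum_rankOne X]
  refine sum_mem fun S _ => sum_mem fun T _ => (carPolynomials I).smul_mem ?_ _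
  obtain ⟨A, hA, hAS⟩ := exists_mem_apply_vacuum S
  obtain ⟨B, hB, hBT⟩ := exists_mem_apply_vacuum T
  have e : rankOne ℂ (basisVec S : Fock I) (basisVec T)
      = A * rankOne ℂ (basisVec ∅ : Fock I) (basisVec ∅) * star B := by
    refine ContinuousLinearMap.ext fun f => ?_
    change ⟪(basisVec T : Fock I), f⟫_ℂ • basisVec S
      = A (⟪(basisVec ∅ : Fock I), star B f⟫_ℂ • basisVec ∅)
    rw [map_smul, hAS, ContinuousLinearMap.star_eq_adjoint,
      ContinuousLinearMap.adjoint_inner_right, hBT]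
  rw [e]
  exact mul_mem (mul_mem hA vacuumProjection_mem) (star_mem hB)

/-- The operator `ρ` with `ω(X) = tr (ρ X)`. -/
def traceDual (ω : FockOp I →ₗ[ℂ] ℂ) : FockOp I :=
  ∑ S, ∑ T, ω (rankOne ℂ (basisVec T : Fock I) (basisVec S)) •
    rankOne ℂ (basisVec S : Fock I) (basisVec T)

theorem trace_rankOne_mul (X : FockOp I) (u v : Fock I) :
    LinearMap.trace ℂ (Fock I) ((rankOne ℂ u v * X : FockOp I) : Fock I →ₗ[ℂ] Fock I) = ⟪v, X u⟫_ℂ := by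
  rw [← trace_mul_rankOne]
  exact LinearMap.trace_mul_comm ℂ _ _

theorem trace_traceDual_mul (ω : FockOp I →ₗ[ℂ] ℂ) (X : FockOp I) :
    LinearMap.trace ℂ (Fock I) ((traceDual ω * X : FockOp I) : Fock I →ₗ[ℂ] Fock I) = ω X := by
  have e : ((traceDual ω * X : FockOp I) : Fock I →ₗ[ℂ] Fock I)
      = ∑ S, ∑ T, ω (rankOne ℂ (basisVec T : Fock I) (basisVec S)) •
        ((rankOne ℂ (basisVec S : Fock I) (basisVec T) * X : FockOp I) : Fock I →ₗ[ℂ] Fock I) := by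
    rw [traceDual, Finset.sum_mul]
    simp only [Finset.sum_mul, smul_mul_assoc]
    ext f : 1
    simp
  rw [e, map_sum]
  conv_rhs => rw [eq_sum_rankOne X, Finset.sum_comm, map_sum]
  refine Finset.sum_congr rfl fun S _ => ?_
  rw [map_sum, map_sum]
  refine Finset.sum_congr rfl fun T _ => ?_
  rw [map_smul, map_smul, trace_rankOne_mul, smul_eq_mul, smul_eq_mul, mul_comm]

theorem eq_of_trace_mul_eq {ρ σ : FockOp I}
    (h : ∀ X : FockOp I, LinearMap.trace ℂ (Fock I) ((ρ * X : FockOp I) : Fock I →ₗ[ℂ] Fock I)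
      = LinearMap.trace ℂ (Fock I) ((σ * X : FockOp I) : Fock I →ₗ[ℂ] Fock I)) : ρ = σ := by
  refine ContinuousLinearMap.ext fun u => ext_inner_left ℂ fun v => ?_
  rw [← trace_mul_rankOne, ← trace_mul_rankOne, h]

/-- `⟪v, ρ v⟫` is the value of `ω` at `rankOne ℂ v v`, which has the form `star X * X` with `X`
mapping into the line of the vacuum. -/
theorem isPositive_traceDual {ω : FockOp I →ₗ[ℂ] ℂ} (hω : ∀ X, 0 ≤ ω (star X * X)) :
    (traceDual ω).IsPositive := by
  have hnn : ∀ v, 0 ≤ ⟪v, traceDual ω v⟫_ℂ := by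
    intro v
    have e : star (rankOne ℂ (basisVec ∅ : Fock I) v) * rankOne ℂ (basisVec ∅ : Fock I) v
        = rankOne ℂ v v := by
      refine ContinuousLinearMap.ext fun f => ext_inner_left ℂ fun g => ?_
      change ⟪g, star (rankOne ℂ (basisVec ∅ : Fock I) v) (rankOne ℂ (basisVec ∅ : Fock I) v f)⟫_ℂ = _
      rw [ContinuousLinearMap.star_eq_adjoint, ContinuousLinearMap.adjoint_inner_right,
        InnerProductSpace.rankOne_apply, InnerProductSpace.rankOne_apply,
        InnerProductSpace.rankOne_apply, inner_smul_left, inner_smul_right, inner_basisVec,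
        coord_basisVec, if_pos rfl, inner_smul_right, inner_conj_symm]
      ring
    rw [← trace_mul_rankOne, trace_traceDual_mul, ← e]
    exact hω _
  rw [ContinuousLinearMap.isPositive_iff_complex]
  intro v
  have h1 := hnn v
  have h2 : ⟪traceDual ω v, v⟫_ℂ = ⟪v, traceDual ω v⟫_ℂ := by
    rw [← inner_conj_symm, Complex.conj_eq_iff_im]
    exact (Complex.le_def.1 h1).2.symm
  rw [h2]
  refine ⟨?_, (Complex.le_def.1 h1).1⟩
  exact Complex.ext (by simp) (by simpa using (Complex.le_def.1 h1).2)

/-- The kernel of the density operator is invariant under an algebra that contains every operator,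
hence is trivial or the whole space; normalization rules out the whole space. -/
theorem IsPreQuasiFree.isUnit_traceDual {Q : Ell2 I →L[ℂ] Ell2 I} {ω : FockOp I →ₗ[ℂ] ℂ}
    (h : IsPreQuasiFree Q ω) (hQ : Function.Surjective Q)
    (hQ' : Function.Surjective (1 - Q : Ell2 I →L[ℂ] Ell2 I)) : IsUnit (traceDual ω) := by
  set ρ := traceDual ω with hρ
  have hpos : ρ.IsPositive := isPositive_traceDual h.pos
  have hsa : star ρ = ρ := hpos.isSelfAdjoint
  -- The KMS relation for the functional, read through the nondegenerate trace pairing and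
  -- cyclicity.
  have hkms : ∀ φ, ρ * creation ((1 - Q) φ) = creation (Q φ) * ρ := by
    intro φ
    refine eq_of_trace_mul_eq fun X => ?_
    have e1 : LinearMap.trace ℂ (Fock I) ((creation (Q φ) * ρ * X : FockOp I) : Fock I →ₗ[ℂ] Fock I)
        = LinearMap.trace ℂ (Fock I) ((ρ * (X * creation (Q φ)) : FockOp I) : Fock I →ₗ[ℂ] Fock I) := by
      rw [mul_assoc, ← mul_assoc ρ]
      exact LinearMap.trace_mul_comm ℂ _ _
    rw [e1, mul_assoc, trace_traceDual_mul, trace_traceDual_mul]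
    exact h.kms φ X
  have hker : ∀ X ∈ carPolynomials I, ∀ v, ρ v = 0 → ρ (X v) = 0 := by
    intro X hX
    change X ∈ (carPolynomials I).toSubalgebra at hX
    rw [StarAlgebra.adjoin_toSubalgebra] at hX
    -- Surjectivity of `1 - Q` lets every creation operator appear on the left of the relation; for
    -- annihilation operators the adjoint relation and surjectivity of `Q` do the same.
    have hc : ∀ ψ v, ρ v = 0 → ρ (creation ψ v) = 0 := by
      intro ψ v hv
      obtain ⟨φ, rfl⟩ := hQ' ψ
      change (ρ * creation ((1 - Q) φ)) v = 0
      rw [hkms]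
      change creation (Q φ) (ρ v) = 0
      rw [hv, map_zero]
    have ha : ∀ ψ v, ρ v = 0 → ρ (annihilation ψ v) = 0 := by
      intro ψ v hv
      obtain ⟨φ, rfl⟩ := hQ ψ
      have h1 := congrArg star (hkms φ)
      rw [star_mul, star_mul, hsa] at h1
      change (ρ * star (creation (Q φ))) v = 0
      rw [← h1]
      change star (creation ((1 - Q) φ)) (ρ v) = 0
      rw [hv, map_zero]
    induction hX using Algebra.adjoin_induction with
    | mem X hX =>
      rcases hX with ⟨φ, rfl⟩ | ⟨φ, hφ⟩
      · exact ha φ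
      · have : X = creation φ := by
          rw [← star_star X, ← hφ, annihilation, star_star]
        rw [this]
        exact hc φ
    | algebraMap r =>
      intro v hv
      rw [Algebra.algebraMap_eq_smul_one]
      change ρ (r • v) = 0
      rw [map_smul, hv, smul_zero]
    | add A B _ _ hA hB =>
      intro v hv
      change ρ (A v + B v) = 0
      rw [map_add, hA v hv, hB v hv, add_zero]
    | mul A B _ _ hA hB => intro v hv; exact hA _ (hB v hv)
  have hinj : ∀ v, ρ v = 0 → v = 0 := by
    intro v hv
    by_contra hv0
    have hzero : ρ = 0 := by
      refine ContinuousLinearMap.ext fun u => ?_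
      -- This operator sends `v` to a nonzero multiple of the arbitrary vector `u`, so a nonzero
      -- kernel vector forces `ρ = 0`.
      have h1 := hker (rankOne ℂ u v) (mem_carPolynomials _) v hv
      rw [InnerProductSpace.rankOne_apply, map_smul] at h1
      exact (smul_eq_zero.1 h1).resolve_left (inner_self_ne_zero.2 hv0)
    have h2 := trace_traceDual_mul ω 1
    rw [← hρ, hzero, zero_mul, h.one] at h2
    simp at h2
  rw [ContinuousLinearMap.isUnit_iff_bijective]
  have hinj' : Function.Injective (ρ : Fock I →ₗ[ℂ] Fock I) := by
    rw [← LinearMap.ker_eq_bot, LinearMap.ker_eq_bot']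
    exact hinj
  exact ⟨hinj', LinearMap.injective_iff_surjective.1 hinj'⟩

/-- Uniqueness holds because the CAR algebra is all of `FockOp I` here, so the trace pairing with it
determines `ρ`. -/
theorem isDensityOperator_unique_isUnit {Q : Ell2 I →L[ℂ] Ell2 I} (hQs : IsSymbol Q)
    (hQ : Function.Surjective Q)
    (hQ' : Function.Surjective (1 - Q : Ell2 I →L[ℂ] Ell2 I)) :
    (∃! ρ, IsDensityOperator (quasiFreeState Q hQs) ρ) ∧
      ∀ ρ, IsDensityOperator (quasiFreeState Q hQs) ρ → IsUnit ρ := by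
  obtain ⟨ω, hω, he⟩ := exists_isPreQuasiFree_eq_quasiFreeState hQs
  have hd : IsDensityOperator (quasiFreeState Q hQs) (traceDual ω) := by
    refine ⟨isPositive_traceDual hω.pos, ?_, fun X => ?_⟩
    · have := trace_traceDual_mul ω 1
      rwa [mul_one, hω.one] at this
    · rw [trace_traceDual_mul, he X (mem_carPolynomials _)]
  have huniq : ∀ ρ, IsDensityOperator (quasiFreeState Q hQs) ρ → ρ = traceDual ω := by
    intro ρ hρ
    refine eq_of_trace_mul_eq fun X => ?_
    have hX : X ∈ carAlgebra I := carPolynomials_le (mem_carPolynomials X)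
    exact (hρ.apply_eq ⟨X, hX⟩).symm.trans (hd.apply_eq ⟨X, hX⟩)
  exact ⟨⟨traceDual ω, hd, huniq⟩, fun ρ hρ => huniq ρ hρ ▸ hω.isUnit_traceDual hQ hQ'⟩

end DensityOperator

/-! ### Strict positivity of the restricted symbols -/

section LocalState

variable {q : Set.Ico (0 : ℝ) (2 * Real.pi) → Set.Icc (0 : ℝ) 1}

theorem exists_siteEmbedding_eq_siteVec {n : ℕ} {x : Ell2 (Fin n)} (hx : x ≠ 0) :
    ∃ a : ℕ → ℂ, (∃ k < n, a k ≠ 0) ∧ siteEmbedding n x = siteVec n a := by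
  refine ⟨fun k => if h : k < n then coord x ⟨k, h⟩ else 0, ?_, ?_⟩
  · by_contra! h
    refine hx (ext_coord fun k => ?_)
    have := h k k.2
    simpa using this
  · rw [siteEmbedding_apply, siteVec, Finset.sum_range]
    simp

theorem surjective_of_inner_ne_zero {n : ℕ} {A : Ell2 (Fin n) →L[ℂ] Ell2 (Fin n)}
    (h : ∀ x, x ≠ 0 → ⟪x, A x⟫_ℂ ≠ 0) : Function.Surjective A := by
  have hfd : FiniteDimensional ℂ (Ell2 (Fin n)) := by
    have := (LinearMap.ker_eq_bot (f := (LinearMap.pi fun i =>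
      { toFun := fun f => coord f i
        map_add' := fun _ _ => rfl
        map_smul' := fun _ _ => rfl } : Ell2 (Fin n) →ₗ[ℂ] Fin n → ℂ))).2
        (fun f g hfg => ext_coord fun i => congrFun hfg i)
    exact FiniteDimensional.of_injective _ (LinearMap.ker_eq_bot.1 this)
  refine (LinearMap.injective_iff_surjective (f := (A : Ell2 (Fin n) →ₗ[ℂ] Ell2 (Fin n)))).1 ?_
  rw [← LinearMap.ker_eq_bot, LinearMap.ker_eq_bot']
  intro x hx
  by_contra hx0
  refine h x hx0 ?_
  change A x = 0 at hx
  rw [hx, inner_zero_right]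

/-- The quadratic forms of `Q_n` and `1 - Q_n` at a nonzero `x` are integrals of `q` and `1 - q`
against the squared modulus of a nonzero trigonometric polynomial. They are strictly positive, so
both operators are injective and, in finite dimension, surjective. -/
theorem localState_density_isUnit (hq : Measurable q)
    (hq0 : ¬ ∀ᵐ x : ℝ, ∀ hx : x ∈ Set.Ico (0 : ℝ) (2 * Real.pi), (q ⟨x, hx⟩ : ℝ) = 0)
    (hq1 : ¬ ∀ᵐ x : ℝ, ∀ hx : x ∈ Set.Ico (0 : ℝ) (2 * Real.pi), (q ⟨x, hx⟩ : ℝ) = 1) (n : ℕ) :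
    (∃! ρ, IsDensityOperator (localState q hq n) ρ) ∧
      ∀ ρ, IsDensityOperator (localState q hq n) ρ → IsUnit ρ := by
  refine isDensityOperator_unique_isUnit _ (surjective_of_inner_ne_zero fun x hx => ?_)
    (surjective_of_inner_ne_zero fun x hx => ?_)
  · obtain ⟨a, ha, e⟩ := exists_siteEmbedding_eq_siteVec hx
    rw [inner_restrictSymbol, e]
    intro h
    have h1 := inner_siteVec_pos hq hq0 ha
    rw [h] at h1
    exact lt_irrefl _ h1
  · obtain ⟨a, ha, e⟩ := exists_siteEmbedding_eq_siteVec hx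
    have e1 : (1 - restrictSymbol n (translationInvariantSymbol q hq)) x
        = x - restrictSymbol n (translationInvariantSymbol q hq) x := rfl
    have e2 : (1 - translationInvariantSymbol q hq) (siteEmbedding n x)
        = siteEmbedding n x - translationInvariantSymbol q hq (siteEmbedding n x) := rfl
    rw [e1, inner_sub_right, inner_restrictSymbol, ← inner_siteEmbedding n x x, ← inner_sub_right,
      ← e2, e]
    intro h
    have h1 := inner_one_sub_siteVec_pos hq hq1 ha
    rw [h] at h1
    exact lt_irrefl _ h1

end LocalState

end
end Fermi

theorem theorem2 (q r : Set.Ico (0 : ℝ) (2 * Real.pi) → Set.Icc (0 : ℝ) 1)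
    (hq : Measurable q) (hr : Measurable r)
    (α ω : ℝ) (hα : 0 ≤ α) (hαω : α < ω) (hω : ω < 2 * Real.pi)
    (hq0 : ∀ x : Set.Ico (0 : ℝ) (2 * Real.pi), (x : ℝ) ∈ Set.Icc α ω → (q x : ℝ) = 0)
    (hr1 : ∀ x : Set.Ico (0 : ℝ) (2 * Real.pi), (x : ℝ) ∈ Set.Icc α ω → (r x : ℝ) = 1) :
    (∃ c : ℝ, 0 < c ∧ ∃ T : ℕ → Fermi.carAlgebra ℤ,
      (∀ n, (T n : Fermi.FockOp ℤ) ∈ Fermi.localAlgebra n ∧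
        IsStarProjection (T n) ∧ Fermi.IsEven (T n)) ∧
      ∀ n : ℕ, 1 ≤ n →
        ((c * Real.log n : ℝ) : EReal) ≤ Fermi.errorRate (Fermi.chainState q hq) n (1 - T n) ∧
        ((c * Real.log n : ℝ) : EReal) ≤ Fermi.errorRate (Fermi.chainState r hr) n (T n)) ∧
    Fermi.SuperExpDistinguishableBy (fun X => IsStarProjection X ∧ Fermi.IsEven X)
      (Fermi.chainState q hq) (Fermi.chainState r hr) ∧
    ((¬ ∀ᵐ x : ℝ, ∀ hx : x ∈ Set.Ico (0 : ℝ) (2 * Real.pi), (q ⟨x, hx⟩ : ℝ) = 0) →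
      (¬ ∀ᵐ x : ℝ, ∀ hx : x ∈ Set.Ico (0 : ℝ) (2 * Real.pi), (r ⟨x, hx⟩ : ℝ) = 1) →
      ∀ n : ℕ,
        ((∃! ρ, Fermi.IsDensityOperator (Fermi.localState q hq n) ρ) ∧
          ∀ ρ, Fermi.IsDensityOperator (Fermi.localState q hq n) ρ → IsUnit ρ) ∧
        ((∃! ρ, Fermi.IsDensityOperator (Fermi.localState r hr n) ρ) ∧
          ∀ ρ, Fermi.IsDensityOperator (Fermi.localState r hr n) ρ → IsUnit ρ)) := by
  -- The values on the window already exclude `q = 1` and `r = 0` almost everywhere; invertibility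
  -- needs only the other two exclusions as hypotheses.
  have hq1 := Fermi.not_ae_of_eq_on_interval hα hαω hω zero_ne_one hq0
  have hr0 := Fermi.not_ae_of_eq_on_interval hα hαω hω one_ne_zero hr1
  obtain ⟨c, hc, T, hT, hE⟩ := Fermi.exists_tests hq hr hα hαω hω hq0 hr1
  refine ⟨⟨c, hc, T, hT, hE⟩, ⟨T, fun n => ⟨(hT n).1,
    Fermi.isTest_of_isStarProjection (hT n).2.1, (hT n).2⟩,
    Fermi.liminf_errorRate_eq_top hc fun n hn => (hE n hn).1,
    Fermi.liminf_errorRate_eq_top hc fun n hn => (hE n hn).2⟩, fun hq0' hr1' n => ?_⟩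
  exact ⟨Fermi.localState_density_isUnit hq hq0' hq1 n,
    Fermi.localState_density_isUnit hr hr0 hr1' n⟩
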